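/- Let $n,d,d'$ be non-negative integers. There is a constant $C=C(n,d,d')$ such that the following holds for every perfect field $K$ with algebraic closure $\overline K$. "Variety" means a Zariski closed set of $\overline K$-points (not necessarily irreducible); irreducibility, dimension and degree are taken over $\overline K$, and the degree of an irreducible variety $Z\subset\mathbb A^N$ is the number of points in which $Z$ meets a generic plane of dimension $N-\dim Z$. Varieties in $\mathrm{SL}_n$ are viewed in the affine space $\mathbb A^{n^2}$ of $n\times n$ matrices. Let $G<\mathrm{SL}_n$ be a simple linear algebraic group over $K$, that is, an algebraic group defined over $K$ which is connected, is semisimple (it has no non-trivial connected solvable normal algebraic subgroup, even over $\overline K$), and has no proper non-trivial connected normal algebraic subgroup defined over $K$. (No assumption is made on the Lie algebra of $G$.) Let $V,V'\subset G$ be irreducible subvarieties of degrees $d$ and $d'$ with $\dim V<\dim G$ and $\dim V'>0$, and suppose that $V'$ is defined over $K$ (no restriction if $K$ is algebraically closed; so, if $G$ is simple over $\overline K$, taking $\overline K$ as the ground field allows arbitrary $V$ and $V'$). Then there is a proper subvariety $W\subsetneq G$, depending on $G$, $V$ and $V'$, such that for every $g\in G(\overline K)$ outside $W$ the Zariski closure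 $\overline{VgV'}$ has dimension $>\dim V$. Moreover, $W$ has at most $C$ irreducible components, each of degree at most $C$. -/

import Mathlib

open MvPolynomial
open scoped MatrixGroups Pointwise

/-- The `k`-points of the affine space with coordinates indexed by `σ`, to be endowed with the
Zariski topology. -/
def ZariskiSpace (σ k : Type*) : Type _ := σ → k

/-- `Z` is the set of common zeros in `k ^ σ` of a family of polynomials with coefficients in `K`: an affine algebraic set defined over `K`. -/
def IsDefinedOver (K : Type*) {σ k : Type*} [Field K] [Field k] [Algebra K k]
    (Z : Set (ZariskiSpace σ k)) : Prop :=
  ∃ S : Set (MvPolynomial σ K), Z = {x : ZariskiSpace σ k | ∀ p ∈ S, aeval (x : σ → k) p = 0}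

/-- The Zariski topology on `k ^ σ`: the closed sets are the affine algebraic sets. -/
instance ZariskiSpace.instTopologicalSpace (σ k : Type*) [Field k] :
    TopologicalSpace (ZariskiSpace σ k) :=
  TopologicalSpace.ofClosed {Z | IsDefinedOver k Z}
    ⟨{1}, by ext x; simp⟩
    (by
      intro A hA
      have hA' : ∀ Z ∈ A, IsDefinedOver k Z := fun Z hZ => hA hZ
      choose! f hf using hA'
      refine ⟨⋃ Z ∈ A, f Z, ?_⟩
      ext x
      constructor
      · intro h p hp
        obtain ⟨Z, hZ, hp⟩ := Set.mem_iUnion₂.1 hp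
        have hx := h Z hZ
        rw [hf Z hZ] at hx
        exact hx p hp
      · intro h Z hZ
        rw [hf Z hZ]
        exact fun p hp => h p (Set.mem_iUnion₂.2 ⟨Z, hZ, hp⟩))
    (by
      rintro A ⟨S, rfl⟩ B ⟨T, rfl⟩
      refine ⟨{r | ∃ p ∈ S, ∃ q ∈ T, r = p * q}, ?_⟩
      ext x
      constructor
      · rintro (h | h) r ⟨p, hp, q, hq, rfl⟩
        · rw [map_mul, h p hp, zero_mul]
        · rw [map_mul, h q hq, mul_zero]
      · intro h
        by_contra hne
        obtain ⟨h1, h2⟩ := not_or.1 hne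
        apply h1
        intro p hp
        by_contra hpx
        apply h2
        intro q hq
        have hpq := h (p * q) ⟨p, hp, q, hq, rfl⟩
        rw [map_mul] at hpq
        exact (mul_eq_zero.1 hpq).resolve_left hpx)

theorem ZariskiSpace.isClosed_iff {σ k : Type*} [Field k] (Z : Set (ZariskiSpace σ k)) :
    IsClosed Z ↔ IsDefinedOver k Z := by
  rw [← isOpen_compl_iff]
  change Zᶜᶜ ∈ {Z | IsDefinedOver k Z} ↔ _
  rw [compl_compl]
  rfl

/-- The dimension of a subset of affine space: the supremum of the lengths of chains of nonempty
irreducible (relatively) Zariski closed subsets. -/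
noncomputable def zariskiDim {σ k : Type*} [Field k] (Z : Set (ZariskiSpace σ k)) : WithBot ℕ∞ :=
  topologicalKrullDim Z

/-- The irreducible components of `Z`, as subsets of the ambient space: the maximal irreducible
subsets of `Z`. -/
def componentsOf {X : Type*} [TopologicalSpace X] (Z : Set X) : Set (Set X) :=
  {Y | Maximal (fun S => IsIrreducible S ∧ S ⊆ Z) Y}

/-- The affine subspace cut out by the `r` affine equations
`a (i, none) + ∑ j, a (i, some j) * x j = 0`. -/
def affinePlane {σ k : Type*} [Fintype σ] [Field k] {r : ℕ} (a : Fin r × Option σ → k) :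
    Set (ZariskiSpace σ k) :=
  {x | ∀ i, a (i, none) + ∑ j, a (i, some j) * x j = 0}

/-- `Z`, of dimension `r`, has degree `m`: a generic plane of codimension `r` meets `Z` in exactly
`m` points. Generic means: for all systems of `r` affine equations whose coefficients avoid the
zero set of some nonzero polynomial. -/
def HasDegree {σ k : Type*} [Fintype σ] [Field k] (Z : Set (ZariskiSpace σ k)) (m : ℕ) : Prop :=
  ∃ r : ℕ, zariskiDim Z = r ∧
    ∃ P : MvPolynomial (Fin r × Option σ) k, P ≠ 0 ∧
      ∀ a : Fin r × Option σ → k, eval a P ≠ 0 → (Z ∩ affinePlane a).encard = m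

/-- The set of points of the affine space of `n × n` matrices given by a set of elements
of `SL_n`. -/
def points {n : ℕ} {k : Type*} [Field k] (S : Set SL(n, k)) :
    Set (ZariskiSpace (Fin n × Fin n) k) :=
  (fun (g : SL(n, k)) (ij : Fin n × Fin n) => g ij.1 ij.2) '' S

/-- `H` is a connected algebraic subgroup of `SL_n` that is contained in `G` and normal in `G`
(over the algebraically closed field `k`). -/
structure IsConnectedNormalAlgSubgroup {n : ℕ} {k : Type*} [Field k]
    (G H : Subgroup SL(n, k)) : Prop where
  isClosed : IsClosed (points (H : Set SL(n, k)))
  isConnected : IsConnected (points (H : Set SL(n, k)))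
  le : H ≤ G
  normal : (H.subgroupOf G).Normal

/-- For `k` an algebraic closure of `K`: `G` is (the group of `k`-points of) a simple linear
algebraic group over `K` inside `SL_n`, i.e. an algebraic group defined over `K` that is
connected, semisimple (no nontrivial connected solvable normal algebraic subgroup, even over `k`)
and has no proper nontrivial connected normal algebraic subgroup defined over `K`. -/
structure IsSimpleAlgGroup (K : Type*) {k : Type*} [Field K] [Field k] [Algebra K k] {n : ℕ}
    (G : Subgroup SL(n, k)) : Prop where
  isDefinedOver : IsDefinedOver K (points (G : Set SL(n, k)))
  isConnected : IsConnected (points (G : Set SL(n, k)))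
  semisimple : ∀ H : Subgroup SL(n, k),
    IsConnectedNormalAlgSubgroup G H → Group.IsSolvable H → H = ⊥
  simple : ∀ H : Subgroup SL(n, k), IsConnectedNormalAlgSubgroup G H →
    IsDefinedOver K (points (H : Set SL(n, k))) → H = ⊥ ∨ H = G

/-! Fix `g ∈ G`. For `v ∈ V'` the translate `V g v` is closed, irreducible and contained in the
irreducible set `closure (V g V')`. If the latter has no larger dimension than `V`, all these
translates are equal to it, so `V` is stable under right multiplication by `g v w⁻¹ g⁻¹` for all `v,
w ∈ V'` (`mul_mem_of_zariskiDim_closure_le`). Suppose this holds for every `g ∈ G`. The closure of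
the subgroup generated by these elements is normal in `G`, connected because `V'` is irreducible,
non-trivial because `V'` has two points, and defined over `K` by Galois descent, since `K` is
perfect. By simplicity it is `G`, whence `V = G`, against the dimensions
(`IsSimpleAlgGroup.eq_of_mul_subset`). So there are `g₀ ∈ G`, `u ∈ V`, `v, w ∈ V'` with `u g₀ v w⁻¹
g₀⁻¹ ∉ V`. For a polynomial `p` that vanishes on `V` but not at this point, `W = {g ∈ G | p (u g v
w⁻¹ g⁻¹) = 0}` is a proper closed subset containing every exceptional `g`.

To bound `W`, bounds are needed for the degree of `p`, for the degree of `G`, and for the components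
of a hypersurface section. All of them come from the Hilbert function `hilb`, the dimension of the
space of functions of degree at most `t`. A variety of dimension `s` and degree `δ` has `hilb` at
most `c * t ^ s`, with `c` depending only on `s`, `δ` and the ambient dimension
(`HasGenericFinrank.hilb_le_mul_pow`). Conversely, elements that are independent over polynomial
rings in functions of bounded degree produce many independent monomials, so a bound for `hilb`
limits their number (`card_le_of_hilb_le`). This takes the place of Bézout's theorem: it bounds the
degree of the closure of the image of a product (`HasDegree.closure_polyImage_le`) and the sum of
the degrees of the components of a hypersurface section (`exists_hasDegree_sum_le`). A strictly
larger irreducible variety has a Hilbert function of larger order, which gives `p` of bounded degree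
(`exists_separating_of_ssubset`). Finally `G` is reached from `V'` by at most `n * n + 1`
multiplications with translates of `V'`, since each one raises the dimension
(`IsSimpleAlgGroup.exists_hasDegree_le`).

The geometric notions are tied to algebra by two facts: the dimension is the transcendence degree of
the coordinate ring (`zariskiDim_eq`), and the degree is the degree of the function field over the
subfield generated by generic linear forms (`exists_hasDegree`). -/

section Dimension

/-! ### Transcendence degree and Krull's principal ideal theorem. -/

variable {k A : Type*} [Field k] [CommRing A] [IsDomain A] [Algebra k A]

/-- The transcendence degree, as a natural number. -/
noncomputable def tdim (k A : Type*) [Field k] [CommRing A] [Algebra k A] : ℕ :=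
  Cardinal.toNat (Algebra.trdeg k A)

theorem IsTranscendenceBasis.card_eq_tdim {ι : Type*} [Fintype ι] {y : ι → A}
    (hy : IsTranscendenceBasis k y) : Fintype.card ι = tdim k A := by
  have := congrArg Cardinal.toNat hy.lift_cardinalMk_eq_trdeg
  simpa [tdim] using this

omit [IsDomain A] in
theorem AlgebraicIndependent.card_le_tdim [Algebra.FiniteType k A] {ι : Type*} [Fintype ι]
    {y : ι → A} (hy : AlgebraicIndependent k y) : Fintype.card ι ≤ tdim k A := by
  have h := hy.lift_cardinalMk_le_trdeg
  have hfin : Algebra.trdeg k A < Cardinal.aleph0 := trdeg_lt_aleph0_of_finiteType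
  have := Cardinal.toNat_le_toNat h (by simpa using hfin)
  simpa [tdim] using this

theorem AlgebraicIndependent.isTranscendenceBasis_of_tdim_le [Algebra.FiniteType k A]
    {ι : Type*} [Fintype ι] {y : ι → A} (hy : AlgebraicIndependent k y)
    (h : tdim k A ≤ Fintype.card ι) : IsTranscendenceBasis k y := by
  have hfin : Algebra.trdeg k A < Cardinal.aleph0 := trdeg_lt_aleph0_of_finiteType
  apply hy.isTranscendenceBasis_of_lift_trdeg_le hfin
  rw [← Cardinal.cast_toNat_of_lt_aleph0 hfin]
  simpa [tdim] using h

theorem exists_isTranscendenceBasis_fin_of_subset [Algebra.FiniteType k A] {s : Set A}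
    (hs : Algebra.IsAlgebraic (Algebra.adjoin k s) A) :
    ∃ y : Fin (tdim k A) → A, IsTranscendenceBasis k y ∧ ∀ i, y i ∈ s := by
  obtain ⟨t, hts, ht⟩ := exists_isTranscendenceBasis_subset (R := k) s
  have hfin : Algebra.trdeg k A < Cardinal.aleph0 := trdeg_lt_aleph0_of_finiteType
  have h1 := ht.cardinalMk_eq_trdeg
  have : Finite t := by
    rw [← Cardinal.lt_aleph0_iff_finite, h1]; exact hfin
  have := Fintype.ofFinite t
  have hc := ht.card_eq_tdim
  let e : Fin (tdim k A) ≃ t := (Fintype.equivFinOfCardEq hc).symm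
  exact ⟨fun i => e i, ht.comp_equiv e, fun i => hts (e i).2⟩

theorem tdim_eq_of_isAlgebraic {B : Type*} [CommRing B] [IsDomain B] [Algebra k B] [Algebra A B]
    [IsScalarTower k A B] [FaithfulSMul A B] [Algebra.IsAlgebraic A B] :
    tdim k A = tdim k B := by
  have h := lift_trdeg_add_eq k A B
  rw [trdeg_eq_zero (R := A) (A := B)] at h
  have := congrArg Cardinal.toNat h
  simpa [tdim] using this

/-- An ideal of a domain that is algebraic over a subring meets that subring nontrivially. -/
theorem exists_dvd_aeval_of_isTranscendenceBasis {ι : Type*} {y : ι → A}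
    (hy : IsTranscendenceBasis k y) {P : A} (hP : P ≠ 0) :
    ∃ c : MvPolynomial ι k, c ≠ 0 ∧ P ∣ aeval y c := by
  have := hy.isAlgebraic
  have halg : IsAlgebraic (Algebra.adjoin k (Set.range y)) P := this.isAlgebraic P
  obtain ⟨c, hc, hd⟩ := halg.exists_nonzero_dvd (mem_nonZeroDivisors_of_ne_zero hP)
  obtain ⟨c, hc'⟩ := c
  have h2 : c ∈ (aeval y : MvPolynomial ι k →ₐ[k] A).range := by
    rwa [← Algebra.adjoin_range_eq_range_aeval]
  obtain ⟨d, rfl⟩ := h2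
  refine ⟨d, ?_, hd⟩
  rintro rfl
  apply hc
  ext
  simp

theorem exists_isTranscendenceBasis_fin [Algebra.FiniteType k A] :
    ∃ y : Fin (tdim k A) → A, IsTranscendenceBasis k y := by
  obtain ⟨y, hy, -⟩ := exists_isTranscendenceBasis_fin_of_subset (k := k) (A := A) (s := Set.univ)
    (by
      rw [Algebra.adjoin_univ]
      exact ⟨fun a => isAlgebraic_algebraMap (⟨a, trivial⟩ : (⊤ : Subalgebra k A))⟩)
  exact ⟨y, hy⟩

/-- A transcendence basis of `B` lifts to independent elements of `A`. If these were a basis of `A`,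
then `P` would divide a nonzero polynomial in them, and applying `f` would give a relation in `B`.
-/
theorem tdim_lt_of_surjective_of_ker_ne_bot {B : Type*} [CommRing B] [IsDomain B] [Algebra k B]
    [Algebra.FiniteType k A] [Algebra.FiniteType k B] (f : A →ₐ[k] B)
    (hf : Function.Surjective f) {P : A} (hP : P ≠ 0) (hfP : f P = 0) :
    tdim k B < tdim k A := by
  obtain ⟨y, hy⟩ := exists_isTranscendenceBasis_fin (k := k) (A := B)
  choose g hg using hf
  have hcomp : f ∘ (g ∘ y) = y := funext fun i => hg (y i)
  have hind : AlgebraicIndependent k (g ∘ y) :=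
    AlgebraicIndependent.of_comp f (by rw [hcomp]; exact hy.1)
  have hle : tdim k B ≤ tdim k A := by simpa using hind.card_le_tdim
  refine lt_of_le_of_ne hle fun heq => ?_
  have hbas := hind.isTranscendenceBasis_of_tdim_le (by simp [heq])
  obtain ⟨c, hc, d, hd⟩ := exists_dvd_aeval_of_isTranscendenceBasis hbas hP
  apply hc
  apply hy.1.eq_zero_of_aeval_eq_zero
  rw [← hcomp]
  change aeval (fun i => f ((g ∘ y) i)) c = 0
  rw [← comp_aeval_apply, hd, map_mul, hfP, zero_mul]

omit [IsDomain A] in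
theorem tdim_le_of_surjective {B : Type*} [CommRing B] [IsDomain B] [Algebra k B]
    [Algebra.FiniteType k A] [Algebra.FiniteType k B] (f : A →ₐ[k] B)
    (hf : Function.Surjective f) : tdim k B ≤ tdim k A := by
  obtain ⟨y, hy⟩ := exists_isTranscendenceBasis_fin (k := k) (A := B)
  choose g hg using hf
  have hcomp : f ∘ (g ∘ y) = y := funext fun i => hg (y i)
  have hind : AlgebraicIndependent k (g ∘ y) :=
    AlgebraicIndependent.of_comp f (by rw [hcomp]; exact hy.1)
  simpa using hind.card_le_tdim

/-- The variables other than one that occurs in `q` are algebraically independent modulo `q`. -/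
theorem MvPolynomial.algebraicIndependent_of_ker_le_span {s : ℕ} {B : Type*} [CommRing B]
    [Algebra k B] (g : MvPolynomial (Fin s) k →ₐ[k] B) {q : MvPolynomial (Fin s) k}
    {i : Fin s} (hi : 0 < q.degreeOf i) (hker : ∀ f, g f = 0 → q ∣ f) :
    AlgebraicIndependent k (fun j : {j // j ≠ i} => g (X j)) := by
  rw [algebraicIndependent_iff]
  intro p hp
  have h1 : g (rename Subtype.val p) = 0 := by
    rw [← hp]
    have : g.comp (rename Subtype.val) = aeval (fun j : {j // j ≠ i} => g (X j)) := by
      ext j; simp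
    rw [← this]; rfl
  obtain ⟨h, hh⟩ := hker _ h1
  by_contra hp0
  have hne : rename (Subtype.val : {j // j ≠ i} → Fin s) p ≠ 0 := by
    rwa [Ne, map_eq_zero_iff _ (rename_injective _ Subtype.val_injective)]
  rw [hh] at hne
  have h2 := degreeOf_mul_eq (n := i) (left_ne_zero_of_mul hne) (right_ne_zero_of_mul hne)
  rw [← hh] at h2
  have h3 : degreeOf i (rename (Subtype.val : {j // j ≠ i} → Fin s) p) = 0 := by
    classical
    rw [degreeOf_def, Multiset.count_eq_zero, ← Multiset.mem_toFinset]
    intro hmem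
    obtain ⟨j, -, hj⟩ := Finset.mem_image.1 (vars_rename _ _ (by simpa [vars] using hmem))
    exact j.2 hj
  omega

open IntermediateField in

-- Since `b = u / P` lies in `K(P)`, one can take norms from `K(P)` to `K` in `u = P * b`. The norm
-- of `u` is a power of `u`, that of `P` is the constant term up to sign, and that of `b` lies in
-- `R` by integrality.
theorem IsIntegrallyClosed.coeff_zero_minpoly_dvd_pow {R K L : Type*} [CommRing R] [IsDomain R]
    [IsIntegrallyClosed R] [Field K] [Field L] [Algebra R K] [IsFractionRing R K] [Algebra K L]
    [Algebra R L] [IsScalarTower R K L] {P b : L} (hP : P ≠ 0) (hPint : IsIntegral R P)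
    (hb : IsIntegral R b) {u : R} (h : algebraMap R L u = P * b) :
    ∃ n, (minpoly R P).coeff 0 ∣ u ^ n := by
  have hPK : IsIntegral K P := hPint.tower_top
  have hfin : FiniteDimensional K K⟮P⟯ := adjoin.finiteDimensional hPK
  have hfree : Module.Free K K⟮P⟯ := Module.Free.of_divisionRing K _
  have hgen0 : AdjoinSimple.gen K P ≠ 0 := by
    intro h0
    apply hP
    rw [← AdjoinSimple.algebraMap_gen K P, h0, map_zero]
  have hbmem : b ∈ K⟮P⟯ := by
    have : b = algebraMap R L u / P := by rw [h, mul_div_cancel_left₀ _ hP]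
    rw [this, IsScalarTower.algebraMap_apply R K L]
    exact div_mem (K⟮P⟯.algebraMap_mem _) (mem_adjoin_simple_self K P)
  let b' : K⟮P⟯ := ⟨b, hbmem⟩
  have hb'int : IsIntegral R b' := by
    have : IsIntegral R ((K⟮P⟯.val.restrictScalars R) b') := hb
    exact (isIntegral_algHom_iff (K⟮P⟯.val.restrictScalars R) K⟮P⟯.val.injective).1 this
  obtain ⟨r, hr⟩ := IsIntegrallyClosed.isIntegral_iff.1 (Algebra.isIntegral_norm K hb'int)
  have hmul : b' * AdjoinSimple.gen K P = algebraMap K K⟮P⟯ (algebraMap R K u) := by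
    apply Subtype.ext
    change b * P = algebraMap K L (algebraMap R K u)
    rw [← IsScalarTower.algebraMap_apply R K L, h, mul_comm]
  have hN := congrArg (Algebra.norm K) hmul
  have hgen := Algebra.PowerBasis.norm_gen_eq_coeff_zero_minpoly (adjoin.powerBasis hPK)
  rw [adjoin.powerBasis_gen, minpoly_gen,
    minpoly.isIntegrallyClosed_eq_field_fractions' K hPint, Polynomial.coeff_map] at hgen
  rw [map_mul, ← hr, Algebra.norm_algebraMap, hgen] at hN
  refine ⟨Module.finrank K K⟮P⟯, r * (-1) ^ (adjoin.powerBasis hPK).dim, ?_⟩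
  apply IsFractionRing.injective R K
  rw [map_pow, ← hN]
  simp only [map_mul, map_pow, map_neg, map_one]
  ring

/-- If `R` is integrally closed and `P` divides `u ∈ R` in an integral extension, then the constant
term of the minimal polynomial of `P` divides a power of `u`. -/
theorem coeff_zero_minpoly_dvd_pow {R B : Type*} [CommRing R] [IsDomain R] [IsIntegrallyClosed R]
    [CommRing B] [IsDomain B] [Algebra R B] [FaithfulSMul R B] [Algebra.IsIntegral R B]
    {P b : B} (hP : P ≠ 0) {u : R} (h : algebraMap R B u = P * b) :
    ∃ n, (minpoly R P).coeff 0 ∣ u ^ n := by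
  let K := FractionRing R
  let L := FractionRing B
  let : Algebra K L := FractionRing.liftAlgebra R L
  have : IsScalarTower R K L := FractionRing.isScalarTower_liftAlgebra R L
  have h1 := IsIntegrallyClosed.coeff_zero_minpoly_dvd_pow (R := R) (K := K) (L := L)
    (P := algebraMap B L P) (b := algebraMap B L b) (u := u)
    (by simpa using hP) (Algebra.IsIntegral.isIntegral P).algebraMap
    (Algebra.IsIntegral.isIntegral b).algebraMap
    (by rw [← map_mul, ← h, ← IsScalarTower.algebraMap_apply R B L])
  rwa [minpoly.algebraMap_eq (IsFractionRing.injective B L)] at h1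

/-- By Noether normalization `A` is finite over a polynomial ring `R` in `tdim k A` variables. Let
`q` be an irreducible factor of the constant term of the minimal polynomial of `P`. An `f ∈ R` lying
in `p` has a power divisible by `P`, hence by the norm argument a power divisible by `q`, so `q ∣
f`. Therefore all variables but one occurring in `q` stay independent modulo `p`. -/
theorem tdim_le_tdim_quotient_radical_add_one [Algebra.FiniteType k A] (p : Ideal A) [p.IsPrime]
    {P : A} (hP : P ≠ 0) (hp : p = (Ideal.span {P}).radical) :
    tdim k A ≤ tdim k (A ⧸ p) + 1 := by
  obtain ⟨s, g, hginj, hgfin⟩ := exists_finite_inj_algHom_of_fg k A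
  let R := MvPolynomial (Fin s) k
  let : Algebra R A := g.toRingHom.toAlgebra
  have hgmap : ∀ r, algebraMap R A r = g r := fun _ => rfl
  have : IsScalarTower k R A := IsScalarTower.of_algebraMap_eq fun r => by
    exact (g.commutes r).symm
  have : FaithfulSMul R A := (faithfulSMul_iff_algebraMap_injective R A).2 hginj
  have : Algebra.IsIntegral R A := ⟨fun a => hgfin.to_isIntegral a⟩
  have hs : s = tdim k A := by
    rw [← tdim_eq_of_isAlgebraic (k := k) (A := R) (B := A)]
    simp [tdim, R, MvPolynomial.trdeg_of_isDomain]
  let c : R := (minpoly R P).coeff 0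
  have hPint : IsIntegral R P := Algebra.IsIntegral.isIntegral P
  have hc0 : c ≠ 0 := by
    intro h0
    have hX := Polynomial.divX_mul_X_add (minpoly R P)
    rw [show (minpoly R P).coeff 0 = 0 from h0, map_zero, add_zero] at hX
    have hmon : (minpoly R P).divX.Monic :=
      Polynomial.monic_X.of_mul_monic_right
        (hX.symm ▸ minpoly.monic hPint)
    have h1 := minpoly.aeval R P
    rw [← congrArg (Polynomial.aeval P) hX, map_mul, Polynomial.aeval_X] at h1
    have h2 := minpoly.min R P hmon ((mul_eq_zero.1 h1).resolve_right hP)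
    have h3 := Polynomial.natDegree_mul_X hmon.ne_zero
    rw [hX] at h3
    have h4 := Polynomial.natDegree_le_natDegree h2
    omega
  have hPc : P ∣ algebraMap R A c := by
    have h1 := minpoly.aeval R P
    rw [← Polynomial.divX_mul_X_add (minpoly R P)] at h1
    simp only [map_add, map_mul, Polynomial.aeval_X, Polynomial.aeval_C] at h1
    exact ⟨-(Polynomial.aeval P (minpoly R P).divX), by linear_combination h1⟩
  have hPp : P ∈ p := by
    rw [hp]; exact Ideal.le_radical (Ideal.mem_span_singleton_self P)
  have hcp : algebraMap R A c ∈ p := p.mem_of_dvd hPc hPp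
  have hcu : ¬ IsUnit c := fun hu => Ideal.IsPrime.ne_top ‹_›
    (Ideal.eq_top_of_isUnit_mem _ hcp (hu.map (algebraMap R A)))
  obtain ⟨q, hq, hqc⟩ := WfDvdMonoid.exists_irreducible_factor hcu hc0
  have hqd : q.totalDegree ≠ 0 := by
    intro h0
    rw [totalDegree_eq_zero_iff_eq_C] at h0
    apply hq.not_isUnit
    rw [h0]
    refine (isUnit_iff_ne_zero.2 fun h1 => hq.ne_zero ?_).map C
    rw [h0, h1, map_zero]
  have hqi : ∃ i, 0 < q.degreeOf i := by
    by_contra! hcon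
    apply hqd
    rw [totalDegree_eq_zero_iff]
    intro m hm i
    have := (degreeOf_le_iff.1 (hcon i)) m hm
    omega
  obtain ⟨i, hi⟩ := hqi
  have hind := MvPolynomial.algebraicIndependent_of_ker_le_span
    ((Ideal.Quotient.mkₐ k p).comp g) hi (fun f hf => by
      have hfp : g f ∈ p := by
        rw [← Ideal.Quotient.eq_zero_iff_mem]; exact hf
      rw [hp] at hfp
      obtain ⟨m, hm⟩ := hfp
      obtain ⟨b, hb⟩ := Ideal.mem_span_singleton'.1 hm
      obtain ⟨n, hn⟩ := coeff_zero_minpoly_dvd_pow (R := R) (B := A) hP (b := b) (u := f ^ m)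
        (by rw [hgmap, map_pow, ← hb, mul_comm])
      rw [← pow_mul] at hn
      exact hq.prime.dvd_of_dvd_pow (hqc.trans hn))
  have h5 := hind.card_le_tdim
  rw [Fintype.card_subtype_compl, Fintype.card_fin, Fintype.card_subtype_eq] at h5
  omega

/-- Krull's principal ideal theorem for domains of finite type over a field. -/
theorem tdim_le_tdim_quotient_add_one [Algebra.FiniteType k A] {p : Ideal A}
    {P : A} (hP : P ≠ 0) (hp : p ∈ (Ideal.span {P}).minimalPrimes) :
    tdim k A ≤ tdim k (A ⧸ p) + 1 := by
  have hprime : p.IsPrime := hp.1.1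
  have hnoeth : IsNoetherianRing A := Algebra.FiniteType.isNoetherianRing k A
  have hfin := Ideal.finite_minimalPrimes_of_isNoetherianRing A (Ideal.span {P})
  -- Inverting an element outside `p` that lies in all other minimal primes makes `p` the radical of
  -- the ideal of `P`, which is the case already settled.
  obtain ⟨h, hhp, hh⟩ : ∃ h ∉ p, ∀ q ∈ (Ideal.span {P}).minimalPrimes, q ≠ p → h ∈ q := by
    have : ∀ q ∈ (Ideal.span {P}).minimalPrimes, ∃ h ∉ p, q ≠ p → h ∈ q := by
      intro q hq
      by_cases hqp : q = p
      · exact ⟨1, (Ideal.ne_top_iff_one _).1 hprime.ne_top, fun h => absurd hqp h⟩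
      · have : ¬ q ≤ p := fun hle => hqp (le_antisymm hle (hp.2 hq.1 hle))
        obtain ⟨h, h1, h2⟩ := SetLike.not_le_iff_exists.1 this
        exact ⟨h, h2, fun _ => h1⟩
    choose! f hf1 hf2 using this
    refine ⟨∏ q ∈ hfin.toFinset, f q, ?_, fun q hq hqp => ?_⟩
    · rw [hprime.prod_mem_iff]
      push Not
      intro q hq
      exact hf1 q (by simpa using hq)
    · exact Ideal.mem_of_dvd _ (Finset.dvd_prod_of_mem f (by simpa using hq)) (hf2 q hq hqp)
  have hh0 : h ≠ 0 := fun h0 => hhp (h0 ▸ p.zero_mem)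
  let B := Localization.Away h
  have hle : Submonoid.powers h ≤ nonZeroDivisors A :=
    powers_le_nonZeroDivisors_of_noZeroDivisors hh0
  have : IsDomain B := IsLocalization.isDomain_localization hle
  have : FaithfulSMul A B := (faithfulSMul_iff_algebraMap_injective A B).2
    (IsLocalization.injective B hle)
  have : Algebra.IsAlgebraic A B := IsLocalization.isAlgebraic B (Submonoid.powers h)
  have hftA : Algebra.FiniteType A B := IsLocalization.finiteType_of_monoid_fg (Submonoid.powers h) B
  have : Algebra.FiniteType k B := Algebra.FiniteType.trans ‹_› hftA
  have hdisj : Disjoint (Submonoid.powers h : Set A) (p : Set A) := by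
    rw [Ideal.disjoint_powers_iff_notMem_of_isPrime] 
    exact hhp
  let p' : Ideal B := p.map (algebraMap A B)
  have hp' : p'.IsPrime := IsLocalization.isPrime_of_isPrime_disjoint (Submonoid.powers h) B p hprime hdisj
  have hcomap : p'.under A = p :=
    IsLocalization.under_map_of_isPrime_disjoint (Submonoid.powers h) B hprime hdisj
  have hrad : p' = (Ideal.span {algebraMap A B P}).radical := by
    apply le_antisymm
    · rw [Ideal.map_le_iff_le_comap]
      intro a ha
      have hah : a * h ∈ (Ideal.span {P}).radical := by
        rw [← Ideal.sInf_minimalPrimes, Ideal.mem_sInf]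
        intro q hq
        by_cases hqp : q = p
        · exact hqp ▸ p.mul_mem_right _ ha
        · exact q.mul_mem_left _ (hh q hq hqp)
      have h1 : algebraMap A B (a * h) ∈ (Ideal.span {algebraMap A B P}).radical := by
        rw [← Set.image_singleton, ← Ideal.map_span]
        exact Ideal.map_radical_le _ (Ideal.mem_map_of_mem _ hah)
      rw [map_mul] at h1
      have hu : IsUnit (algebraMap A B h) := IsLocalization.Away.algebraMap_isUnit h
      exact Ideal.mem_comap.2 ((Ideal.mul_unit_mem_iff_mem _ hu).1 h1)
    · rw [hp'.isRadical.radical_le_iff, Ideal.span_singleton_le_iff_mem]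
      exact Ideal.mem_map_of_mem _ (hp.1.2 (Ideal.mem_span_singleton_self P))
  have h1 := tdim_le_tdim_quotient_radical_add_one (k := k) p'
    (P := algebraMap A B P) (by simpa using hP) hrad
  rw [tdim_eq_of_isAlgebraic (k := k) (A := A) (B := B)]
  refine h1.trans (Nat.add_le_add_right (le_of_eq ?_) 1)
  have hpp : p ≤ p'.comap (algebraMap A B) := hcomap.ge
  let : Algebra (A ⧸ p) (B ⧸ p') := (Ideal.quotientMap p' (algebraMap A B) hpp).toAlgebra
  have hmap : ∀ a : A, algebraMap (A ⧸ p) (B ⧸ p') (Ideal.Quotient.mk p a)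
      = Ideal.Quotient.mk p' (algebraMap A B a) := fun a => rfl
  have : IsScalarTower k (A ⧸ p) (B ⧸ p') := IsScalarTower.of_algebraMap_eq fun r => rfl
  have : FaithfulSMul (A ⧸ p) (B ⧸ p') := (faithfulSMul_iff_algebraMap_injective _ _).2
    (Ideal.quotientMap_injective' hcomap.le)
  have : Algebra.IsAlgebraic (A ⧸ p) (B ⧸ p') := by
    constructor
    intro b
    obtain ⟨b, rfl⟩ := Ideal.Quotient.mk_surjective b
    obtain ⟨⟨a, ⟨m, hm⟩⟩, hb⟩ := IsLocalization.surj (Submonoid.powers h) b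
    have hmp : Ideal.Quotient.mk p m ≠ 0 := by
      rw [Ne, Ideal.Quotient.eq_zero_iff_mem]
      exact fun hmp => Set.disjoint_left.1 hdisj hm hmp
    refine ⟨Polynomial.C (Ideal.Quotient.mk p m) * Polynomial.X
      - Polynomial.C (Ideal.Quotient.mk p a), fun h0 => ?_, ?_⟩
    · have := congrArg (fun f => Polynomial.coeff f 1) h0
      simp [Polynomial.coeff_C] at this
      exact hmp this
    · simp only [map_sub, map_mul, Polynomial.aeval_C, Polynomial.aeval_X, hmap]
      rw [← map_mul, mul_comm, hb, sub_self]
  exact (tdim_eq_of_isAlgebraic (k := k) (A := A ⧸ p) (B := B ⧸ p')).symm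

end Dimension

/-! ### Zariski closed sets, their coordinate rings and their dimension. -/

section Geometry

variable {σ k : Type*} [Field k]

/-- Evaluation at a point of the affine space. -/
noncomputable def zEval (x : ZariskiSpace σ k) : MvPolynomial σ k →ₐ[k] k :=
  aeval (show σ → k from x)

@[simp] theorem zEval_X (x : ZariskiSpace σ k) (i : σ) : zEval x (X i) = x i := aeval_X _ i

@[simp] theorem zEval_C (x : ZariskiSpace σ k) (a : k) : zEval x (C a) = a := aeval_C _ a

/-- The ideal of polynomials vanishing on `Z`. -/
noncomputable abbrev vI (Z : Set (ZariskiSpace σ k)) : Ideal (MvPolynomial σ k) :=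
  vanishingIdeal k (show Set (σ → k) from Z)

/-- The coordinate ring of `Z`. -/
abbrev CoordRing (Z : Set (ZariskiSpace σ k)) : Type _ := MvPolynomial σ k ⧸ vI Z

/-- The zero set of an ideal. -/
def zSet (I : Ideal (MvPolynomial σ k)) : Set (ZariskiSpace σ k) := zeroLocus k I

theorem mem_vI {Z : Set (ZariskiSpace σ k)} {f : MvPolynomial σ k} :
    f ∈ vI Z ↔ ∀ x ∈ Z, zEval x f = 0 := by
  exact mem_vanishingIdeal_iff

theorem mem_zSet {I : Ideal (MvPolynomial σ k)} {x : ZariskiSpace σ k} :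
    x ∈ zSet I ↔ ∀ f ∈ I, zEval x f = 0 := by
  exact mem_zeroLocus_iff

theorem isClosed_zSet (I : Ideal (MvPolynomial σ k)) : IsClosed (zSet I) := by
  rw [ZariskiSpace.isClosed_iff]
  exact ⟨I, by ext x; rw [mem_zSet]; rfl⟩

theorem isClosed_eval_eq_zero (f : MvPolynomial σ k) :
    IsClosed {x : ZariskiSpace σ k | zEval x f = 0} := by
  rw [ZariskiSpace.isClosed_iff]
  exact ⟨{f}, by ext x; simp [zEval]⟩

theorem zSet_vI_of_isClosed {Z : Set (ZariskiSpace σ k)} (hZ : IsClosed Z) : zSet (vI Z) = Z := by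
  obtain ⟨S, hS⟩ := (ZariskiSpace.isClosed_iff Z).1 hZ
  ext x
  constructor
  · intro hx
    rw [hS]
    intro p hp
    refine mem_zSet.1 hx p (mem_vI.2 fun z hz => ?_)
    rw [hS] at hz
    exact hz p hp
  · intro hx
    exact mem_zSet.2 fun f hf => mem_vI.1 hf x hx

theorem vI_anti {Z Z' : Set (ZariskiSpace σ k)} (h : Z ⊆ Z') : vI Z' ≤ vI Z :=
  fun _ hf => mem_vI.2 fun x hx => mem_vI.1 hf x (h hx)

theorem zSet_anti {I J : Ideal (MvPolynomial σ k)} (h : I ≤ J) : zSet J ⊆ zSet I :=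
  fun _ hx => mem_zSet.2 fun f hf => mem_zSet.1 hx f (h hf)

theorem vI_closure (Z : Set (ZariskiSpace σ k)) : vI (closure Z) = vI Z := by
  refine le_antisymm (vI_anti subset_closure) fun f hf => mem_vI.2 fun x hx => ?_
  exact closure_minimal (s := Z) (t := {x : ZariskiSpace σ k | zEval x f = 0})
    (fun z hz => mem_vI.1 hf z hz) (isClosed_eval_eq_zero f) hx

theorem vI_isPrime {Z : Set (ZariskiSpace σ k)} (hZ : IsIrreducible Z) : (vI Z).IsPrime := by
  constructor
  · rw [Ne, Ideal.eq_top_iff_one, mem_vI]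
    obtain ⟨x, hx⟩ := hZ.1
    intro h
    simpa using h x hx
  · intro f g hfg
    have h := isPreirreducible_iff_isClosed_union_isClosed.1 hZ.2 _ _
      (isClosed_eval_eq_zero f) (isClosed_eval_eq_zero g) (fun x hx => by
        have := mem_vI.1 hfg x hx
        rw [map_mul] at this
        exact mul_eq_zero.1 this)
    exact h.imp (fun h => mem_vI.2 h) (fun h => mem_vI.2 h)

theorem vI_zSet_of_isPrime [IsAlgClosed k] [Finite σ] (I : Ideal (MvPolynomial σ k))
    [h : I.IsPrime] : vI (zSet I) = I :=
  MvPolynomial.IsPrime.vanishingIdeal_zeroLocus I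

theorem isIrreducible_zSet [IsAlgClosed k] [Finite σ] (I : Ideal (MvPolynomial σ k))
    [h : I.IsPrime] : IsIrreducible (zSet I) := by
  constructor
  · by_contra hne
    rw [Set.not_nonempty_iff_eq_empty] at hne
    have := vI_zSet_of_isPrime I
    apply h.ne_top
    rw [← this, hne, Ideal.eq_top_iff_one, mem_vI]
    simp
  · rw [isPreirreducible_iff_isClosed_union_isClosed]
    intro z₁ z₂ h1 h2 hsub
    by_contra! hcon
    obtain ⟨⟨x, hx, hx1⟩, ⟨y, hy, hy2⟩⟩ := hcon.imp Set.not_subset.1 Set.not_subset.1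
    rw [← zSet_vI_of_isClosed h1, mem_zSet] at hx1
    rw [← zSet_vI_of_isClosed h2, mem_zSet] at hy2
    push Not at hx1 hy2
    obtain ⟨f, hf, hfx⟩ := hx1
    obtain ⟨g, hg, hgy⟩ := hy2
    have hfg : f * g ∈ I := by
      rw [← vI_zSet_of_isPrime I, mem_vI]
      intro z hz
      rw [map_mul]
      rcases hsub hz with hz | hz
      · rw [mem_vI.1 hf z hz, zero_mul]
      · rw [mem_vI.1 hg z hz, mul_zero]
    rcases h.mem_or_mem hfg with hfI | hgI
    · exact hfx (mem_zSet.1 hx f hfI)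
    · exact hgy (mem_zSet.1 hy g hgI)

/-- Enlarging an irreducible closed set strictly raises the Krull dimension. -/
theorem add_one_le_topologicalKrullDim {X : Type*} [TopologicalSpace X] {Z₀ Z : Set X}
    (hZ₀ : IsClosed Z₀) (hZ : IsIrreducible Z) (hlt : Z₀ ⊂ Z) {n : ℕ}
    (hn : (n : WithBot ℕ∞) ≤ topologicalKrullDim Z₀) :
    ((n + 1 : ℕ) : WithBot ℕ∞) ≤ topologicalKrullDim Z := by
  obtain ⟨l, hl⟩ := Order.le_krullDim_iff.1 hn
  have hind : Topology.IsInducing (Set.inclusion hlt.subset) :=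
    (Topology.IsEmbedding.inclusion hlt.subset).isInducing
  have : IrreducibleSpace Z := isIrreducible_iff_irreducibleSpace.1 hZ
  let T : TopologicalSpace.IrreducibleCloseds Z :=
    ⟨Set.univ, IrreducibleSpace.isIrreducible_univ _, isClosed_univ⟩
  let l' := l.map _ (TopologicalSpace.IrreducibleCloseds.map_strictMono_of_isInducing hind)
  have hlast : l'.last < T := by
    refine lt_of_le_of_ne (fun _ _ => trivial) fun heq => ?_
    obtain ⟨x, hxZ, hx⟩ := Set.exists_of_ssubset hlt
    have h1 : (⟨x, hxZ⟩ : Z) ∈ (l'.last : Set Z) := by rw [heq]; trivial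
    have h2 : (l'.last : Set Z) ⊆ {z : Z | (z : X) ∈ Z₀} := by
      rw [LTSeries.last_map, TopologicalSpace.IrreducibleCloseds.coe_map]
      refine closure_minimal ?_ (hZ₀.preimage continuous_subtype_val)
      rintro _ ⟨z, -, rfl⟩
      exact z.2
    exact hx (h2 h1)
  refine Order.le_krullDim_iff.2 ⟨l'.snoc T hlast, ?_⟩
  simp [l', hl]

theorem tdim_quotient_eq_of_ker {R B : Type*} [CommRing R] [Algebra k R] [CommRing B] [Algebra k B]
    (f : R →ₐ[k] B) (hf : Function.Surjective f) {q : Ideal R} (hq : RingHom.ker f = q) :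
    tdim k (R ⧸ q) = tdim k B := by
  subst hq
  have h := (Ideal.quotientKerAlgEquivOfSurjective hf).lift_trdeg_eq
  have := congrArg Cardinal.toNat h
  simpa [tdim] using this

theorem tdim_coordRing_lt [Finite σ] {Z₀ Z : Set (ZariskiSpace σ k)}
    (hZ₀ : IsIrreducible Z₀) (hc : IsClosed Z₀) (hZ : IsIrreducible Z) (hlt : Z₀ ⊂ Z) :
    tdim k (CoordRing Z₀) < tdim k (CoordRing Z) := by
  have := vI_isPrime hZ₀
  have := vI_isPrime hZ
  obtain ⟨x, hxZ, hx⟩ := Set.exists_of_ssubset hlt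
  rw [← zSet_vI_of_isClosed hc, mem_zSet] at hx
  push Not at hx
  obtain ⟨f, hf, hfx⟩ := hx
  have hle := vI_anti hlt.subset
  refine tdim_lt_of_surjective_of_ker_ne_bot (Ideal.Quotient.factorₐ k hle)
    (Ideal.Quotient.factor_surjective hle) (P := Ideal.Quotient.mk _ f) ?_ ?_
  · rw [Ne, Ideal.Quotient.eq_zero_iff_mem, mem_vI]
    exact fun h => hfx (h x hxZ)
  · exact Ideal.Quotient.eq_zero_iff_mem.2 hf

theorem tdim_coordRing_zSet_comap [IsAlgClosed k] [Finite σ] {Z : Set (ZariskiSpace σ k)}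
    (p : Ideal (CoordRing Z)) [p.IsPrime] :
    tdim k (CoordRing (zSet (p.comap (Ideal.Quotient.mk (vI Z))))) = tdim k (CoordRing Z ⧸ p) := by
  refine tdim_quotient_eq_of_ker
    ((Ideal.Quotient.mkₐ k p).comp (Ideal.Quotient.mkₐ k (vI Z)))
    (Ideal.Quotient.mk_surjective.comp Ideal.Quotient.mk_surjective) ?_
  rw [vI_zSet_of_isPrime]
  ext f
  exact Ideal.Quotient.eq_zero_iff_mem

/-- A transcendental function minus its value at a point of `Z` is neither zero nor a unit. A
minimal prime over it defines an irreducible closed subset whose transcendence degree drops by at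
most one, and a chain in that subset is prolonged by `Z`. -/
theorem le_zariskiDim [IsAlgClosed k] [Finite σ] (n : ℕ) :
    ∀ Z : Set (ZariskiSpace σ k), IsIrreducible Z → IsClosed Z → n ≤ tdim k (CoordRing Z) →
      (n : WithBot ℕ∞) ≤ zariskiDim Z := by
  induction n with
  | zero =>
    intro Z hZ _ _
    have : IrreducibleSpace Z := isIrreducible_iff_irreducibleSpace.1 hZ
    exact Order.le_krullDim_iff.2 ⟨RelSeries.singleton _
      ⟨Set.univ, IrreducibleSpace.isIrreducible_univ _, isClosed_univ⟩, rfl⟩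
  | succ n ih =>
    intro Z hZ hc hn
    have := vI_isPrime hZ
    obtain ⟨y, hy⟩ := exists_isTranscendenceBasis_fin (k := k) (A := CoordRing Z)
    let i : Fin (tdim k (CoordRing Z)) := ⟨0, by omega⟩
    have htr : Transcendental k (y i) := hy.1.transcendental i
    obtain ⟨z, hz⟩ := hZ.1
    obtain ⟨f, hf⟩ := Ideal.Quotient.mk_surjective (y i)
    let g : MvPolynomial σ k := f - C (zEval z f)
    let P : CoordRing Z := Ideal.Quotient.mk _ g
    have hP : P ≠ 0 := by
      intro h0
      apply htr
      have : y i = algebraMap k _ (zEval z f) := by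
        rw [← sub_eq_zero, ← h0, ← hf]
        simp only [P, g, map_sub]
        rfl
      rw [this]
      exact isAlgebraic_algebraMap _
    have hspan : Ideal.span {P} ≠ ⊤ := by
      intro htop
      have h1 : (1 : CoordRing Z) ∈ Ideal.span {P} := by rw [htop]; trivial
      obtain ⟨b, hb⟩ := Ideal.mem_span_singleton'.1 h1
      obtain ⟨b, rfl⟩ := Ideal.Quotient.mk_surjective b
      have h2 : b * g - 1 ∈ vI Z := by
        rw [← Ideal.Quotient.eq_zero_iff_mem, map_sub, map_mul, map_one, sub_eq_zero]
        exact hb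
      have := mem_vI.1 h2 z hz
      simp [g] at this
    obtain ⟨p, hp⟩ := Ideal.nonempty_minimalPrimes hspan
    have hpp : p.IsPrime := hp.1.1
    have hdim := tdim_le_tdim_quotient_add_one (k := k) hP hp
    let q : Ideal (MvPolynomial σ k) := p.comap (Ideal.Quotient.mk (vI Z))
    have hq : q.IsPrime := Ideal.IsPrime.comap _
    have hqtd := tdim_coordRing_zSet_comap p
    have h1 := ih (zSet q) (isIrreducible_zSet q) (isClosed_zSet q) (by rw [hqtd]; omega)
    have hIq : vI Z ≤ q := fun f hf => by
      change Ideal.Quotient.mk _ f ∈ p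
      rw [Ideal.Quotient.eq_zero_iff_mem.2 hf]
      exact p.zero_mem
    have hsub : zSet q ⊆ Z := by
      rw [← zSet_vI_of_isClosed hc]
      exact zSet_anti hIq
    refine add_one_le_topologicalKrullDim (isClosed_zSet q) hZ ⟨hsub, fun hle => ?_⟩ h1
    have hgq : g ∈ q := hp.1.2 (Ideal.mem_span_singleton_self P)
    rw [← vI_zSet_of_isPrime q] at hgq
    exact hP (Ideal.Quotient.eq_zero_iff_mem.2 (vI_anti hle hgq))

/-- The transcendence degree of the coordinate ring increases strictly along chains of irreducible
closed sets. -/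
theorem zariskiDim_le [Finite σ] {Z : Set (ZariskiSpace σ k)} (hZ : IsIrreducible Z)
    (hc : IsClosed Z) : zariskiDim Z ≤ tdim k (CoordRing Z) := by
  refine iSup_le fun l => ?_
  let F : TopologicalSpace.IrreducibleCloseds Z → Set (ZariskiSpace σ k) :=
    fun Y => Subtype.val '' (Y : Set Z)
  have hFirr : ∀ Y, IsIrreducible (F Y) := fun Y =>
    Y.isIrreducible.image _ continuous_subtype_val.continuousOn
  have hFc : ∀ Y, IsClosed (F Y) := fun Y => hc.isClosedMap_subtype_val _ Y.isClosed
  have hmono : StrictMono fun Y => tdim k (CoordRing (F Y)) := fun Y Y' h =>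
    tdim_coordRing_lt (hFirr Y) (hFc Y) (hFirr Y')
      ⟨Set.image_mono h.le,
        fun hle => h.not_ge ((Set.image_subset_image_iff Subtype.val_injective).1 hle)⟩
  have h1 := (l.map _ hmono).head_add_length_le_nat
  have h2 : tdim k (CoordRing (F l.last)) ≤ tdim k (CoordRing Z) := by
    rcases (show F l.last ⊆ Z from Subtype.coe_image_subset _ _).eq_or_ssubset with h | h
    · rw [h]
    · exact (tdim_coordRing_lt (hFirr _) (hFc _) hZ h).le
  rw [LTSeries.last_map, LTSeries.map_length] at h1
  exact_mod_cast (by omega : l.length ≤ tdim k (CoordRing Z))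

theorem zariskiDim_eq [IsAlgClosed k] [Finite σ] {Z : Set (ZariskiSpace σ k)}
    (hZ : IsIrreducible Z) (hc : IsClosed Z) : zariskiDim Z = tdim k (CoordRing Z) :=
  le_antisymm (zariskiDim_le hZ hc) (le_zariskiDim _ Z hZ hc le_rfl)

end Geometry

/-! ### Counting the points of a generic fibre. -/

section GenericFibre

/-- A ring homomorphism from `Q` to a field that factors through the image of `Q` in `B` extends
to `B` when `B` is contained in a localization of this image at an element not mapped to `0`. -/
theorem RingHom.exists_comp_eq_of_ker_le {Q B k : Type*} [CommRing Q] [CommRing B] [Field k]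
    (ρ : Q →+* B) (ε : Q →+* k) (hker : ∀ q, ρ q = 0 → ε q = 0) (h : Q) (hh : ε h ≠ 0)
    (hB : ∀ b : B, ∃ (n : ℕ) (q : Q), ρ h ^ n * b = ρ q) :
    ∃ φ : B →+* k, φ.comp ρ = ε := by
  choose n q hq using hB
  have key : ∀ b m p, ρ h ^ m * b = ρ p → ε (q b) / ε h ^ n b = ε p / ε h ^ m := by
    intro b m p hp
    rw [div_eq_div_iff (pow_ne_zero _ hh) (pow_ne_zero _ hh), ← sub_eq_zero]
    have := hker (q b * h ^ m - p * h ^ n b) (by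
      simp only [map_sub, map_mul, map_pow, ← hq, ← hp]
      ring)
    simpa using this
  refine ⟨{ toFun := fun b => ε (q b) / ε h ^ n b, map_one' := ?_, map_mul' := fun a b => ?_,
            map_zero' := ?_, map_add' := fun a b => ?_ }, ?_⟩
  · rw [key 1 0 1 (by simp)]; simp
  · change ε (q (a * b)) / ε h ^ n (a * b) = ε (q a) / ε h ^ n a * (ε (q b) / ε h ^ n b)
    rw [key (a * b) (n a + n b) (q a * q b) (by rw [map_mul, ← hq, ← hq]; ring), map_mul, pow_add,
      div_mul_div_comm]
  · rw [key 0 0 0 (by simp)]; simp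
  · change ε (q (a + b)) / ε h ^ n (a + b) = ε (q a) / ε h ^ n a + ε (q b) / ε h ^ n b
    rw [key (a + b) (n a + n b) (h ^ n b * q a + h ^ n a * q b)
      (by simp only [map_add, map_mul, map_pow, ← hq]; ring)]
    have := pow_ne_zero (n a) hh
    have := pow_ne_zero (n b) hh
    simp only [map_add, map_mul, map_pow, pow_add]
    field_simp
  · ext p
    change ε (q (ρ p)) / ε h ^ n (ρ p) = ε p
    rw [key (ρ p) 0 p (by simp)]; simp

variable {R F B L : Type*} [CommRing R] [IsDomain R] [CommRing B] [IsDomain B] [Algebra R B]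
  [Field F] [Field L] [Algebra R F] [IsFractionRing R F] [Algebra B L] [IsFractionRing B L]
  [Algebra F L] [Algebra R L] [IsScalarTower R F L] [IsScalarTower R B L]

theorem exists_algebraMap_mul_eq_algebraMap [Algebra.IsAlgebraic F L] (u : L) :
    ∃ d : R, d ≠ 0 ∧ ∃ b : B, algebraMap R L d * u = algebraMap B L b := by
  obtain ⟨b, c, hc, rfl⟩ := IsFractionRing.div_surjective (A := B) u
  have hc0 : c ≠ 0 := nonZeroDivisors.ne_zero hc
  have h1 : IsAlgebraic R (algebraMap B L c) :=
    (IsFractionRing.isAlgebraic_iff R F L).2 (Algebra.IsAlgebraic.isAlgebraic _)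
  have h2 : IsAlgebraic R c := (isAlgebraic_algebraMap_iff (IsFractionRing.injective B L)).1 h1
  obtain ⟨d, hd, e, he⟩ := h2.exists_nonzero_dvd hc
  refine ⟨d, hd, e * b, ?_⟩
  have hcL : algebraMap B L c ≠ 0 := by simpa using hc0
  rw [IsScalarTower.algebraMap_apply R B L, he]
  simp only [map_mul]
  field_simp

open IntermediateField in

/-- A finite separable extension of fraction fields has a primitive element that lies in the given
subring and is integral over the base ring. -/
theorem exists_primitive_element_monic [FiniteDimensional F L] [Algebra.IsSeparable F L] :
    ∃ (θ : B) (m : Polynomial R), m.Monic ∧ m.natDegree = Module.finrank F L ∧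
      F⟮algebraMap B L θ⟯ = ⊤ ∧ m.map (algebraMap R F) = minpoly F (algebraMap B L θ) := by
  have hscale : ∀ (u : L) (d : R), d ≠ 0 → F⟮u⟯ = ⊤ → F⟮algebraMap R L d * u⟯ = ⊤ := by
    intro u d hd hu
    rw [eq_top_iff, ← hu, adjoin_simple_le_iff]
    have hd' : algebraMap R F d ≠ 0 := by simpa using hd
    have : u = algebraMap F L (algebraMap R F d)⁻¹ * (algebraMap R L d * u) := by
      rw [map_inv₀, ← IsScalarTower.algebraMap_apply R F L, inv_mul_cancel_left₀]
      rw [IsScalarTower.algebraMap_apply R F L]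
      simpa using hd'
    refine Set.mem_of_eq_of_mem this ?_
    exact mul_mem (IntermediateField.algebraMap_mem F⟮algebraMap R L d * u⟯ _) (mem_adjoin_simple_self F _)
  obtain ⟨u, hu⟩ := Field.exists_primitive_element F L
  obtain ⟨d, hd, b, hb⟩ := exists_algebraMap_mul_eq_algebraMap (R := R) (F := F) (B := B) u
  have hb' := hscale u d hd hu
  rw [hb] at hb'
  set p := minpoly F (algebraMap B L b) with hp
  classical
  -- Multiplying the root by a common denominator `e` of the coefficients turns its minimal
  -- polynomial into a monic one with coefficients in `R`.
  obtain ⟨e, he⟩ := IsLocalization.exist_integer_multiples_of_finset (nonZeroDivisors R)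
    ((Finset.range (p.natDegree + 1)).image p.coeff)
  have he0 : (e : R) ≠ 0 := nonZeroDivisors.ne_zero e.2
  have hint : IsIntegral F (algebraMap B L b) := Algebra.IsIntegral.isIntegral _
  have hθ := hscale _ e he0 hb'
  let q := p.scaleRoots (algebraMap R F e)
  have hqm : q.Monic := (Polynomial.monic_scaleRoots_iff _).2 (minpoly.monic hint)
  have hqd : q.natDegree = Module.finrank F L := by
    rw [Polynomial.natDegree_scaleRoots, hp]
    exact (Field.primitive_element_iff_minpoly_natDegree_eq F _).1 hb'
  have hq0 : Polynomial.aeval (algebraMap R L e * algebraMap B L b) q = 0 := by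
    have := Polynomial.scaleRoots_aeval_eq_zero (r := algebraMap R F e) (minpoly.aeval F (algebraMap B L b))
    rwa [← IsScalarTower.algebraMap_apply R F L] at this
  have hmin : minpoly F (algebraMap R L e * algebraMap B L b) = q := by
    refine (minpoly.unique_of_degree_le_degree_minpoly _ _ hqm hq0 ?_).symm
    rw [Polynomial.degree_eq_natDegree hqm.ne_zero, Polynomial.degree_eq_natDegree
      (minpoly.ne_zero (Algebra.IsIntegral.isIntegral _)), hqd,
      (Field.primitive_element_iff_minpoly_natDegree_eq F _).1 hθ]
  have hlift : q ∈ Polynomial.lifts (algebraMap R F) := by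
    rw [Polynomial.lifts_iff_coeff_lifts]
    intro i
    rw [Polynomial.coeff_scaleRoots]
    rcases lt_trichotomy i p.natDegree with hi | hi | hi
    · obtain ⟨r, hr⟩ := he (p.coeff i) (Finset.mem_image_of_mem _ (by simpa using hi.le))
      refine ⟨r * (e : R) ^ (p.natDegree - i - 1), ?_⟩
      rw [map_mul, hr, Algebra.smul_def, map_pow, mul_comm _ (p.coeff i), mul_assoc, ← pow_succ',
        Nat.sub_add_cancel (by omega)]
    · refine ⟨1, ?_⟩
      rw [hi, Polynomial.Monic.coeff_natDegree (minpoly.monic hint)]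
      simp
    · exact ⟨0, by rw [Polynomial.coeff_eq_zero_of_natDegree_lt hi]; simp⟩
  obtain ⟨m, hm, hmd, hmm⟩ := Polynomial.lifts_and_natDegree_eq_and_monic hlift hqm
  refine ⟨algebraMap R B e * b, m, hmm, hmd.trans hqd, ?_, ?_⟩
  · rw [map_mul, ← IsScalarTower.algebraMap_apply R B L]; exact hθ
  · rw [map_mul, ← IsScalarTower.algebraMap_apply R B L, hm, hmin]

omit [IsDomain B] in
-- Every element of `L` is a polynomial in the primitive element over `F`; only the denominators of
-- its coefficients have to be cleared.
theorem exists_algebraMap_mul_eq_aeval [FiniteDimensional F L] {θ : B}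
    (hθ : IntermediateField.adjoin F {algebraMap B L θ} = ⊤) (b : B) :
    ∃ (d : R) (g : Polynomial R), d ≠ 0 ∧ algebraMap R B d * b = Polynomial.aeval θ g := by
  have h1 : algebraMap B L b ∈ IntermediateField.adjoin F {algebraMap B L θ} := by
    rw [hθ]; trivial
  rw [← IntermediateField.mem_toSubalgebra,
    IntermediateField.adjoin_simple_toSubalgebra_of_isAlgebraic (Algebra.IsAlgebraic.isAlgebraic _),
    Algebra.adjoin_singleton_eq_range_aeval] at h1
  obtain ⟨g, hg⟩ := h1
  obtain ⟨d, hd0, hd⟩ := IsLocalization.integerNormalization_spec (nonZeroDivisors R) g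
  refine ⟨d, IsLocalization.integerNormalization (nonZeroDivisors R) g,
    nonZeroDivisors.ne_zero hd0, IsFractionRing.injective B L ?_⟩
  rw [map_mul, ← IsScalarTower.algebraMap_apply R B L, ← Polynomial.aeval_algebraMap_apply,
    ← Polynomial.aeval_map_algebraMap F, hd, Algebra.smul_def,
    map_mul, IsScalarTower.algebraMap_apply R F (Polynomial F), Polynomial.algebraMap_apply,
    Polynomial.aeval_C, Algebra.algebraMap_self, RingHom.id_apply,
    ← IsScalarTower.algebraMap_apply R F L]
  exact congrArg _ hg.symm

/-- The number of points of a generic fibre of a generically finite separable extension is its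
degree. -/
theorem exists_natCard_ringHom_eq_finrank [FiniteDimensional F L] [Algebra.IsSeparable F L]
    [Algebra.FiniteType R B] (k : Type*) [Field k] [IsAlgClosed k] :
    ∃ f : R, f ≠ 0 ∧ ∀ ev : R →+* k, ev f ≠ 0 →
      Nat.card {φ : B →+* k // φ.comp (algebraMap R B) = ev} = Module.finrank F L := by
  classical
  obtain ⟨θ, m, hmm, hmd, hθ, hmin⟩ :=
    exists_primitive_element_monic (R := R) (F := F) (B := B) (L := L)
  obtain ⟨S, hS⟩ := ‹Algebra.FiniteType R B›
  choose d g hd hg using fun b : B => exists_algebraMap_mul_eq_aeval (R := R) (F := F) hθ b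
  -- With this common denominator for a finite set of generators, `B` becomes contained in `R[θ]`
  -- after inverting `h`.
  let h : R := ∏ b ∈ S, d b
  have hh : h ≠ 0 := Finset.prod_ne_zero_iff.2 fun b _ => hd b
  have hB : ∀ b : B, ∃ (n : ℕ) (q : Polynomial R), algebraMap R B h ^ n * b = Polynomial.aeval θ q := by
    intro b
    have hb : b ∈ Algebra.adjoin R (S : Set B) := by rw [hS]; trivial
    induction hb using Algebra.adjoin_induction with
    | mem x hx =>
      obtain ⟨c, hc⟩ := Finset.dvd_prod_of_mem d hx
      refine ⟨1, Polynomial.C c * g x, ?_⟩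
      rw [pow_one, map_mul, ← hg, Polynomial.aeval_C, show h = d x * c from hc, map_mul]
      ring
    | algebraMap r => exact ⟨0, Polynomial.C r, by simp⟩
    | add x y _ _ hx hy =>
      obtain ⟨n, p, hp⟩ := hx
      obtain ⟨n', q, hq⟩ := hy
      refine ⟨n + n', Polynomial.C h ^ n' * p + Polynomial.C h ^ n * q, ?_⟩
      simp only [map_add, map_mul, map_pow, Polynomial.aeval_C, ← hp, ← hq]
      ring
    | mul x y _ _ hx hy =>
      obtain ⟨n, p, hp⟩ := hx
      obtain ⟨n', q, hq⟩ := hy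
      refine ⟨n + n', p * q, ?_⟩
      simp only [map_mul, ← hp, ← hq]
      ring
  have hmθ : Polynomial.aeval θ m = 0 := by
    apply IsFractionRing.injective B L
    rw [map_zero, ← Polynomial.aeval_algebraMap_apply, ← Polynomial.aeval_map_algebraMap F, hmin, minpoly.aeval]
  have hker : ∀ q : Polynomial R, Polynomial.aeval θ q = 0 → m ∣ q := by
    intro q hq
    rw [← Polynomial.modByMonic_eq_zero_iff_dvd hmm]
    by_contra hne
    have h1 : Polynomial.aeval θ (Polynomial.modByMonic q m) = 0 := by
      have := Polynomial.modByMonic_add_div q m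
      rw [← this] at hq
      simpa [hmθ] using hq
    have h2 : Polynomial.aeval (algebraMap B L θ) ((Polynomial.modByMonic q m).map (algebraMap R F)) = 0 := by
      rw [Polynomial.aeval_map_algebraMap, Polynomial.aeval_algebraMap_apply, h1, map_zero]
    have h3 := minpoly.degree_le_of_ne_zero F (algebraMap B L θ)
      (by rwa [Ne, Polynomial.map_eq_zero_iff (IsFractionRing.injective R F)]) h2
    rw [← hmin, Polynomial.degree_map_eq_of_injective (IsFractionRing.injective R F),
      Polynomial.degree_map_eq_of_injective (IsFractionRing.injective R F)] at h3
    exact absurd h3 (not_le.2 (Polynomial.degree_modByMonic_lt q hmm))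
  -- Clearing denominators in a Bézout identity for `m` and its derivative gives an `s` such that
  -- `m` stays separable under every specialization with `ev s ≠ 0`.
  obtain ⟨s, hs, u, v, huv⟩ : ∃ s : R, s ≠ 0 ∧ ∃ u v : Polynomial R, u * m + v * Polynomial.derivative m = Polynomial.C s := by
    have hsep : (minpoly F (algebraMap B L θ)).Separable := Algebra.IsSeparable.isSeparable F _
    rw [← hmin] at hsep
    obtain ⟨u, v, huv⟩ := hsep
    obtain ⟨a, ha0, ha⟩ := IsLocalization.integerNormalization_spec (nonZeroDivisors R) u
    obtain ⟨b, hb0, hb⟩ := IsLocalization.integerNormalization_spec (nonZeroDivisors R) v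
    refine ⟨a * b, mul_ne_zero (nonZeroDivisors.ne_zero ha0) (nonZeroDivisors.ne_zero hb0),
      Polynomial.C b * IsLocalization.integerNormalization (nonZeroDivisors R) u,
      Polynomial.C a * IsLocalization.integerNormalization (nonZeroDivisors R) v, ?_⟩
    apply Polynomial.map_injective _ (IsFractionRing.injective R F)
    simp only [Polynomial.map_add, Polynomial.map_mul, ha, hb, Polynomial.map_C,
      ← Polynomial.derivative_map, map_mul, Algebra.smul_def]
    simp only [Polynomial.algebraMap_apply]
    linear_combination (Polynomial.C (algebraMap R F a) * Polynomial.C (algebraMap R F b)) * huv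
  refine ⟨h * s, mul_ne_zero hh hs, fun ev hev => ?_⟩
  rw [map_mul] at hev
  have hevh := left_ne_zero_of_mul hev
  have hevs := right_ne_zero_of_mul hev
  have hsepm : (m.map ev).Separable := by
    refine ⟨Polynomial.C (ev s)⁻¹ * u.map ev, Polynomial.C (ev s)⁻¹ * v.map ev, ?_⟩
    have h1 := congrArg (Polynomial.map ev) huv
    simp only [Polynomial.map_add, Polynomial.map_mul, Polynomial.map_C, ← Polynomial.derivative_map] at h1
    rw [mul_assoc, mul_assoc, ← mul_add, h1, ← Polynomial.C_mul, inv_mul_cancel₀ hevs, Polynomial.C_1]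
  have hcard : Fintype.card ((m.map ev).rootSet k) = Module.finrank F L := by
    rw [Polynomial.card_rootSet_eq_natDegree hsepm (IsAlgClosed.splits _), hmm.natDegree_map, hmd]
  rw [← hcard, ← Nat.card_eq_fintype_card]
  have hroot : ∀ t : k, t ∈ (m.map ev).rootSet k ↔ Polynomial.eval₂ ev t m = 0 := by
    intro t
    rw [Polynomial.mem_rootSet_of_ne (hmm.map ev).ne_zero, Polynomial.coe_aeval_eq_eval, Polynomial.eval_map]
  have hφ : ∀ (φ : B →+* k), φ.comp (algebraMap R B) = ev → ∀ p : Polynomial R,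
      φ (Polynomial.aeval θ p) = Polynomial.eval₂ ev (φ θ) p := by
    intro φ hφ p
    rw [Polynomial.aeval_def, Polynomial.hom_eval₂, hφ]
  -- A homomorphism over `ev` is determined by the image of `θ`, because `h` becomes invertible, and
  -- this image can be any root of the specialized polynomial `m`.
  refine Nat.card_congr (Equiv.ofBijective
    (fun φ => ⟨φ.1 θ, (hroot _).2 (by rw [← hφ φ.1 φ.2, hmθ, map_zero])⟩) ⟨?_, ?_⟩)
  · rintro ⟨φ, hφ1⟩ ⟨ψ, hψ1⟩ heq
    have heq' : φ θ = ψ θ := congrArg Subtype.val heq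
    apply Subtype.ext
    ext b
    obtain ⟨n, q, hq⟩ := hB b
    have h1 := congrArg φ hq
    have h2 := congrArg ψ hq
    rw [hφ φ hφ1, map_mul, map_pow, ← RingHom.comp_apply, hφ1] at h1
    rw [hφ ψ hψ1, map_mul, map_pow, ← RingHom.comp_apply, hψ1, ← heq', ← h1] at h2
    exact (mul_left_cancel₀ (pow_ne_zero n hevh) h2).symm
  · rintro ⟨t, ht⟩
    rw [hroot] at ht
    obtain ⟨φ, hφ'⟩ := RingHom.exists_comp_eq_of_ker_le (Polynomial.aeval θ : Polynomial R →ₐ[R] B).toRingHom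
      (Polynomial.eval₂RingHom ev t) (fun q hq => by
        obtain ⟨w, rfl⟩ := hker q hq
        simp [ht]) (Polynomial.C h) (by simpa using hevh) (fun b => by
        obtain ⟨n, q, hq⟩ := hB b
        exact ⟨n, q, by simpa using hq⟩)
    refine ⟨⟨φ, ?_⟩, ?_⟩
    · ext r
      simpa using congrArg (fun f => f (Polynomial.C r)) hφ'
    · apply Subtype.ext
      simpa using congrArg (fun f => f Polynomial.X) hφ'

end GenericFibre

/-! ### Separability of generic linear projections, by differentials. -/

section GenericProjection

/-- The kernel of `D` is a field, so it contains the field generated by `S`. If `p` is the minimal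
polynomial of `z` over that field, then `0 = D (p z) = p' z • D z` with `p' z ≠ 0` by separability.
-/
theorem Derivation.eq_zero_of_isSeparable_adjoin {k L M : Type*} [Field k] [Field L] [Algebra k L]
    [AddCommGroup M] [Module k M] [Module L M] [IsScalarTower k L M] (D : Derivation k L M)
    (S : Set L) (hS : ∀ z ∈ S, D z = 0) [Algebra.IsSeparable (IntermediateField.adjoin k S) L]
    (z : L) : D z = 0 := by
  let E : IntermediateField k L :=
    { carrier := {z | D z = 0}
      mul_mem' := fun {a b} ha hb => by
        change D (a * b) = 0
        rw [D.leibniz, show D a = 0 from ha, show D b = 0 from hb]; simp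
      add_mem' := fun {a b} ha hb => by
        change D (a + b) = 0
        rw [map_add, show D a = 0 from ha, show D b = 0 from hb, add_zero]
      algebraMap_mem' := fun r => D.map_algebraMap r
      inv_mem' := fun a ha => by
        change D a⁻¹ = 0
        rw [D.leibniz_inv, show D a = 0 from ha, smul_zero] }
  have hE : IntermediateField.adjoin k S ≤ E := IntermediateField.adjoin_le_iff.2 hS
  let p := minpoly (IntermediateField.adjoin k S) z
  have hsep : p.Separable := Algebra.IsSeparable.isSeparable _ z
  have hformula : ∀ q : Polynomial (IntermediateField.adjoin k S),
      D (Polynomial.aeval z q) = Polynomial.aeval z (Polynomial.derivative q) • D z := by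
    intro q
    induction q using Polynomial.induction_on' with
    | add p q hp hq => simp [map_add, hp, hq, add_smul]
    | monomial n a =>
      have ha : D (a : L) = 0 := hE a.2
      simp only [Polynomial.aeval_monomial, Polynomial.derivative_monomial, D.leibniz, D.leibniz_pow]
      rw [show (algebraMap (IntermediateField.adjoin k S) L a) = (a : L) from rfl, ha]
      simp only [smul_zero, add_zero, map_mul, ← smul_assoc]
      congr 1
      simp only [nsmul_eq_mul, smul_eq_mul]
      have hn : algebraMap (IntermediateField.adjoin k S) L n = n :=
        _root_.map_natCast (algebraMap (IntermediateField.adjoin k S) L) n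
      rw [show (algebraMap (IntermediateField.adjoin k S) L a) = (a : L) from rfl, hn]
      ring
  have h1 := hformula p
  rw [minpoly.aeval, map_zero] at h1
  refine (smul_eq_zero.1 h1.symm).resolve_left ?_
  exact hsep.aeval_derivative_ne_zero (minpoly.aeval _ z)

theorem KaehlerDifferential.span_eq_top_of_isSeparable_adjoin {k L : Type*} [Field k] [Field L]
    [Algebra k L] (S : Set L) [Algebra.IsSeparable (IntermediateField.adjoin k S) L] :
    Submodule.span L (KaehlerDifferential.D k L '' S) = ⊤ := by
  rw [eq_top_iff, ← KaehlerDifferential.span_range_derivation, Submodule.span_le]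
  rintro _ ⟨z, rfl⟩
  let N := Submodule.span L (KaehlerDifferential.D k L '' S)
  let D' : Derivation k L (Ω[L⁄k] ⧸ N) := N.mkQ.compDer (KaehlerDifferential.D k L)
  have h := D'.eq_zero_of_isSeparable_adjoin S (fun z hz => by
    change N.mkQ (KaehlerDifferential.D k L z) = 0
    rw [Submodule.mkQ_apply, Submodule.Quotient.mk_eq_zero]
    exact Submodule.subset_span ⟨z, hz, rfl⟩) z
  change N.mkQ (KaehlerDifferential.D k L z) = 0 at h
  rwa [Submodule.mkQ_apply, Submodule.Quotient.mk_eq_zero] at h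

/-- Over a perfect field there is a separating transcendence basis, and the differentials of its
members span all differentials. -/
theorem finrank_kaehlerDifferential_le {k L : Type*} [Field k] [PerfectField k] [Field L]
    [Algebra k L] [Algebra.EssFiniteType k L] : Module.finrank L Ω[L⁄k] ≤ tdim k L := by
  classical
  obtain ⟨s, hs, hsep⟩ := exists_isTranscendenceBasis_and_isSeparable_of_perfectField k L
  have h := KaehlerDifferential.span_eq_top_of_isSeparable_adjoin (k := k) (s : Set L)
  rw [← hs.card_eq_tdim, ← finrank_top, ← h, ← Finset.coe_image]
  refine (finrank_span_finset_le_card _).trans ?_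
  simpa using Finset.card_image_le

/-- Let `x` generate `L` over a perfect field. For `a` outside of a hypersurface, a derivation that
kills `a` and the `s` linear combinations of the `x j` with coefficients `a` also kills `x`. -/
theorem exists_generic_derivation_eq_zero {k L σ : Type*} [Field k] [PerfectField k] [Field L]
    [Algebra k L] [Algebra.EssFiniteType k L] [Fintype σ] (x : σ → L)
    (hx : IntermediateField.adjoin k (Set.range x) = ⊤) :
    ∃ G : MvPolynomial (Fin (tdim k L) × σ) L, G ≠ 0 ∧
      ∀ (M N : Type*) [Field M] [Algebra L M] [Algebra k M] [IsScalarTower k L M] [AddCommGroup N]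
        [Module k N] [Module L N] [Module M N] [IsScalarTower k M N] [IsScalarTower L M N]
        [IsScalarTower k L N] (D : Derivation k M N) (a : Fin (tdim k L) × σ → M),
        aeval a G ≠ 0 → (∀ i, D (a i) = 0) →
        (∀ i, D (∑ j, a (i, j) * algebraMap L M (x j)) = 0) →
        ∀ j, D (algebraMap L M (x j)) = 0 := by
  classical
  have hsepx : Algebra.IsSeparable (IntermediateField.adjoin k (Set.range x)) L := by
    rw [hx]
    exact ⟨fun z => isSeparable_algebraMap (⟨z, trivial⟩ : (⊤ : IntermediateField k L))⟩
  have hspan := KaehlerDifferential.span_eq_top_of_isSeparable_adjoin (k := k) (Set.range x)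
  obtain ⟨f, hf, hfspan, hfli⟩ := Submodule.exists_fun_fin_finrank_span_eq L
    (KaehlerDifferential.D k L '' Set.range x)
  replace hfspan := hfspan.trans hspan
  have hq : Module.finrank L (Submodule.span L (KaehlerDifferential.D k L '' Set.range x))
      ≤ tdim k L := by
    rw [hspan, finrank_top]
    exact finrank_kaehlerDifferential_le
  generalize Module.finrank L (Submodule.span L (KaehlerDifferential.D k L '' Set.range x)) = q
    at f hf hfspan hfli hq
  have hf' : ∀ l, ∃ j, KaehlerDifferential.D k L (x j) = f l := by
    intro l
    obtain ⟨_, ⟨j, rfl⟩, hj⟩ := hf l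
    exact ⟨j, hj⟩
  choose e he using hf'
  let b : Module.Basis (Fin q) L Ω[L⁄k] := Module.Basis.mk hfli hfspan.ge
  have hb : ∀ l, b l = KaehlerDifferential.D k L (x (e l)) := fun l => by
    rw [Module.Basis.mk_apply, he]
  let c : σ → Fin q → L := fun j l => b.repr (KaehlerDifferential.D k L (x j)) l
  have hce : ∀ i l, c (e i) l = if i = l then 1 else 0 := fun i l => by
    simp only [c, ← hb, Module.Basis.repr_self, Finsupp.single_apply]
  -- The `d x (e l)` form a basis of the differentials. This matrix expresses in that basis the
  -- differentials of the first `q` generic forms, with the coefficients of the forms treated as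
  -- constants; `G` is its determinant.
  let m : Matrix (Fin q) (Fin q) (MvPolynomial (Fin (tdim k L) × σ) L) :=
    Matrix.of fun i l => ∑ j, X (Fin.castLE hq i, j) * C (c j l)
  refine ⟨m.det, fun h0 => ?_, ?_⟩
  · let a₀ : Fin (tdim k L) × σ → L := fun p =>
      if h : (p.1 : ℕ) < q then if p.2 = e ⟨p.1, h⟩ then 1 else 0 else 0
    have h1 := congrArg (aeval a₀) h0
    rw [AlgHom.map_det, map_zero] at h1
    have : (aeval a₀ : _ →ₐ[L] L).mapMatrix m = 1 := by
      ext i l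
      simp [m, a₀, hce, Matrix.one_apply]
    rw [this, Matrix.det_one] at h1
    exact one_ne_zero h1
  · intro M N _ _ _ _ _ _ _ _ _ _ _ D a ha hDa hDy
    rw [AlgHom.map_det] at ha
    set m' : Matrix (Fin q) (Fin q) M := (aeval a).mapMatrix m with hm'
    have hm'a : ∀ i l, m' i l = ∑ j, a (Fin.castLE hq i, j) * algebraMap L M (c j l) := by
      intro i l
      simp [hm', m]
    let D' : Derivation k L N := D.compAlgebraMap L
    have hD' : ∀ z, D' z = D (algebraMap L M z) := fun z => rfl
    have hexp : ∀ j, D (algebraMap L M (x j))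
        = ∑ l, algebraMap L M (c j l) • D (algebraMap L M (x (e l))) := by
      intro j
      have h1 := b.sum_repr (KaehlerDifferential.D k L (x j))
      have h2 := congrArg D'.liftKaehlerDifferential h1
      simp only [map_sum, map_smul, hb, Derivation.liftKaehlerDifferential_comp_D, hD'] at h2
      rw [← h2]
      exact Finset.sum_congr rfl fun l _ => (algebraMap_smul M _ _).symm
    have hsum : ∀ i, ∑ l, m' i l • D (algebraMap L M (x (e l))) = 0 := by
      intro i
      have h1 := hDy (Fin.castLE hq i)
      simp only [map_sum, D.leibniz, hDa, smul_zero, add_zero] at h1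
      simp only [hm'a, Finset.sum_smul]
      rw [Finset.sum_comm, ← h1]
      refine Finset.sum_congr rfl fun j _ => ?_
      rw [hexp j, Finset.smul_sum]
      exact Finset.sum_congr rfl fun l _ => mul_smul _ _ _
    have hzero : ∀ h, D (algebraMap L M (x (e h))) = 0 := by
      intro h
      have hinv : m'⁻¹ * m' = 1 := Matrix.nonsing_inv_mul m' (isUnit_iff_ne_zero.2 ha)
      have h1 : ∑ i, m'⁻¹ h i • ∑ l, m' i l • D (algebraMap L M (x (e l))) = 0 := by
        simp [hsum]
      simp only [Finset.smul_sum, smul_smul] at h1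
      rw [Finset.sum_comm] at h1
      simp only [← Finset.sum_smul, ← Matrix.mul_apply, hinv, Matrix.one_apply] at h1
      simpa using h1
    intro j
    rw [hexp j]
    simp [hzero]

/-- For `a` outside of a hypersurface, the extension `M = k(a, x)` is finite and separable over a
subfield containing `a` and the linear combinations of the `x j` with coefficients `a`. -/
theorem exists_generic_finite_separable {k L σ : Type*} [Field k] [PerfectField k] [Field L]
    [Algebra k L] [Algebra.EssFiniteType k L] [Fintype σ] (x : σ → L)
    (hx : IntermediateField.adjoin k (Set.range x) = ⊤) :
    ∃ G : MvPolynomial (Fin (tdim k L) × σ) L, G ≠ 0 ∧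
      ∀ (M : Type*) [Field M] [Algebra L M] [Algebra k M] [IsScalarTower k L M]
        [Algebra.EssFiniteType k M] (F : IntermediateField k M) (a : Fin (tdim k L) × σ → M),
        aeval a G ≠ 0 → (∀ i, a i ∈ F) → (∀ i, ∑ j, a (i, j) * algebraMap L M (x j) ∈ F) →
        IntermediateField.adjoin k (Set.range a ∪ Set.range fun j => algebraMap L M (x j)) = ⊤ →
        FiniteDimensional F M ∧ Algebra.IsSeparable F M := by
  obtain ⟨G, hG, h⟩ := exists_generic_derivation_eq_zero x hx
  refine ⟨G, hG, ?_⟩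
  intro M _ _ _ _ _ F a ha haF hyF htop
  have hess : Algebra.EssFiniteType F M := Algebra.EssFiniteType.of_comp k F M
  -- The universal derivation over `F` kills `a` and the linear forms, hence also `x`, and these
  -- generate `M`. So there are no differentials, and an unramified extension that is essentially of
  -- finite type is finite and separable.
  let D : Derivation k M Ω[M⁄F] := (KaehlerDifferential.D F M).restrictScalars k
  have hDF : ∀ z ∈ F, D z = 0 := fun z hz =>
    (KaehlerDifferential.D F M).map_algebraMap (⟨z, hz⟩ : F)
  have hx0 := h M Ω[M⁄F] D a ha (fun i => hDF _ (haF i)) (fun i => hDF _ (hyF i))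
  have hsep : Algebra.IsSeparable (IntermediateField.adjoin k
      (Set.range a ∪ Set.range fun j => algebraMap L M (x j))) M := by
    rw [htop]
    exact ⟨fun z => isSeparable_algebraMap (⟨z, trivial⟩ : (⊤ : IntermediateField k M))⟩
  have hD0 := D.eq_zero_of_isSeparable_adjoin
    (Set.range a ∪ Set.range fun j => algebraMap L M (x j)) (by
      rintro _ (⟨i, rfl⟩ | ⟨j, rfl⟩)
      · exact hDF _ (haF i)
      · exact hx0 j)
  have hsub : Subsingleton Ω[M⁄F] := by
    refine Submodule.subsingleton_iff M |>.1 (subsingleton_of_bot_eq_top ?_)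
    rw [← KaehlerDifferential.span_range_derivation, eq_comm, Submodule.span_eq_bot]
    rintro _ ⟨z, rfl⟩
    exact hD0 z
  have hunr : Algebra.FormallyUnramified F M := ⟨hsub⟩
  exact ⟨Algebra.FormallyUnramified.finite_of_free F M,
    Algebra.FormallyUnramified.isSeparable F M⟩

end GenericProjection

/-! ### Fibres over affine space and manipulation of genericity conditions. -/

theorem isTranscendenceBasis_of_isAlgebraic_adjoin {k M ι : Type*} [Field k] [Field M] [Algebra k M]
    [Fintype ι] (w : ι → M) [Algebra.IsAlgebraic (IntermediateField.adjoin k (Set.range w)) M]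
    (h : Fintype.card ι ≤ tdim k M) : IsTranscendenceBasis k w := by
  have : Algebra.IsAlgebraic (Algebra.adjoin k (Set.range w)) M :=
    IntermediateField.isAlgebraic_adjoin_iff_top.1 inferInstance
  apply Algebra.IsAlgebraic.isTranscendenceBasis_of_lift_le_trdeg_of_finite
  have h1 : (tdim k M : Cardinal) ≤ Algebra.trdeg k M := by
    unfold tdim
    rcases lt_or_ge (Algebra.trdeg k M) Cardinal.aleph0 with hlt | hge
    · rw [Cardinal.cast_toNat_of_lt_aleph0 hlt]
    · rw [Cardinal.toNat_apply_of_aleph0_le hge]; simp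
  have h2 : ((Fintype.card ι : ℕ) : Cardinal) ≤ Algebra.trdeg k M :=
    le_trans (by exact_mod_cast h) h1
  have h3 := Cardinal.lift_le.2 h2
  rw [Cardinal.lift_natCast] at h3
  rw [Cardinal.mk_fintype, Cardinal.lift_natCast]
  exact h3

open scoped IntermediateField.algebraAdjoinAdjoin in
-- This is the count of generic fibres for the polynomial ring in `w`, whose fraction field is
-- realized as the subfield of `M` generated by `w`.
theorem exists_natCard_algHom_eq_finrank {k B M τ : Type*} [Field k] [IsAlgClosed k] [CommRing B]
    [IsDomain B] [Algebra k B] [Algebra.FiniteType k B] [Field M] [Algebra B M] [IsFractionRing B M]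
    [Algebra k M] [IsScalarTower k B M] (w : τ → B) (hw : AlgebraicIndependent k w)
    [FiniteDimensional (IntermediateField.adjoin k (Set.range (algebraMap B M ∘ w))) M]
    [Algebra.IsSeparable (IntermediateField.adjoin k (Set.range (algebraMap B M ∘ w))) M] :
    ∃ f : MvPolynomial τ k, f ≠ 0 ∧ ∀ a : τ → k, eval a f ≠ 0 →
      Nat.card {φ : B →ₐ[k] k // ∀ i, φ (w i) = a i} =
        Module.finrank (IntermediateField.adjoin k (Set.range (algebraMap B M ∘ w))) M := by
  let F := IntermediateField.adjoin k (Set.range (algebraMap B M ∘ w))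
  have hw' : AlgebraicIndependent k (algebraMap B M ∘ w) :=
    hw.map' (f := IsScalarTower.toAlgHom k B M) (IsFractionRing.injective B M)
  let i1 : Algebra (MvPolynomial τ k) B := (aeval w).toAlgebra
  let i2 : Algebra (MvPolynomial τ k) M := (aeval (algebraMap B M ∘ w)).toAlgebra
  let w' : τ → F := fun i => ⟨algebraMap B M (w i), IntermediateField.subset_adjoin _ _ ⟨i, rfl⟩⟩
  let i3 : Algebra (MvPolynomial τ k) F := (aeval w').toAlgebra
  have t1 : IsScalarTower (MvPolynomial τ k) B M := by
    refine IsScalarTower.of_algebraMap_eq fun p => ?_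
    change aeval (algebraMap B M ∘ w) p = algebraMap B M (aeval w p)
    exact aeval_algebraMap_apply M w p
  have hF : ∀ p : MvPolynomial τ k, ((aeval w' p : F) : M) = aeval (algebraMap B M ∘ w) p := by
    intro p
    exact (aeval_algebraMap_apply (A := F) M w' p).symm
  have t2 : IsScalarTower (MvPolynomial τ k) F M := IsScalarTower.of_algebraMap_eq fun p => (hF p).symm
  have : FaithfulSMul (MvPolynomial τ k) F := by
    rw [faithfulSMul_iff_algebraMap_injective]
    intro p q hpq
    apply hw'
    have := congrArg (algebraMap F M) hpq
    change ((aeval w' p : F) : M) = ((aeval w' q : F) : M) at this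
    rwa [hF, hF] at this
  have : IsFractionRing (MvPolynomial τ k) F := by
    apply IsFractionRing.of_field
    rintro ⟨z, hz⟩
    obtain ⟨r, s, h⟩ := (IntermediateField.mem_adjoin_range_iff k _ z).1 hz
    refine ⟨r, s, Subtype.ext ?_⟩
    change z = ((aeval w' r / aeval w' s : F) : M)
    rw [IntermediateField.coe_div, hF, hF, h]
  have : IsScalarTower k (MvPolynomial τ k) B := IsScalarTower.of_algebraMap_eq fun r => by
    change _ = aeval w (C r)
    simp
  have : Algebra.FiniteType (MvPolynomial τ k) B := Algebra.FiniteType.of_restrictScalars_finiteType k _ _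
  obtain ⟨f, hf, h⟩ := exists_natCard_ringHom_eq_finrank (R := MvPolynomial τ k) (F := F) (B := B) (L := M) k
  refine ⟨f, hf, fun a ha => ?_⟩
  rw [← h (eval a) ha]
  refine Nat.card_congr
    { toFun := fun φ => ⟨φ.1, ?_⟩
      invFun := fun φ => ⟨{ φ.1 with commutes' := fun r => ?_ }, fun i => ?_⟩
      left_inv := fun φ => rfl
      right_inv := fun φ => rfl }
  · apply MvPolynomial.ringHom_ext
    · intro r
      change φ.1 (aeval w (C r)) = _
      simp
    · intro i
      change φ.1 (aeval w (X i)) = _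
      simp [φ.2]
  · have := congrArg (fun g => g (C r)) φ.2
    change φ.1 (aeval w (C r)) = _ at this
    simpa using this
  · have := congrArg (fun g => g (X i)) φ.2
    change φ.1 (aeval w (X i)) = _ at this
    simpa using this

theorem IntermediateField.adjoin_image_algebraMap_eq_top {k B M : Type*} [Field k] [CommRing B]
    [Algebra k B] [Field M] [Algebra B M] [IsFractionRing B M] [Algebra k M]
    [IsScalarTower k B M] {S : Set B} (hS : Algebra.adjoin k S = ⊤) :
    IntermediateField.adjoin k (algebraMap B M '' S) = ⊤ := by
  have hB : ∀ b : B, algebraMap B M b ∈ IntermediateField.adjoin k (algebraMap B M '' S) := by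
    intro b
    have hb : b ∈ Algebra.adjoin k S := by rw [hS]; trivial
    induction hb using Algebra.adjoin_induction with
    | mem x hx => exact IntermediateField.subset_adjoin _ _ ⟨x, hx, rfl⟩
    | algebraMap r =>
      rw [← IsScalarTower.algebraMap_apply]
      exact IntermediateField.algebraMap_mem _ _
    | add x y _ _ hx hy => rw [map_add]; exact add_mem hx hy
    | mul x y _ _ hx hy => rw [map_mul]; exact mul_mem hx hy
  rw [eq_top_iff]
  intro z _
  obtain ⟨x, y, _, rfl⟩ := IsFractionRing.div_surjective (A := B) z
  exact div_mem (hB x) (hB y)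

theorem MvPolynomial.exists_eval_ne_zero {k τ : Type*} [Field k] [Infinite k]
    {P : MvPolynomial τ k} (hP : P ≠ 0) : ∃ a : τ → k, eval a P ≠ 0 := by
  by_contra! h
  exact hP (MvPolynomial.funext fun a => by rw [h a, map_zero])

/-- A `k`-linear functional on `L` that is nonzero at some coefficient of `G` is applied to all
coefficients. At points with coordinates in `k` it commutes with evaluation. -/
theorem MvPolynomial.exists_ne_zero_eval_imp_aeval_ne_zero {k L τ : Type*} [Field k] [Field L]
    [Algebra k L] {G : MvPolynomial τ L} (hG : G ≠ 0) : ∃ Q : MvPolynomial τ k, Q ≠ 0 ∧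
      ∀ a : τ → k, eval a Q ≠ 0 → aeval (fun i => algebraMap k L (a i)) G ≠ 0 := by
  classical
  obtain ⟨m, hm⟩ := MvPolynomial.ne_zero_iff.1 hG
  obtain ⟨ℓ, hℓ⟩ : ∃ ℓ : Module.Dual k L, ℓ (coeff m G) ≠ 0 := by
    by_contra! h
    exact hm ((Module.forall_dual_apply_eq_zero_iff k _).1 h)
  refine ⟨∑ d ∈ G.support, monomial d (ℓ (coeff d G)), fun h0 => ?_, fun a ha h0 => ha ?_⟩
  · have := congrArg (coeff m) h0
    rw [coeff_sum, Finset.sum_eq_single m] at this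
    · rw [coeff_monomial, if_pos rfl, coeff_zero] at this
      exact hℓ this
    · intro d _ hd
      rw [coeff_monomial, if_neg hd]
    · intro h
      simp [notMem_support_iff.1 h]
  · have := congrArg ℓ h0
    rw [aeval_def, eval₂_eq, map_sum, map_zero] at this
    rw [map_sum, ← this]
    refine Finset.sum_congr rfl fun d _ => ?_
    rw [eval_monomial, Finsupp.prod]
    simp only [← map_pow, ← map_prod]
    rw [Algebra.algebraMap_self, RingHom.id_apply, mul_comm (coeff d G), ← Algebra.smul_def,
      map_smul, smul_eq_mul, mul_comm]

/-- Coefficients `a` of linear forms and right hand sides `c` are combined to the coefficients of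
affine forms. -/
def affineCoeff {ι σ k : Type*} [Neg k] (a : ι × σ → k) (c : ι → k) : ι × Option σ → k
  | (i, none) => -c i
  | (i, some j) => a (i, j)

/-- A generic condition on affine forms is read as a polynomial in the right hand sides `c` with
coefficients depending on the directions `a`. If one nonzero coefficient does not vanish at `a`, the
condition is generic in `c`. -/
theorem exists_ne_zero_eval_affineCoeff {k ι σ : Type*} [Field k]
    {P : MvPolynomial (ι × Option σ) k} (hP : P ≠ 0) :
    ∃ Q : MvPolynomial (ι × σ) k, Q ≠ 0 ∧ ∀ a : ι × σ → k, eval a Q ≠ 0 →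
      ∃ P' : MvPolynomial ι k, P' ≠ 0 ∧ ∀ c : ι → k, eval c P' ≠ 0 →
        eval (affineCoeff a c) P ≠ 0 := by
  let ψ : MvPolynomial (ι × Option σ) k →ₐ[k] MvPolynomial ι (MvPolynomial (ι × σ) k) :=
    aeval (affineCoeff (fun p => C (X p)) X)
  let θ : MvPolynomial ι (MvPolynomial (ι × σ) k) →+* MvPolynomial (ι × Option σ) k :=
    eval₂Hom (aeval fun p : ι × σ => X (p.1, some p.2)).toRingHom fun i => -X (i, none)
  have hθψ : ∀ p, θ (ψ p) = p := by
    intro p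
    have : θ.comp ψ.toRingHom = RingHom.id _ := by
      apply MvPolynomial.ringHom_ext
      · intro r
        simp [ψ, θ, MvPolynomial.algebraMap_eq, MvPolynomial.algebraMap_apply]
      · rintro ⟨i, _ | j⟩ <;> simp [ψ, θ, affineCoeff]
    exact congrArg (fun f => f p) this
  have hψ : ψ P ≠ 0 := fun h0 => hP (by rw [← hθψ P, h0, map_zero])
  obtain ⟨m, hm⟩ := MvPolynomial.ne_zero_iff.1 hψ
  refine ⟨coeff m (ψ P), hm, fun a ha => ⟨map (eval a) (ψ P), fun h0 => ha ?_, fun c hc => ?_⟩⟩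
  · rw [← coeff_map, h0, coeff_zero]
  · have : ((eval c).comp (map (eval a))).comp ψ.toRingHom = eval (affineCoeff a c) := by
      apply MvPolynomial.ringHom_ext
      · intro r
        simp [ψ, MvPolynomial.algebraMap_eq, MvPolynomial.algebraMap_apply]
      · rintro ⟨i, _ | j⟩ <;> simp [ψ, affineCoeff]
    rw [← this]
    exact hc

/-! ### Intersection with a generic plane. -/

section GenericCount

variable {k σ A : Type*} [Field k] [IsAlgClosed k] [Fintype σ] [CommRing A] [IsDomain A]
  [Algebra k A]

/-- The coefficients and the constant terms of generic affine forms that vanish at `x`. -/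
noncomputable def genericAffine {ι σ A : Type*} [Fintype σ] [CommRing A] (x : σ → A) :
    ι × Option σ → MvPolynomial (ι × σ) A
  | (i, none) => -∑ j, X (i, j) * C (x j)
  | (i, some j) => X (i, j)

omit [IsAlgClosed k] [IsDomain A] in
-- The ring `MvPolynomial (ι × σ) A` belongs to the incidence variety of planes with a marked point:
-- directions are free, and the constant terms are determined by the point. Its fibre over a plane
-- consists of the points on that plane.
theorem natCard_algHom_genericAffine {ι : Type*} (x : σ → A) (c : ι × Option σ → k) :
    Nat.card {φ : MvPolynomial (ι × σ) A →ₐ[k] k // ∀ i, φ (genericAffine x i) = c i} =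
      Nat.card {φ : A →ₐ[k] k // ∀ i, c (i, none) + ∑ j, c (i, some j) * φ (x j) = 0} := by
  refine Nat.card_congr (Equiv.ofBijective (fun φ =>
    ⟨φ.1.comp (IsScalarTower.toAlgHom k A (MvPolynomial (ι × σ) A)), fun i => ?_⟩) ⟨?_, ?_⟩)
  · have h1 := φ.2 (i, none)
    have h2 : ∀ j, φ.1 (X (i, j)) = c (i, some j) := fun j => φ.2 (i, some j)
    simp only [genericAffine, map_neg, map_sum, map_mul, h2] at h1
    rw [← h1]
    exact neg_add_cancel _
  · rintro ⟨φ, hφ⟩ ⟨ψ, hψ⟩ h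
    apply Subtype.ext
    apply AlgHom.coe_ringHom_injective
    apply MvPolynomial.ringHom_ext
    · intro b
      exact congrArg (fun f => f.1 b) h
    · rintro ⟨i, j⟩
      exact (hφ (i, some j)).trans (hψ (i, some j)).symm
  · rintro ⟨φ, hφ⟩
    refine ⟨⟨aevalTower φ fun p => c (p.1, some p.2), ?_⟩, ?_⟩
    · rintro ⟨i, _ | j⟩
      · simpa [genericAffine, neg_eq_iff_add_eq_zero, add_comm] using hφ i
      · simp [genericAffine]
    · apply Subtype.ext
      ext b
      exact aevalTower_C ..

/-- The incidence variety has the same dimension as the space of planes, and by generic separability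
its function field `M` is finite and separable over the field `F` generated by the coefficients of
the plane. The constant `δ` is the degree of `M` over `F`, the number of points of a generic fibre.
-/
theorem exists_generic_natCard_eq {s : ℕ} (x : σ → A) (hx : Algebra.adjoin k (Set.range x) = ⊤)
    (hs : tdim k A = s) :
    ∃ δ : ℕ, 0 < δ ∧ ∃ P : MvPolynomial (Fin s × Option σ) k, P ≠ 0 ∧ ∀ a, eval a P ≠ 0 →
      Nat.card {φ : A →ₐ[k] k // ∀ i, a (i, none) + ∑ j, a (i, some j) * φ (x j) = 0} = δ := by
  classical
  let L := FractionRing A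
  let B := MvPolynomial (Fin s × σ) A
  let M := FractionRing B
  have hAM : Function.Injective (algebraMap A M) := by
    rw [IsScalarTower.algebraMap_eq A B M]
    exact (IsFractionRing.injective B M).comp (MvPolynomial.C_injective _ _)
  have : FaithfulSMul A M := (faithfulSMul_iff_algebraMap_injective _ _).2 hAM
  let : Algebra L M := FractionRing.liftAlgebra A M
  have t1 : IsScalarTower A L M := FractionRing.isScalarTower_liftAlgebra A M
  have t2 : IsScalarTower k L M := IsScalarTower.of_algebraMap_eq fun r => by
    rw [IsScalarTower.algebraMap_apply k A M, IsScalarTower.algebraMap_apply A L M,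
      ← IsScalarTower.algebraMap_apply k A L]
  have hfA : Algebra.FiniteType k A := ⟨⟨Finset.univ.image x, by simpa using hx⟩⟩
  have hfB : Algebra.FiniteType k B := Algebra.FiniteType.trans (S := A) hfA inferInstance
  have hL : Algebra.EssFiniteType k L :=
    have := Algebra.EssFiniteType.of_isLocalization L (nonZeroDivisors A)
    Algebra.EssFiniteType.comp k A L
  have hM : Algebra.EssFiniteType k M :=
    have := Algebra.EssFiniteType.of_isLocalization M (nonZeroDivisors B)
    Algebra.EssFiniteType.comp k B M
  have htL : IntermediateField.adjoin k (Set.range fun j => algebraMap A L (x j)) = ⊤ := by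
    rw [← IntermediateField.adjoin_image_algebraMap_eq_top (M := L) hx, ← Set.range_comp]
    rfl
  have halg : Algebra.IsAlgebraic A L := IsLocalization.isAlgebraic L (nonZeroDivisors A)
  have halgB : Algebra.IsAlgebraic B M := IsLocalization.isAlgebraic M (nonZeroDivisors B)
  have htd : tdim k L = s := by rw [← hs]; exact tdim_eq_of_isAlgebraic.symm
  have hsep := exists_generic_finite_separable (k := k) (fun j => algebraMap A L (x j)) htL
  rw [htd] at hsep
  obtain ⟨G, hG, h⟩ := hsep
  let a : Fin s × σ → M := fun p => algebraMap B M (X p)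
  have ha : AlgebraicIndependent L a := by
    refine AlgebraicIndependent.extendScalars (R := A) L ?_
    exact (MvPolynomial.algebraicIndependent_X (Fin s × σ) A).map'
      (f := IsScalarTower.toAlgHom A B M) (IsFractionRing.injective B M)
  let w : Fin s × Option σ → B := genericAffine x
  let F := IntermediateField.adjoin k (Set.range (algebraMap B M ∘ w))
  have hwF : ∀ p, algebraMap B M (w p) ∈ F := fun p => IntermediateField.subset_adjoin _ _ ⟨p, rfl⟩
  have haF : ∀ p, a p ∈ F := fun p => hwF (p.1, some p.2)
  have htB : Algebra.adjoin k (Set.range (X : Fin s × σ → B) ∪ Set.range fun j => (C (x j) : B)) = ⊤ := by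
    rw [eq_top_iff]
    rintro p -
    induction p using MvPolynomial.induction_on with
    | C b =>
      have hb : b ∈ Algebra.adjoin k (Set.range x) := by rw [hx]; trivial
      have := Subalgebra.mem_map.2 ⟨b, hb, (rfl : IsScalarTower.toAlgHom k A B b = C b)⟩
      rw [AlgHom.map_adjoin, ← Set.range_comp] at this
      exact Algebra.adjoin_mono Set.subset_union_right this
    | add p q hp hq => exact add_mem hp hq
    | mul_X p i hp => exact mul_mem hp (Algebra.subset_adjoin (Or.inl ⟨i, rfl⟩))
  have htM := IntermediateField.adjoin_image_algebraMap_eq_top (M := M) htB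
  rw [Set.image_union, ← Set.range_comp, ← Set.range_comp] at htM
  have hxLM : ∀ j, algebraMap L M (algebraMap A L (x j)) = algebraMap B M (C (x j)) := fun j => by
    rw [← IsScalarTower.algebraMap_apply]
    rfl
  obtain ⟨hfin, hsepF⟩ := h M F a
    (by rw [← map_zero (aeval a : MvPolynomial (Fin s × σ) L →ₐ[L] M)]; exact fun h0 => hG (ha h0))
    haF (fun i => by
      have h1 : -algebraMap B M (w (i, none)) = ∑ j, a (i, j) * algebraMap B M (C (x j)) := by
        rw [← map_neg, show -w (i, none) = ∑ j, X (i, j) * C (x j) from neg_neg _, map_sum]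
        exact Finset.sum_congr rfl fun j _ => map_mul _ _ _
      simp only [hxLM]
      rw [← h1]
      exact neg_mem (hwF (i, none)))
    (by simp only [hxLM]; exact htM)
  have htdM : tdim k M = Fintype.card (Fin s × Option σ) := by
    obtain ⟨y, hy⟩ := exists_isTranscendenceBasis_fin (k := k) (A := A)
    have h1 := hy.sumElim_comp (IsTranscendenceBasis.mvPolynomial (Fin s × σ) A)
    have h2 : tdim k B = tdim k M := tdim_eq_of_isAlgebraic
    rw [← h2, ← h1.card_eq_tdim]
    simp [hs, Nat.mul_add, add_comm]
  have hwM : IsTranscendenceBasis k (algebraMap B M ∘ w) :=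
    isTranscendenceBasis_of_isAlgebraic_adjoin _ htdM.ge
  have hw : AlgebraicIndependent k w :=
    AlgebraicIndependent.of_comp (IsScalarTower.toAlgHom k B M) hwM.1
  obtain ⟨f, hf, hcount⟩ := exists_natCard_algHom_eq_finrank (M := M) w hw
  refine ⟨Module.finrank F M, Module.finrank_pos, f, hf, fun c hc => ?_⟩
  rw [← hcount c hc]
  exact (natCard_algHom_genericAffine x c).symm

end GenericCount

/-! ### The degree as the degree of a function field. -/

section GenericCount

variable {k σ A : Type*} [Field k] [IsAlgClosed k] [Fintype σ] [CommRing A] [IsDomain A]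
  [Algebra k A]

variable (k) in

/-- `s` generic linear combinations of the `x j` form a transcendence basis of `A` such that the
function field of `A` has degree `δ` over the subfield they generate. -/
def HasGenericFinrank (x : σ → A) (s δ : ℕ) : Prop :=
  ∃ Q : MvPolynomial (Fin s × σ) k, Q ≠ 0 ∧ ∀ a, eval a Q ≠ 0 → ∀ y : Fin s → A,
    (∀ i, y i = ∑ j, a (i, j) • x j) → IsTranscendenceBasis k y ∧
    Module.finrank (IntermediateField.adjoin k (Set.range (algebraMap A (FractionRing A) ∘ y)))
      (FractionRing A) = δ

/-- For fixed generic directions `a`, the fibre of the projection `y` over a generic `c` has as many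
points as the extension has degree. The same fibre is the intersection with a generic plane, so it
has `δ` points; one `c` that is generic in both senses suffices. -/
theorem hasGenericFinrank_of_natCard_eq {s δ : ℕ} (x : σ → A) (hx : Algebra.adjoin k (Set.range x) = ⊤)
    (hs : tdim k A = s) {P : MvPolynomial (Fin s × Option σ) k} (hP : P ≠ 0)
    (hPδ : ∀ a, eval a P ≠ 0 →
      Nat.card {φ : A →ₐ[k] k // ∀ i, a (i, none) + ∑ j, a (i, some j) * φ (x j) = 0} = δ) :
    HasGenericFinrank k x s δ := by
  classical
  let L := FractionRing A
  have hfA : Algebra.FiniteType k A := ⟨⟨Finset.univ.image x, by simpa using hx⟩⟩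
  have hL : Algebra.EssFiniteType k L :=
    have := Algebra.EssFiniteType.of_isLocalization L (nonZeroDivisors A)
    Algebra.EssFiniteType.comp k A L
  have htL : IntermediateField.adjoin k (Set.range fun j => algebraMap A L (x j)) = ⊤ := by
    rw [← IntermediateField.adjoin_image_algebraMap_eq_top (M := L) hx, ← Set.range_comp]
    rfl
  have halg : Algebra.IsAlgebraic A L := IsLocalization.isAlgebraic L (nonZeroDivisors A)
  have htd : tdim k L = s := by rw [← hs]; exact tdim_eq_of_isAlgebraic.symm
  have hsep := exists_generic_finite_separable (k := k) (fun j => algebraMap A L (x j)) htL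
  rw [htd] at hsep
  obtain ⟨G, hG, h⟩ := hsep
  obtain ⟨Q₁, hQ₁, h₁⟩ := MvPolynomial.exists_ne_zero_eval_imp_aeval_ne_zero (k := k) hG
  obtain ⟨Q₂, hQ₂, h₂⟩ := exists_ne_zero_eval_affineCoeff hP
  refine ⟨Q₁ * Q₂, mul_ne_zero hQ₁ hQ₂, fun a ha y hy => ?_⟩
  rw [map_mul] at ha
  let F := IntermediateField.adjoin k (Set.range (algebraMap A L ∘ y))
  obtain ⟨hfin, hsepF⟩ := h L F (fun p => algebraMap k L (a p)) (h₁ a (left_ne_zero_of_mul ha))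
    (fun p => F.algebraMap_mem _) (fun i => by
      refine IntermediateField.subset_adjoin _ _ ⟨i, ?_⟩
      rw [Function.comp_apply, hy, map_sum]
      refine Finset.sum_congr rfl fun j _ => ?_
      rw [Algebra.smul_def, map_mul, ← IsScalarTower.algebraMap_apply]
      rfl)
    (by
      rw [eq_top_iff, ← htL]
      exact IntermediateField.adjoin.mono _ _ _ Set.subset_union_right)
  have hyL : IsTranscendenceBasis k (algebraMap A L ∘ y) :=
    isTranscendenceBasis_of_isAlgebraic_adjoin _ (by simp [htd])
  have hyA : IsTranscendenceBasis k y := IsTranscendenceBasis.of_comp_algebraMap hyL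
  refine ⟨hyA, ?_⟩
  obtain ⟨f, hf, hcount⟩ := exists_natCard_algHom_eq_finrank (M := L) y hyA.1
  obtain ⟨P', hP', h'⟩ := h₂ a (right_ne_zero_of_mul ha)
  obtain ⟨c, hc⟩ := MvPolynomial.exists_eval_ne_zero (mul_ne_zero hf hP')
  rw [map_mul] at hc
  rw [← hcount c (left_ne_zero_of_mul hc), ← hPδ _ (h' c (right_ne_zero_of_mul hc))]
  refine Nat.card_congr (Equiv.subtypeEquivRight fun φ => forall_congr' fun i => ?_)
  simp only [affineCoeff, hy, map_sum, map_smul, smul_eq_mul]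
  rw [neg_add_eq_zero, eq_comm]

end GenericCount

/-! ### Degrees of irreducible closed sets. -/

section Degree

variable {σ k : Type*} [Field k]

/-- The coordinate functions on `Z`. -/
noncomputable def coordFun (Z : Set (ZariskiSpace σ k)) (j : σ) : CoordRing Z := Ideal.Quotient.mk (vI Z) (X j)

theorem adjoin_range_coordFun (Z : Set (ZariskiSpace σ k)) :
    Algebra.adjoin k (Set.range (coordFun Z)) = ⊤ := by
  have h := congrArg (Subalgebra.map (Ideal.Quotient.mkₐ k (vI Z)))
    (MvPolynomial.adjoin_range_X (R := k) (σ := σ))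
  rw [AlgHom.map_adjoin, ← Set.range_comp, Algebra.map_top,
    (AlgHom.range_eq_top _).2 (Ideal.Quotient.mkₐ_surjective k (vI Z))] at h
  exact h

/-- Points of a closed set are the homomorphisms from its coordinate ring to the field. -/
noncomputable def pointsEquiv {Z : Set (ZariskiSpace σ k)} (hZ : IsClosed Z) :
    (CoordRing Z →ₐ[k] k) ≃ Z where
  toFun φ := ⟨fun j => φ (coordFun Z j), by
    refine (zSet_vI_of_isClosed hZ).subset (mem_zSet.2 fun f hf => ?_)
    have h : (zEval fun j => φ (coordFun Z j)) = φ.comp (Ideal.Quotient.mkₐ k (vI Z)) := by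
      ext j
      exact zEval_X _ j
    rw [h, AlgHom.comp_apply, Ideal.Quotient.mkₐ_eq_mk, Ideal.Quotient.eq_zero_iff_mem.2 hf,
      map_zero]⟩
  invFun x := Ideal.Quotient.liftₐ (vI Z) (zEval x.1) fun f hf => mem_vI.1 hf x.1 x.2
  left_inv φ := by
    apply Ideal.Quotient.algHom_ext
    ext j
    exact zEval_X _ j
  right_inv x := Subtype.ext (funext fun j => zEval_X x.1 j)

theorem HasDegree.eq [Fintype σ] [Infinite k] {Z : Set (ZariskiSpace σ k)} {m m' : ℕ}
    (h : HasDegree Z m) (h' : HasDegree Z m') : m = m' := by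
  obtain ⟨r, hr, P, hP, hPm⟩ := h
  obtain ⟨r', hr', P', hP', hPm'⟩ := h'
  obtain rfl : r = r' := by
    rw [hr] at hr'
    exact_mod_cast hr'
  obtain ⟨a, ha⟩ := MvPolynomial.exists_eval_ne_zero (mul_ne_zero hP hP')
  rw [map_mul] at ha
  have h1 := hPm a (left_ne_zero_of_mul ha)
  rw [hPm' a (right_ne_zero_of_mul ha)] at h1
  exact_mod_cast h1.symm

/-- Points of `Z` are homomorphisms from its coordinate ring, so one and the same count gives both
the geometric degree and the degree of the function field. -/
theorem exists_hasDegree [Fintype σ] [IsAlgClosed k] {Z : Set (ZariskiSpace σ k)}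
    [(vI Z).IsPrime] (hZ : IsIrreducible Z) (hc : IsClosed Z) :
    ∃ δ, 0 < δ ∧ HasDegree Z δ ∧ HasGenericFinrank k (coordFun Z) (tdim k (CoordRing Z)) δ := by
  obtain ⟨δ, hδ, P, hP, hPδ⟩ := exists_generic_natCard_eq (k := k) (coordFun Z)
    (adjoin_range_coordFun Z) rfl
  refine ⟨δ, hδ, ⟨_, zariskiDim_eq hZ hc, P, hP, fun a ha => ?_⟩,
    hasGenericFinrank_of_natCard_eq _ (adjoin_range_coordFun Z) rfl hP hPδ⟩
  have h1 : Nat.card (Z ∩ affinePlane a : Set (ZariskiSpace σ k)) = δ := by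
    rw [← hPδ a ha]
    symm
    refine Nat.card_congr (((pointsEquiv hc).subtypeEquiv (q := fun x => x.1 ∈ affinePlane a)
      fun φ => Iff.rfl).trans (Equiv.subtypeSubtypeEquivSubtypeInter _ _))
  have h2 : (Z ∩ affinePlane a).Finite := Nat.finite_of_card_ne_zero (h1.trans_ne hδ.ne')
  rw [← h2.cast_ncard_eq]
  exact_mod_cast h1

theorem HasDegree.hasGenericFinrank [Fintype σ] [IsAlgClosed k] {Z : Set (ZariskiSpace σ k)} {d : ℕ}
    [(vI Z).IsPrime] (h : HasDegree Z d) (hZ : IsIrreducible Z) (hc : IsClosed Z) :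
    0 < d ∧ HasGenericFinrank k (coordFun Z) (tdim k (CoordRing Z)) d := by
  obtain ⟨δ, hδ, h1, h2⟩ := exists_hasDegree hZ hc
  obtain rfl := h.eq h1
  exact ⟨hδ, h2⟩

end Degree

/-! ### Irreducible algebraic relations. -/

section Relation

open IntermediateField in

open scoped IntermediateField.algebraAdjoinAdjoin in
-- By Gauss's lemma `F` stays irreducible as a polynomial in the variable `i` over the field
-- generated by the other `u j`. Up to a constant it is then the minimal polynomial of `u i`.
theorem degreeOf_le_finrank_of_irreducible {k L ι : Type*} [Field k] [Field L] [Algebra k L]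
    {u : ι → L} {F : MvPolynomial ι k} (hF : Irreducible F) (hFu : aeval u F = 0) (i : ι)
    (hu : AlgebraicIndependent k fun j : {j | j ≠ i} => u j)
    [FiniteDimensional (adjoin k (u '' {i}ᶜ)) L] :
    degreeOf i F ≤ Module.finrank (adjoin k (u '' {i}ᶜ)) L := by
  classical
  let p := toPolynomialAdjoinImageCompl F u i
  have hp : Irreducible p := irreducible_toPolynomialAdjoinImageCompl hF i hu
  have hdeg : p.natDegree = degreeOf i F := by
    let g : MvPolynomial {j // j ≠ i} k →ₐ[k] Algebra.adjoin k (u '' {i}ᶜ) :=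
      aeval fun j => ⟨u j, Algebra.subset_adjoin ⟨j, j.2, rfl⟩⟩
    have h1 : Function.Injective g := by
      refine Function.Injective.of_comp (f := Algebra.adjoin k (u '' {i}ᶜ) |>.val) ?_
      rw [← AlgHom.coe_comp]
      have : (Algebra.adjoin k (u '' {i}ᶜ)).val.comp g = aeval fun j : {j // j ≠ i} => u j := by
        ext j; simp [g]
      rw [this]
      exact hu
    simp only [p, toPolynomialAdjoinImageCompl]
    refine (Polynomial.natDegree_map_eq_of_injective (f := g.toRingHom) h1 _).trans ?_
    rw [natDegree_optionEquivLeft, renameEquiv_apply,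
      ← degreeOf_rename_of_injective (Equiv.optionSubtypeNe i).symm.injective i,
      Equiv.optionSubtypeNe_symm_self]
    congr!
  rcases Nat.eq_zero_or_pos p.natDegree with h0 | h0
  · rw [← hdeg, h0]; exact Nat.zero_le _
  have := (AlgebraicIndepOn.aevalEquiv (s := {i}ᶜ) hu).uniqueFactorizationMonoid inferInstance
  have h2 := ((hp.isPrimitive h0.ne').irreducible_iff_irreducible_map_fraction_map
    (K := adjoin k (u '' {i}ᶜ))).1 hp
  have h3 := minpoly.eq_of_irreducible h2 ((Polynomial.aeval_map_algebraMap ..).trans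
    (aeval_toPolynomialAdjoinImageCompl_eq_zero hFu i))
  have h4 := minpoly.natDegree_le (A := adjoin k (u '' {i}ᶜ)) (u i)
  rw [← h3, Polynomial.natDegree_mul_C (by simpa using h2.ne_zero), Polynomial.natDegree_map_eq_of_injective
    (FaithfulSMul.algebraMap_injective ..), hdeg] at h4
  exact h4

/-- A nonzero relation of least total degree is irreducible. -/
theorem exists_irreducible_relation {k L ι : Type*} [Field k] [Field L] [Algebra k L]
    {u : ι → L} (hu : ¬ AlgebraicIndependent k u) :
    ∃ F : MvPolynomial ι k, Irreducible F ∧ aeval u F = 0 := by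
  let S : Set (MvPolynomial ι k) := {F | F ≠ 0 ∧ F.aeval u = 0}
  have hS : S.Nonempty := by
    simpa [S, algebraicIndependent_iff, and_comm, Set.Nonempty] using hu
  obtain ⟨h1, h2⟩ := totalDegree.argminOn_mem S hS
  exact ⟨_, irreducible_of_forall_totalDegree_le
    (fun G hG hG' => totalDegree.argminOn_le S ⟨hG, hG'⟩) h1 h2, h2⟩

end Relation

/-! ### Spaces of monomials with bounded exponents. -/

section Box

variable {k A ι : Type*} [Field k] [CommRing A] [Algebra k A]

theorem Submodule.finrank_mul_le (P Q : Submodule k A) [Module.Finite k P] [Module.Finite k Q] :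
    Module.finrank k (P * Q : Submodule k A) ≤ Module.finrank k P * Module.finrank k Q := by
  rw [← Submodule.mulMap_range, ← Module.finrank_tensorProduct (R := k)]
  exact LinearMap.finrank_range_le _

variable [Fintype ι]

variable (k) in

/-- The span of the monomials in `y` with all exponents at most `m`. -/
def box (y : ι → A) (m : ℕ) : Submodule k A :=
  Submodule.span k (Set.range fun α : ι → Fin (m + 1) => ∏ i, y i ^ (α i : ℕ))

instance (y : ι → A) (m : ℕ) : Module.Finite k (box k y m) :=
  Module.Finite.span_of_finite k (Set.finite_range _)

theorem finrank_box_le (y : ι → A) (m : ℕ) :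
    Module.finrank k (box k y m) ≤ (m + 1) ^ Fintype.card ι := by
  classical
  refine (finrank_range_le_card _).trans ?_
  simp

theorem prod_pow_mem_box (y : ι → A) {m : ℕ} {α : ι → ℕ} (h : ∀ i, α i ≤ m) :
    ∏ i, y i ^ α i ∈ box k y m :=
  Submodule.subset_span ⟨fun i => ⟨α i, Nat.lt_succ_of_le (h i)⟩, rfl⟩

theorem one_mem_box (y : ι → A) (m : ℕ) : 1 ∈ box k y m := by
  simpa using prod_pow_mem_box (k := k) y (m := m) (α := fun _ => 0) fun _ => Nat.zero_le _

theorem mem_box (y : ι → A) {m : ℕ} (hm : 0 < m) (i : ι) : y i ∈ box k y m := by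
  classical
  have := prod_pow_mem_box (k := k) y (m := m) (α := fun j => if j = i then 1 else 0) fun j => by
    split_ifs <;> omega
  simpa using this

theorem box_mono (y : ι → A) {m m' : ℕ} (h : m ≤ m') : box k y m ≤ box k y m' := by
  refine Submodule.span_le.2 ?_
  rintro _ ⟨α, rfl⟩
  exact prod_pow_mem_box y fun i => (Nat.lt_succ_iff.1 (α i).2).trans h

theorem box_mul_le (y : ι → A) (m m' : ℕ) : box k y m * box k y m' ≤ box k y (m + m') := by
  rw [box, box, Submodule.span_mul_span]
  refine Submodule.span_le.2 ?_
  rintro _ ⟨_, ⟨α, rfl⟩, _, ⟨β, rfl⟩, rfl⟩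
  simp only [← Finset.prod_mul_distrib, ← pow_add]
  exact prod_pow_mem_box y fun i => by have := (α i).2; have := (β i).2; omega

theorem box_pow_le (y : ι → A) (m t : ℕ) : box k y m ^ t ≤ box k y (t * m) := by
  induction t with
  | zero =>
    rw [pow_zero, Submodule.one_le]
    exact one_mem_box y _
  | succ t ih =>
    rw [pow_succ, Nat.succ_mul]
    exact (mul_le_mul' ih le_rfl).trans (box_mul_le y _ _)

theorem aeval_mem_box (y : ι → A) {m : ℕ} {q : MvPolynomial ι k} (h : ∀ i, degreeOf i q ≤ m) :
    aeval y q ∈ box k y m := by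
  rw [aeval_def, eval₂_eq']
  refine Submodule.sum_mem _ fun d hd => ?_
  rw [← Algebra.smul_def]
  exact Submodule.smul_mem _ _ (prod_pow_mem_box y fun i => (degreeOf_le_iff.1 (h i) d hd))

/-- The relation `p` trades the leading coefficient times `z ^ δ` for lower powers of `z`, with
coefficients in `box k y δ`. Each factor of the leading coefficient thus lowers the exponent of `z`
by at least one, until it is less than `δ`. -/
theorem pow_mul_pow_mem_box_mul (y : ι → A) (z : A) {δ : ℕ} {p : Polynomial (MvPolynomial ι k)}
    (hp : p.natDegree = δ) (hpd : ∀ j i, degreeOf i (p.coeff j) ≤ δ)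
    (hpz : Polynomial.eval₂ (aeval y : MvPolynomial ι k →ₐ[k] A).toRingHom z p = 0) (m : ℕ) :
    ∀ i, i < m + δ → (aeval y p.leadingCoeff) ^ m * z ^ i ∈
      box k y (m * δ) * Submodule.span k (Set.range fun j : Fin δ => z ^ (j : ℕ)) := by
  induction m with
  | zero =>
    intro i hi
    exact Submodule.mul_mem_mul (by simpa using one_mem_box y _)
      (Submodule.subset_span ⟨⟨i, by omega⟩, rfl⟩)
  | succ m ih =>
    intro i hi
    have hbox : ∀ j, aeval y (p.coeff j) ∈ box k y δ := fun j => aeval_mem_box y (hpd j)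
    have hmul : ∀ a ∈ box k y δ, ∀ b ∈ box k y (m * δ) * Submodule.span k
        (Set.range fun j : Fin δ => z ^ (j : ℕ)), a * b ∈ box k y ((m + 1) * δ) *
        Submodule.span k (Set.range fun j : Fin δ => z ^ (j : ℕ)) := by
      intro a ha b hb
      have := Submodule.mul_mem_mul ha hb
      rw [← mul_assoc] at this
      have h1 : box k y δ * box k y (m * δ) ≤ box k y ((m + 1) * δ) := by
        rw [add_comm m 1, Nat.add_mul, one_mul]
        exact box_mul_le _ _ _
      exact mul_le_mul' h1 le_rfl this
    rcases lt_or_ge i δ with h | h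
    · rw [pow_succ', mul_assoc]
      exact hmul _ (hbox _) _ (ih i (by omega))
    · obtain ⟨i, rfl⟩ := Nat.exists_eq_add_of_le h
      have h1 : aeval y p.leadingCoeff * z ^ δ = -∑ j ∈ Finset.range δ, aeval y (p.coeff j) * z ^ j := by
        rw [Polynomial.eval₂_eq_sum_range, hp, Finset.sum_range_succ, add_comm] at hpz
        rw [Polynomial.leadingCoeff, hp]
        exact eq_neg_of_add_eq_zero_left hpz
      have h2 : aeval y p.leadingCoeff ^ (m + 1) * z ^ (δ + i) =
          -∑ j ∈ Finset.range δ, aeval y (p.coeff j) * (aeval y p.leadingCoeff ^ m * z ^ (j + i)) := by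
        calc _ = aeval y p.leadingCoeff ^ m * z ^ i * (aeval y p.leadingCoeff * z ^ δ) := by ring
          _ = _ := by
            rw [h1, mul_neg, Finset.mul_sum]
            exact congrArg _ (Finset.sum_congr rfl fun j _ => by ring)
      rw [h2]
      refine neg_mem (Submodule.sum_mem _ fun j hj => hmul _ (hbox _) _ (ih _ ?_))
      have := Finset.mem_range.1 hj
      omega

end Box

/-! ### Upper bound for the Hilbert function. -/

section HilbertUpper

variable {k A : Type*} [Field k] [CommRing A] [Algebra k A]

/-- The `s + 1` elements `z` and `y` satisfy an irreducible relation. As any `s` of them generate a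
field over which the function field has degree `δ`, the relation has degree at most `δ` in each
variable. -/
theorem exists_polynomial_relation [IsDomain A] [Algebra.FiniteType k A] {s δ : ℕ} (hδ : 0 < δ)
    (hs : tdim k A = s) (y : Fin s → A) (z : A)
    (h : ∀ e : Fin s → Option (Fin s), Function.Injective e →
      IsTranscendenceBasis k (fun i => (e i).elim z y) ∧
      Module.finrank (IntermediateField.adjoin k
        (Set.range (algebraMap A (FractionRing A) ∘ fun i => (e i).elim z y)))
        (FractionRing A) = δ) :
    ∃ p : Polynomial (MvPolynomial (Fin s) k), p.natDegree = δ ∧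
      (∀ j i, degreeOf i (p.coeff j) ≤ δ) ∧ p ≠ 0 ∧
      Polynomial.eval₂ (aeval y : MvPolynomial (Fin s) k →ₐ[k] A).toRingHom z p = 0 := by
  classical
  let L := FractionRing A
  let u : Option (Fin s) → A := fun o => o.elim z y
  have hu : ¬ AlgebraicIndependent k (algebraMap A L ∘ u) := by
    intro hu
    have h1 := (AlgebraicIndependent.of_comp (IsScalarTower.toAlgHom k A L) hu).card_le_tdim
    simp [hs] at h1
  obtain ⟨F, hF, hFu⟩ := exists_irreducible_relation hu
  have hFA : aeval u F = 0 := by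
    apply IsFractionRing.injective A L
    rw [map_zero, ← hFu]
    exact (aeval_algebraMap_apply L u F).symm
  have hdeg : ∀ o, degreeOf o F ≤ δ := by
    intro o
    obtain ⟨e⟩ : Nonempty (Fin s ≃ {j : Option (Fin s) | j ≠ o}) := by
      rw [← Fintype.card_eq]
      rw [Set.card_ne_eq, Fintype.card_option, Nat.add_sub_cancel]
    obtain ⟨h1, h2⟩ := h (fun i => e i) (Subtype.val_injective.comp e.injective)
    have hset : (algebraMap A L ∘ u) '' {o}ᶜ =
        Set.range (algebraMap A L ∘ fun i => u (e i)) := by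
      ext t
      constructor
      · rintro ⟨j, hj, rfl⟩
        exact ⟨e.symm ⟨j, hj⟩, by simp⟩
      · rintro ⟨i, rfl⟩
        exact ⟨e i, (e i).2, rfl⟩
    have hind : AlgebraicIndependent k fun j : {j | j ≠ o} => (algebraMap A L ∘ u) j := by
      have h3 := h1.1.map' (f := IsScalarTower.toAlgHom k A L) (IsFractionRing.injective A L)
      have h4 := (algebraicIndependent_equiv e.symm).2 h3
      convert h4 using 1
      ext j
      simp [u]
    have h2' : Module.finrank (IntermediateField.adjoin k ((algebraMap A L ∘ u) '' {o}ᶜ)) L = δ := by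
      rw [hset]; exact h2
    have : FiniteDimensional (IntermediateField.adjoin k ((algebraMap A L ∘ u) '' {o}ᶜ)) L :=
      Module.finite_of_finrank_pos (h2' ▸ hδ)
    exact (degreeOf_le_finrank_of_irreducible hF hFu o hind).trans h2'.le
  let q := optionEquivLeft k (Fin s) F
  have hq : q ≠ 0 := (map_ne_zero_iff _ (optionEquivLeft k (Fin s)).injective).2 hF.ne_zero
  have hqd : q.natDegree ≤ δ := by rw [natDegree_optionEquivLeft]; exact hdeg none
  have hev : Polynomial.eval₂ (aeval y : MvPolynomial (Fin s) k →ₐ[k] A).toRingHom z q = 0 := by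
    have h1 : (Polynomial.eval₂RingHom (aeval y : MvPolynomial (Fin s) k →ₐ[k] A).toRingHom z).comp
        (optionEquivLeft k (Fin s)).toRingEquiv.toRingHom =
        (aeval u : MvPolynomial (Option (Fin s)) k →ₐ[k] A).toRingHom := by
      apply MvPolynomial.ringHom_ext
      · intro r; simp [optionEquivLeft_C]
      · rintro (_ | i)
        · simp [optionEquivLeft_X_none, u]
        · simp [optionEquivLeft_X_some, u]
    rw [← hFA]
    exact congrArg (fun f => f F) h1
  -- The power of `X` raises the degree to exactly `δ`, so that the same exponent can be used for
  -- all coordinates.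
  refine ⟨q * Polynomial.X ^ (δ - q.natDegree), ?_, ?_, ?_, ?_⟩
  · rw [Polynomial.natDegree_mul_X_pow _ hq]; omega
  · intro j i
    rw [Polynomial.coeff_mul_X_pow']
    split_ifs
    · rw [degreeOf_le_iff]
      intro m hm
      rw [mem_support_coeff_optionEquivLeft] at hm
      have := degreeOf_le_iff.1 (hdeg (some i)) _ hm
      simpa using this
    · simp
  · exact mul_ne_zero hq (pow_ne_zero _ Polynomial.X_ne_zero)
  · rw [Polynomial.eval₂_mul, hev, zero_mul]

variable (k) in

/-- The span of `1` and the `x j`. -/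
def degOneSpan {σ : Type*} (x : σ → A) : Submodule k A := Submodule.span k (insert 1 (Set.range x))

variable (k) in

/-- The dimension of the space of polynomials of degree at most `t` in `x`. -/
noncomputable def hilb {σ : Type*} (x : σ → A) (t : ℕ) : ℕ := Module.finrank k (degOneSpan k x ^ t : Submodule k A)

instance {σ : Type*} [Finite σ] (x : σ → A) : Module.Finite k (degOneSpan k x) :=
  Module.Finite.span_of_finite k ((Set.finite_range x).insert 1)

theorem one_mem_degOneSpan {σ : Type*} (x : σ → A) : 1 ∈ degOneSpan k x :=
  Submodule.subset_span (Or.inl rfl)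

theorem mem_degOneSpan {σ : Type*} (x : σ → A) (j : σ) : x j ∈ degOneSpan k x :=
  Submodule.subset_span (Or.inr ⟨j, rfl⟩)

theorem degOneSpan_le_iff {σ : Type*} {x : σ → A} {P : Submodule k A} :
    degOneSpan k x ≤ P ↔ 1 ∈ P ∧ ∀ j, x j ∈ P := by
  rw [degOneSpan, Submodule.span_le, Set.insert_subset_iff, Set.range_subset_iff]
  rfl

instance Submodule.finite_pow (P : Submodule k A) [hP : Module.Finite k P] (t : ℕ) :
    Module.Finite k (P ^ t : Submodule k A) :=
  Module.Finite.iff_fg.2 ((Module.Finite.iff_fg.1 hP).pow t)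

/-- Multiplication by the product `c` of the `t`-th powers of the leading coefficients is injective.
It moves every polynomial of degree at most `t` into the product of a box in `y` and the spans of
the powers of `z l` below `δ`, and the dimension of that product is visibly bounded. -/
theorem hilb_le_of_relations [IsDomain A] {σ : Type*} [Fintype σ] {s δ : ℕ} (hδ : 0 < δ)
    {x : σ → A} {y : Fin s → A} (hy : AlgebraicIndependent k y) {z : σ → A}
    (hxz : ∀ j, x j ∈ Submodule.span k (Set.range z))
    (p : σ → Polynomial (MvPolynomial (Fin s) k)) (hp : ∀ l, (p l).natDegree = δ)
    (hp0 : ∀ l, p l ≠ 0)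
    (hpd : ∀ l j i, degreeOf i ((p l).coeff j) ≤ δ)
    (hpz : ∀ l, Polynomial.eval₂ (aeval y : MvPolynomial (Fin s) k →ₐ[k] A).toRingHom (z l) (p l) = 0)
    (t : ℕ) : hilb k x t ≤ (Fintype.card σ * (t * δ) + 1) ^ s * δ ^ Fintype.card σ := by
  classical
  let Zl : σ → Submodule k A := fun l => Submodule.span k (Set.range fun j : Fin δ => z l ^ (j : ℕ))
  have hfin : ∀ l, Module.Finite k (Zl l) := fun l =>
    Module.Finite.span_of_finite k (Set.finite_range _)
  have hprod : ∀ S : Finset σ, Module.Finite k (∏ l ∈ S, Zl l : Submodule k A) ∧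
      Module.finrank k (∏ l ∈ S, Zl l : Submodule k A) ≤ δ ^ S.card := by
    intro S
    induction S using Finset.induction_on with
    | empty =>
      have h1 : ∏ l ∈ (∅ : Finset σ), Zl l = Submodule.span k {1} := by
        rw [Finset.prod_empty, Submodule.one_eq_span]
      rw [h1]
      exact ⟨Module.Finite.span_of_finite k (Set.finite_singleton _), by
        simpa using finrank_span_le_card (R := k) ({1} : Set A)⟩
    | insert l S hl ih =>
      obtain ⟨h1, h2⟩ := ih
      rw [Finset.prod_insert hl, Finset.card_insert_of_notMem hl, pow_succ']
      refine ⟨Module.Finite.iff_fg.2 ((Module.Finite.iff_fg.1 (hfin l)).mul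
        (Module.Finite.iff_fg.1 h1)), (Submodule.finrank_mul_le _ _).trans (Nat.mul_le_mul ?_ h2)⟩
      refine (finrank_range_le_card _).trans (by simp)
  let c : A := ∏ l, aeval y (p l).leadingCoeff ^ t
  have hc : c ≠ 0 := Finset.prod_ne_zero_iff.2 fun l _ => pow_ne_zero _ fun h0 =>
    hp0 l (Polynomial.leadingCoeff_eq_zero.1 (hy (by rw [map_zero]; exact h0)))
  have hbox : ∀ S : Finset σ, ∀ β : σ → ℕ, (∀ l, β l ≤ t) →
      ∏ l ∈ S, (aeval y (p l).leadingCoeff ^ t * z l ^ β l) ∈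
        box k y (S.card * (t * δ)) * ∏ l ∈ S, Zl l := by
    intro S β hβ
    induction S using Finset.induction_on with
    | empty =>
      simp only [Finset.prod_empty, mul_one]
      exact one_mem_box y _
    | insert l S hl ih =>
      rw [Finset.prod_insert hl, Finset.card_insert_of_notMem hl, Finset.prod_insert hl]
      have h1 := Submodule.mul_mem_mul (pow_mul_pow_mem_box_mul y (z l) (hp l) (hpd l) (hpz l) t (β l)
        (by have := hβ l; omega)) ih
      rw [mul_mul_mul_comm] at h1
      refine mul_le_mul' ((box_mul_le y _ _).trans (box_mono y (le_of_eq ?_))) le_rfl h1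
      ring
  have hU : degOneSpan k x ^ t ≤ box k z t := by
    have h1 : degOneSpan k x ≤ box k z 1 := by
      refine degOneSpan_le_iff.2 ⟨one_mem_box z 1, fun j => ?_⟩
      refine Submodule.span_le.2 ?_ (hxz j)
      rintro _ ⟨l, rfl⟩
      exact mem_box z one_pos l
    refine (pow_le_pow_left' h1 t).trans ((box_pow_le z 1 t).trans ?_)
    rw [mul_one]
  have hle : (degOneSpan k x ^ t).map (LinearMap.mulLeft k c) ≤
      box k y (Fintype.card σ * (t * δ)) * ∏ l, Zl l := by
    refine (Submodule.map_mono hU).trans ?_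
    rw [box, Submodule.map_span, Submodule.span_le]
    rintro _ ⟨_, ⟨β, rfl⟩, rfl⟩
    rw [LinearMap.mulLeft_apply, ← Finset.prod_mul_distrib]
    exact hbox Finset.univ (fun l => β l) fun l => Nat.lt_succ_iff.1 (β l).2
  have h1 := (hprod Finset.univ).1
  have h2 : Module.Finite k (box k y (Fintype.card σ * (t * δ)) * ∏ l, Zl l : Submodule k A) :=
    Module.Finite.iff_fg.2 ((Module.Finite.iff_fg.1 inferInstance).mul (Module.Finite.iff_fg.1 h1))
  have h3 : hilb k x t = Module.finrank k ((degOneSpan k x ^ t).map (LinearMap.mulLeft k c)) :=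
    (Submodule.equivMapOfInjective _ (fun a b hab => mul_left_cancel₀ hc hab) _).finrank_eq
  rw [h3]
  refine (Submodule.finrank_mono hle).trans ((Submodule.finrank_mul_le _ _).trans
    (Nat.mul_le_mul ?_ (hprod Finset.univ).2))
  exact (finrank_box_le _ _).trans (by simp)

theorem HasGenericFinrank.hilb_le [IsAlgClosed k] [IsDomain A] {σ : Type*} [Fintype σ] {s δ : ℕ}
    {x : σ → A} (h : HasGenericFinrank k x s δ) (hx : Algebra.adjoin k (Set.range x) = ⊤)
    (hs : tdim k A = s) (hδ : 0 < δ) (t : ℕ) :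
    hilb k x t ≤ (Fintype.card σ * (t * δ) + 1) ^ s * δ ^ Fintype.card σ := by
  classical
  have hfA : Algebra.FiniteType k A := ⟨⟨Finset.univ.image x, by simpa using hx⟩⟩
  obtain ⟨Q, hQ, hQa⟩ := h
  -- One chooses `s` forms and a further form for each coordinate, such that any `s` of them are
  -- generic and the latter family spans all coordinates.
  have hR : (∏ e : Fin s ↪ Fin s ⊕ σ, rename (Prod.map e _root_.id) Q) *
      rename (Prod.map (Sum.inr : σ → Fin s ⊕ σ) _root_.id) (Matrix.mvPolynomialX σ σ k).det ≠ 0 := by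
    refine mul_ne_zero (Finset.prod_ne_zero_iff.2 fun e _ => ?_) ?_
    · exact (map_ne_zero_iff _ (rename_injective _ (e.injective.prodMap Function.injective_id))).2 hQ
    · exact (map_ne_zero_iff _ (rename_injective _
        (Sum.inr_injective.prodMap Function.injective_id))).2 (Matrix.det_mvPolynomialX_ne_zero σ k)
  obtain ⟨a, ha⟩ := MvPolynomial.exists_eval_ne_zero hR
  rw [map_mul, map_prod] at ha
  have haQ : ∀ e : Fin s ↪ Fin s ⊕ σ, eval (a ∘ Prod.map e _root_.id) Q ≠ 0 := fun e => by
    have := Finset.prod_ne_zero_iff.1 (left_ne_zero_of_mul ha) e (Finset.mem_univ _)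
    rwa [eval_rename] at this
  let v : Fin s ⊕ σ → A := fun i => ∑ j, a (i, j) • x j
  have hv : ∀ e : Fin s → Fin s ⊕ σ, Function.Injective e → IsTranscendenceBasis k (v ∘ e) ∧
      Module.finrank (IntermediateField.adjoin k
        (Set.range (algebraMap A (FractionRing A) ∘ (v ∘ e)))) (FractionRing A) = δ :=
    fun e he => hQa _ (haQ ⟨e, he⟩) _ fun i => rfl
  let b : Matrix σ σ k := Matrix.of fun l j => a (Sum.inr l, j)
  have hb : IsUnit b.det := by
    have h1 := right_ne_zero_of_mul ha
    rw [eval_rename] at h1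
    have h2 := Matrix.det_mvPolynomialX_ne_zero σ k
    rw [RingHom.map_det] at h1
    rw [isUnit_iff_ne_zero]
    convert h1 using 2
    ext l j
    simp [b]
  have hrel : ∀ l : σ, ∃ p : Polynomial (MvPolynomial (Fin s) k), p.natDegree = δ ∧
      (∀ j i, degreeOf i (p.coeff j) ≤ δ) ∧ p ≠ 0 ∧
      Polynomial.eval₂ (aeval (v ∘ Sum.inl) : MvPolynomial (Fin s) k →ₐ[k] A).toRingHom
        (v (Sum.inr l)) p = 0 := by
    intro l
    refine exists_polynomial_relation hδ hs _ _ fun e he => ?_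
    let g : Option (Fin s) → Fin s ⊕ σ := fun o => o.elim (Sum.inr l) Sum.inl
    have hg : Function.Injective g := by
      rintro (_ | i) (_ | j) hij <;> simp_all [g]
    have hge : (fun i => (e i).elim (v (Sum.inr l)) (v ∘ Sum.inl)) = v ∘ (g ∘ e) := by
      funext i
      rcases hi : e i with _ | j <;> simp [g, hi]
    rw [hge]
    exact hv _ (hg.comp he)
  choose p hp1 hp2 hp3 hp4 using hrel
  refine hilb_le_of_relations hδ (hv Sum.inl Sum.inl_injective).1.1 (z := v ∘ Sum.inr)
    (fun j => ?_) p hp1 hp3 hp2 hp4 t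
  have h1 : x j = ∑ l, b⁻¹ j l • v (Sum.inr l) := by
    have h2 : b⁻¹ * b = 1 := Matrix.nonsing_inv_mul b hb
    simp only [v, Finset.smul_sum, smul_smul]
    rw [Finset.sum_comm]
    simp only [← Finset.sum_smul]
    have h3 : ∀ i, ∑ l, b⁻¹ j l * a (Sum.inr l, i) = (1 : Matrix σ σ k) j i := fun i => by
      rw [← h2]; rfl
    simp [h3, Matrix.one_apply]
  rw [h1]
  exact Submodule.sum_mem _ fun l _ => Submodule.smul_mem _ _ (Submodule.subset_span ⟨l, rfl⟩)

/-- The constant in the upper bound for the Hilbert function of a variety of dimension `s` and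
degree `δ` in an affine space of dimension `N`. -/
def hilbConst (N s δ : ℕ) : ℕ := (N * δ + 1) ^ s * δ ^ N

theorem HasGenericFinrank.hilb_le_mul_pow [IsAlgClosed k] [IsDomain A] {σ : Type*} [Fintype σ]
    {s δ : ℕ} {x : σ → A} (h : HasGenericFinrank k x s δ)
    (hx : Algebra.adjoin k (Set.range x) = ⊤) (hs : tdim k A = s) (hδ : 0 < δ) {t : ℕ} (ht : 0 < t) :
    hilb k x t ≤ hilbConst (Fintype.card σ) s δ * t ^ s := by
  refine (h.hilb_le hx hs hδ t).trans ?_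
  rw [hilbConst, mul_right_comm, ← mul_pow]
  refine Nat.mul_le_mul_right _ (Nat.pow_le_pow_left ?_ _)
  nlinarith

end HilbertUpper

/-! ### Lower bounds for the Hilbert function from independent elements. -/

section HilbertLower

variable {k A : Type*} [Field k] [CommRing A] [Algebra k A]

theorem degOneSpan_pow_mono {σ : Type*} (x : σ → A) {m n : ℕ} (h : m ≤ n) :
    degOneSpan k x ^ m ≤ degOneSpan k x ^ n :=
  pow_le_pow_right' (Submodule.one_le.2 (one_mem_degOneSpan x)) h

theorem exists_mem_degOneSpan_pow {σ : Type*} {x : σ → A}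
    (hx : Algebra.adjoin k (Set.range x) = ⊤) (a : A) : ∃ t, a ∈ degOneSpan k x ^ t := by
  have ha : a ∈ Algebra.adjoin k (Set.range x) := by rw [hx]; trivial
  induction ha using Algebra.adjoin_induction with
  | mem a ha =>
    obtain ⟨j, rfl⟩ := ha
    exact ⟨1, by rw [pow_one]; exact mem_degOneSpan x j⟩
  | algebraMap r => exact ⟨0, by rw [pow_zero]; exact Submodule.algebraMap_mem r⟩
  | add a b _ _ ha hb =>
    obtain ⟨t, ht⟩ := ha
    obtain ⟨t', ht'⟩ := hb
    exact ⟨max t t', add_mem (degOneSpan_pow_mono x (le_max_left _ _) ht)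
      (degOneSpan_pow_mono x (le_max_right _ _) ht')⟩
  | mul a b _ _ ha hb =>
    obtain ⟨t, ht⟩ := ha
    obtain ⟨t', ht'⟩ := hb
    exact ⟨t + t', by rw [pow_add]; exact Submodule.mul_mem_mul ht ht'⟩

theorem prod_pow_mem_degOneSpan_pow {σ τ : Type*} [Fintype τ] {x : σ → A} {b : ℕ} {w : τ → A}
    (hw : ∀ j, w j ∈ degOneSpan k x ^ b) {T : ℕ} {α : τ → ℕ} (hα : ∀ j, α j ≤ T) :
    ∏ j, w j ^ α j ∈ degOneSpan k x ^ (b * Fintype.card τ * T) := by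
  have h1 : ∏ j, w j ^ α j ∈ ∏ j : τ, (degOneSpan k x ^ (b * T)) := by
    have h2 : ∀ j, w j ^ α j ∈ degOneSpan k x ^ (b * T) := fun j => by
      refine degOneSpan_pow_mono x (Nat.mul_le_mul_left b (hα j)) ?_
      rw [pow_mul]
      exact Submodule.pow_mem_pow _ (hw j) _
    have h3 : ∀ S : Finset τ, ∏ j ∈ S, w j ^ α j ∈ ∏ j ∈ S, (degOneSpan k x ^ (b * T)) := by
      intro S
      classical
      induction S using Finset.induction_on with
      | empty => exact Submodule.one_le.1 le_rfl
      | insert j S hj ih =>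
        rw [Finset.prod_insert hj, Finset.prod_insert hj]
        exact Submodule.mul_mem_mul (h2 j) ih
    exact h3 _
  rwa [Finset.prod_const, ← pow_mul, Finset.card_univ, mul_right_comm] at h1

/-- Elements `e i` that are independent over polynomial rings in `w i` are few, if the Hilbert
function is small. -/
theorem card_le_of_hilb_le {σ τ ι : Type*} [Finite σ] [Fintype τ] [Fintype ι] {x : σ → A}
    (hx : Algebra.adjoin k (Set.range x) = ⊤) {c b : ℕ}
    (hh : ∀ t, 0 < t → hilb k x t ≤ c * t ^ Fintype.card τ) (w : ι → τ → A)
    (hw : ∀ i j, w i j ∈ degOneSpan k x ^ b) (e : ι → A)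
    (hind : ∀ c : ι → MvPolynomial τ k, ∑ i, aeval (w i) (c i) * e i = 0 → c = 0) :
    Fintype.card ι ≤ c * (b * Fintype.card τ + 1) ^ Fintype.card τ := by
  classical
  choose d hd using fun i => exists_mem_degOneSpan_pow hx (e i)
  -- The monomials in `w i` with exponents below `T`, times `e i`, are linearly independent. There
  -- are `T ^ card τ` of them for each `i`, and for `T` this large they have degree at most `(b *
  -- card τ + 1) * T`. In the comparison with `hilb` the powers of `T` cancel.
  let T := Finset.univ.sup d + 1
  have hT : ∀ i, d i ≤ T := fun i => (Finset.le_sup (Finset.mem_univ i)).trans (Nat.le_succ _)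
  have hT0 : 0 < T := Nat.succ_pos _
  let v : ι × (τ → Fin T) → A := fun p => (∏ j, w p.1 j ^ (p.2 j : ℕ)) * e p.1
  let E : (τ → Fin T) → (τ →₀ ℕ) := fun α => Finsupp.equivFunOnFinite.symm fun j => (α j : ℕ)
  have hE : Function.Injective E := by
    intro α β h
    funext j
    exact Fin.ext (DFunLike.congr_fun h j)
  have hv : LinearIndependent k v := by
    rw [Fintype.linearIndependent_iff]
    intro g hg
    have h1 := hind (fun i => ∑ α : τ → Fin T, monomial (E α) (g (i, α))) (by
      rw [← hg, Fintype.sum_prod_type]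
      refine Finset.sum_congr rfl fun i _ => ?_
      rw [map_sum, Finset.sum_mul]
      refine Finset.sum_congr rfl fun α _ => ?_
      rw [aeval_monomial, ← Algebra.smul_def, smul_mul_assoc, Finsupp.prod_fintype]
      · rfl
      · intro j; exact pow_zero _)
    rintro ⟨i, α⟩
    have h2 := congrArg (coeff (E α)) (congrFun h1 i)
    rw [coeff_sum, Finset.sum_eq_single α] at h2
    · simpa using h2
    · intro β _ hβ
      rw [coeff_monomial, if_neg (hE.ne hβ)]
    · simp
  have hmem : ∀ p, v p ∈ degOneSpan k x ^ ((b * Fintype.card τ + 1) * T) := by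
    rintro ⟨i, α⟩
    rw [Nat.add_mul, one_mul, pow_add]
    exact Submodule.mul_mem_mul
      (prod_pow_mem_degOneSpan_pow (hw i) fun j => (α j).2.le)
      (degOneSpan_pow_mono x (hT i) (hd i))
  have h1 : Fintype.card (ι × (τ → Fin T)) ≤ hilb k x ((b * Fintype.card τ + 1) * T) := by
    rw [← finrank_span_eq_card hv]
    refine Submodule.finrank_mono (Submodule.span_le.2 ?_)
    rintro _ ⟨p, rfl⟩
    exact hmem p
  have h2 := h1.trans (hh _ (by positivity))
  rw [mul_pow, ← mul_assoc, Fintype.card_prod, Fintype.card_fun, Fintype.card_fin] at h2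
  exact Nat.le_of_mul_le_mul_right h2 (by positivity)

/-- The `e i` are a basis of the function field over the field generated by `y`, multiplied by a
common denominator. -/
theorem HasGenericFinrank.exists_independent [Infinite k] [IsDomain A] {σ : Type*} [Fintype σ]
    {s δ : ℕ} {x : σ → A} (h : HasGenericFinrank k x s δ) (hδ : 0 < δ) :
    ∃ (y : Fin s → A) (e : Fin δ → A), (∃ a : Fin s × σ → k, ∀ i, y i = ∑ j, a (i, j) • x j) ∧
      IsTranscendenceBasis k y ∧
      ∀ c : Fin δ → MvPolynomial (Fin s) k, ∑ i, aeval y (c i) * e i = 0 → c = 0 := by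
  obtain ⟨Q, hQ, hQa⟩ := h
  obtain ⟨a, ha⟩ := MvPolynomial.exists_eval_ne_zero hQ
  obtain ⟨hy, hfin⟩ := hQa a ha _ fun i => rfl
  set y : Fin s → A := fun i => ∑ j, a (i, j) • x j with hydef
  let L := FractionRing A
  let F := IntermediateField.adjoin k (Set.range (algebraMap A L ∘ y))
  have : Module.Finite F L := Module.finite_of_finrank_pos (hfin ▸ hδ)
  let b : Module.Basis (Fin δ) F L := Module.finBasisOfFinrankEq F L hfin
  obtain ⟨d, hd⟩ := IsLocalization.exist_integer_multiples_of_finite (nonZeroDivisors A) b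
  choose e he using hd
  refine ⟨y, e, ⟨a, fun i => rfl⟩, hy, fun c hc => ?_⟩
  have hF : ∀ p : MvPolynomial (Fin s) k, algebraMap A L (aeval y p) ∈ F := by
    intro p
    have h1 : algebraMap A L (aeval y p) = aeval (algebraMap A L ∘ y) p :=
      (aeval_algebraMap_apply L y p).symm
    rw [h1]
    refine IntermediateField.algebra_adjoin_le_adjoin _ _ ?_
    rw [Algebra.adjoin_range_eq_range_aeval]
    exact ⟨p, rfl⟩
  have hd0 : algebraMap A L d ≠ 0 := by
    rw [Ne, map_eq_zero_iff _ (IsFractionRing.injective A L)]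
    exact nonZeroDivisors.ne_zero d.2
  have h1 : ∑ i, (⟨_, hF (c i)⟩ : F) • b i = 0 := by
    have h2 := congrArg (algebraMap A L) hc
    rw [map_zero, map_sum] at h2
    refine (mul_eq_zero.1 ?_).resolve_left hd0
    rw [← h2, Finset.mul_sum]
    refine Finset.sum_congr rfl fun i _ => ?_
    rw [map_mul, he, Algebra.smul_def, Algebra.smul_def]
    change algebraMap A L d * (algebraMap A L (aeval y (c i)) * b i) =
      algebraMap A L (aeval y (c i)) * (algebraMap A L d * b i)
    ring
  have h2 := Fintype.linearIndependent_iff.1 b.linearIndependent _ h1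
  funext i
  apply hy.1
  rw [Pi.zero_apply, map_zero]
  apply IsFractionRing.injective A L
  rw [map_zero]
  exact congrArg Subtype.val (h2 i)

/-- The basis `y` of `A` is completed to a transcendence basis of `B` by some generators `S`. Since
`S` is independent over `A`, comparing the coefficients of the monomials in `S` shows that the `δ`
elements that are independent over `k[y]` remain so over `k[y, S]`. Their number is then limited by
the Hilbert function of `B`. -/
theorem le_of_injective_of_hilb_le [Infinite k] [IsDomain A] {B σ ρ : Type*} [Finite σ] [Fintype ρ]
    [CommRing B] [IsDomain B] [Algebra k B] [Algebra A B] [IsScalarTower k A B] [FaithfulSMul A B]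
    {x : σ → B} (hx : Algebra.adjoin k (Set.range x) = ⊤) {c b s δ R : ℕ} (hR : tdim k B = R)
    (hh : ∀ t, 0 < t → hilb k x t ≤ c * t ^ R) {z : ρ → A} (hz : HasGenericFinrank k z s δ)
    (hδ : 0 < δ) (hb : 0 < b) (hzx : ∀ r, algebraMap A B (z r) ∈ degOneSpan k x ^ b) :
    δ ≤ c * (b * R + 1) ^ R := by
  classical
  obtain ⟨y, e, ⟨a, ha⟩, hy, he⟩ := hz.exists_independent hδ
  have halg : Algebra.IsAlgebraic (Algebra.adjoin A (Set.range x)) B := by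
    have h1 : Algebra.adjoin A (Set.range x) = ⊤ := by
      rw [eq_top_iff]
      intro t _
      have ht : t ∈ Algebra.adjoin k (Set.range x) := by rw [hx]; trivial
      exact Algebra.adjoin_induction (p := fun t _ => t ∈ Algebra.adjoin A (Set.range x))
        (fun t ht => Algebra.subset_adjoin ht)
        (fun r => by
          rw [IsScalarTower.algebraMap_apply k A B]
          exact Subalgebra.algebraMap_mem _ _)
        (fun _ _ _ _ => add_mem) (fun _ _ _ _ => mul_mem) ht
    rw [h1]
    exact ⟨fun t => isAlgebraic_algebraMap (⟨t, trivial⟩ : (⊤ : Subalgebra A B))⟩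
  obtain ⟨S, hS, hSb⟩ := exists_isTranscendenceBasis_subset (R := A) (Set.range x)
  have : Fintype S := ((Set.finite_range x).subset hS).fintype
  have htb := hy.sumElim_comp hSb
  have hcard : Fintype.card (S ⊕ Fin s) = R := by rw [htb.card_eq_tdim, hR]
  let w : S ⊕ Fin s → B := Sum.elim Subtype.val (algebraMap A B ∘ y)
  have hw : ∀ j, w j ∈ degOneSpan k x ^ b := by
    rintro (⟨_, ht⟩ | i)
    · obtain ⟨j, rfl⟩ := hS ht
      refine degOneSpan_pow_mono x hb ?_
      rw [pow_one]
      exact mem_degOneSpan x j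
    · change algebraMap A B (y i) ∈ _
      rw [ha, map_sum]
      refine Submodule.sum_mem _ fun j _ => ?_
      have h1 : algebraMap A B (a (i, j) • z j) = a (i, j) • algebraMap A B (z j) :=
        map_smul (IsScalarTower.toAlgHom k A B) _ _
      rw [h1]
      exact Submodule.smul_mem _ _ (hzx j)
  have key := card_le_of_hilb_le hx (c := c) (b := b) (τ := S ⊕ Fin s) (ι := Fin δ)
    (by rw [hcard]; exact hh) (fun _ => w) (fun _ => hw) (fun i => algebraMap A B (e i)) ?_
  · rwa [hcard, Fintype.card_fin] at key
  · intro q hq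
    let ψ : MvPolynomial (S ⊕ Fin s) k ≃ₐ[k] MvPolynomial S (MvPolynomial (Fin s) k) :=
      sumAlgEquiv k S (Fin s)
    let f : MvPolynomial S (MvPolynomial (Fin s) k) →+* MvPolynomial S A :=
      map (aeval y : MvPolynomial (Fin s) k →ₐ[k] A).toRingHom
    have hf : ∀ p, aeval (R := A) (Subtype.val : S → B) (f (ψ p)) = aeval w p := by
      intro p
      have : ((aeval (R := A) (Subtype.val : S → B)).toRingHom.comp f).comp ψ.toRingEquiv.toRingHom
          = (aeval w : MvPolynomial (S ⊕ Fin s) k →ₐ[k] B).toRingHom := by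
        apply MvPolynomial.ringHom_ext
        · intro r
          simp [ψ, f, sumAlgEquiv_C_inl, ← IsScalarTower.algebraMap_apply]
        · rintro (i | i) <;> simp [ψ, f, sumAlgEquiv_X_inl, sumAlgEquiv_X_inr, w]
      exact congrArg (fun g => g p) this
    have h1 : ∑ i, f (ψ (q i)) * C (e i) = 0 := by
      apply hSb.1
      rw [map_zero, map_sum, ← hq]
      refine Finset.sum_congr rfl fun i _ => ?_
      rw [map_mul, hf, aeval_C]
    have h2 : ∀ m, (fun i => coeff m (ψ (q i))) = 0 := by
      intro m
      apply he
      have h3 := congrArg (coeff m) h1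
      rw [coeff_sum, coeff_zero] at h3
      rw [← h3]
      refine Finset.sum_congr rfl fun i _ => ?_
      rw [mul_comm, mul_comm (f _), coeff_C_mul]
      congr 1
    funext i
    apply ψ.injective
    rw [Pi.zero_apply, map_zero]
    ext1 m
    rw [coeff_zero]
    exact congrFun (h2 m) i

end HilbertLower

/-! ### Tensor products of algebras with enough points. -/

section TensorProduct

open scoped TensorProduct

variable {k A B : Type*} [Field k] [CommRing A] [Algebra k A] [CommRing B] [Algebra k B]

/-- Evaluation of the left factor of a tensor product. -/
noncomputable def evalLeft (B : Type*) [CommRing B] [Algebra k B] (φ : A →ₐ[k] k) :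
    A ⊗[k] B →ₐ[k] B :=
  Algebra.TensorProduct.lift ((Algebra.ofId k B).comp φ) (AlgHom.id k B) fun _ _ => Commute.all _ _

theorem evalLeft_tmul (φ : A →ₐ[k] k) (a : A) (b : B) : evalLeft B φ (a ⊗ₜ b) = φ a • b := by
  simp [evalLeft, Algebra.ofId_apply, Algebra.smul_def]

theorem evalLeft_eq_sum {κ : Type*} [DecidableEq κ] (b : Module.Basis κ k B) (φ : A →ₐ[k] k) (u : A ⊗[k] B) :
    evalLeft B φ u = (TensorProduct.equivFinsuppOfBasisRight b u).sum fun i a => φ a • b i := by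
  conv_lhs => rw [← (TensorProduct.equivFinsuppOfBasisRight (M := A) b).symm_apply_apply u]
  rw [TensorProduct.equivFinsuppOfBasisRight_symm_apply, map_finsuppSum]
  simp only [evalLeft_tmul]

theorem coeff_eq_zero_of_evalLeft_eq_zero {κ : Type*} [DecidableEq κ] (b : Module.Basis κ k B) (φ : A →ₐ[k] k)
    {u : A ⊗[k] B} (h : evalLeft B φ u = 0) (i : κ) :
    φ (TensorProduct.equivFinsuppOfBasisRight b u i) = 0 := by
  rw [evalLeft_eq_sum b] at h
  have h1 := congrArg (fun t => b.repr t i) h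
  simp only [Finsupp.sum, map_sum, map_smul, Module.Basis.repr_self, map_zero,
    Finsupp.coe_zero, Pi.zero_apply, Finsupp.coe_finsetSum, Finset.sum_apply, Finsupp.smul_apply,
    Finsupp.single_apply, smul_eq_mul, mul_ite, mul_one, mul_zero] at h1
  rw [Finset.sum_ite_eq'] at h1
  split_ifs at h1 with hi
  · exact h1
  · rw [Finsupp.notMem_support_iff.1 hi, map_zero]

theorem eq_zero_of_evalLeft_eq_zero (hA : ∀ a : A, (∀ φ : A →ₐ[k] k, φ a = 0) → a = 0)
    {u : A ⊗[k] B} (h : ∀ φ : A →ₐ[k] k, evalLeft B φ u = 0) : u = 0 := by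
  classical
  let b := Module.Basis.ofVectorSpace k B
  rw [← map_eq_zero_iff _ (TensorProduct.equivFinsuppOfBasisRight (M := A) b).injective]
  ext i
  exact hA _ fun φ => coeff_eq_zero_of_evalLeft_eq_zero b φ (h φ) i

/-- If `u * v = 0`, then at every point `φ` of `A` one of the two evaluations in the domain `B`
vanishes. So each product of a coordinate of `u` with a coordinate of `v` vanishes at all points and
is zero in `A`. -/
theorem isDomain_tensorProduct [IsDomain A] [IsDomain B]
    (hA : ∀ a : A, (∀ φ : A →ₐ[k] k, φ a = 0) → a = 0) (φ₀ : A →ₐ[k] k) :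
    IsDomain (A ⊗[k] B) := by
  classical
  let b := Module.Basis.ofVectorSpace k B
  have : Nontrivial (A ⊗[k] B) := (evalLeft B φ₀).toRingHom.domain_nontrivial
  have : NoZeroDivisors (A ⊗[k] B) := by
    constructor
    intro u v huv
    have h1 : ∀ i j, TensorProduct.equivFinsuppOfBasisRight b u i *
        TensorProduct.equivFinsuppOfBasisRight b v j = 0 := by
      intro i j
      refine hA _ fun φ => ?_
      rw [map_mul]
      have h2 := congrArg (evalLeft B φ) huv
      rw [map_mul, map_zero] at h2
      rcases mul_eq_zero.1 h2 with h | h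
      · rw [coeff_eq_zero_of_evalLeft_eq_zero b φ h i, zero_mul]
      · rw [coeff_eq_zero_of_evalLeft_eq_zero b φ h j, mul_zero]
    rw [← map_eq_zero_iff _ (TensorProduct.equivFinsuppOfBasisRight (M := A) b).injective,
      ← map_eq_zero_iff (x := v) _ (TensorProduct.equivFinsuppOfBasisRight (M := A) b).injective]
    by_contra! hne
    obtain ⟨i, hi⟩ := Finsupp.ne_iff.1 hne.1
    obtain ⟨j, hj⟩ := Finsupp.ne_iff.1 hne.2
    exact mul_ne_zero hi hj (h1 i j)
  exact NoZeroDivisors.to_isDomain _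

/-- The generators of a tensor product. -/
def tensorGen {σ τ : Type*} (x : σ → A) (z : τ → B) : σ ⊕ τ → A ⊗[k] B :=
  Sum.elim (fun i => x i ⊗ₜ 1) fun j => 1 ⊗ₜ z j

theorem adjoin_range_tensorGen {σ τ : Type*} {x : σ → A} {z : τ → B}
    (hx : Algebra.adjoin k (Set.range x) = ⊤) (hz : Algebra.adjoin k (Set.range z) = ⊤) :
    Algebra.adjoin k (Set.range (tensorGen (k := k) x z)) = ⊤ := by
  have h1 := congrArg (Subalgebra.map (Algebra.TensorProduct.includeLeft : A →ₐ[k] A ⊗[k] B)) hx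
  have h2 := congrArg (Subalgebra.map (Algebra.TensorProduct.includeRight : B →ₐ[k] A ⊗[k] B)) hz
  rw [AlgHom.map_adjoin, ← Set.range_comp] at h1 h2
  rw [eq_top_iff]
  rintro u -
  induction u using TensorProduct.induction_on with
  | zero => exact zero_mem _
  | add u v hu hv => exact add_mem hu hv
  | tmul a b =>
    rw [← mul_one a, ← one_mul b, ← Algebra.TensorProduct.tmul_mul_tmul]
    refine mul_mem ?_ ?_
    · refine Algebra.adjoin_mono (s := Set.range (Algebra.TensorProduct.includeLeft ∘ x)) ?_
        (h1.ge ⟨a, trivial, rfl⟩)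
      rintro _ ⟨i, rfl⟩
      exact ⟨Sum.inl i, rfl⟩
    · refine Algebra.adjoin_mono (s := Set.range (Algebra.TensorProduct.includeRight ∘ z)) ?_
        (h2.ge ⟨b, trivial, rfl⟩)
      rintro _ ⟨i, rfl⟩
      exact ⟨Sum.inr i, rfl⟩

theorem hilb_tensorGen_le {σ τ : Type*} [Finite σ] [Finite τ] (x : σ → A) (z : τ → B) (t : ℕ) :
    hilb k (tensorGen (k := k) x z) t ≤ hilb k x t * hilb k z t := by
  let P := (degOneSpan k x).map (Algebra.TensorProduct.includeLeft : A →ₐ[k] A ⊗[k] B).toLinearMap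
  let Q := (degOneSpan k z).map (Algebra.TensorProduct.includeRight : B →ₐ[k] A ⊗[k] B).toLinearMap
  have hP1 : 1 ∈ P := ⟨1, one_mem_degOneSpan x, map_one (Algebra.TensorProduct.includeLeft : A →ₐ[k] A ⊗[k] B)⟩
  have hQ1 : 1 ∈ Q := ⟨1, one_mem_degOneSpan z, map_one (Algebra.TensorProduct.includeRight : B →ₐ[k] A ⊗[k] B)⟩
  have hle : degOneSpan k (tensorGen (k := k) x z) ≤ P * Q := by
    refine degOneSpan_le_iff.2 ⟨?_, ?_⟩
    · rw [← one_mul (1 : A ⊗[k] B)]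
      exact Submodule.mul_mem_mul hP1 hQ1
    · rintro (i | j)
      · rw [← mul_one (tensorGen x z _)]
        exact Submodule.mul_mem_mul ⟨x i, mem_degOneSpan x i, rfl⟩ hQ1
      · rw [← one_mul (tensorGen x z _)]
        exact Submodule.mul_mem_mul hP1 ⟨z j, mem_degOneSpan z j, rfl⟩
  have h1 := pow_le_pow_left' hle t
  rw [mul_pow] at h1
  have hPt : P ^ t = (degOneSpan k x ^ t).map
      (Algebra.TensorProduct.includeLeft : A →ₐ[k] A ⊗[k] B).toLinearMap :=
    (Submodule.map_pow _ _ _).symm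
  have hQt : Q ^ t = (degOneSpan k z ^ t).map
      (Algebra.TensorProduct.includeRight : B →ₐ[k] A ⊗[k] B).toLinearMap :=
    (Submodule.map_pow _ _ _).symm
  have h2 : Module.Finite k (P ^ t * Q ^ t : Submodule k (A ⊗[k] B)) :=
    Module.Finite.iff_fg.2 ((Module.Finite.iff_fg.1 inferInstance).mul
      (Module.Finite.iff_fg.1 inferInstance))
  refine (Submodule.finrank_mono h1).trans ((Submodule.finrank_mul_le _ _).trans
    (Nat.mul_le_mul ?_ ?_))
  · rw [hPt]; exact Submodule.finrank_map_le _ _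
  · rw [hQt]; exact Submodule.finrank_map_le _ _

theorem algebraicIndependent_tensorGen {ι ι' : Type*}
    (hA : ∀ a : A, (∀ φ : A →ₐ[k] k, φ a = 0) → a = 0) {y : ι → A} {z : ι' → B}
    (hy : AlgebraicIndependent k y) (hz : AlgebraicIndependent k z) :
    AlgebraicIndependent k (tensorGen (k := k) y z) := by
  let ψ := (renameEquiv k (Equiv.sumComm ι ι')).trans (sumAlgEquiv k ι' ι)
  rw [algebraicIndependent_iff]
  intro p hp
  apply ψ.injective
  rw [map_zero]
  ext1 m
  rw [coeff_zero]
  apply hy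
  rw [map_zero]
  refine hA _ fun φ => ?_
  have h1 : aeval z (map (eval fun i => φ (y i)) (ψ p)) = 0 := by
    have h2 := congrArg (evalLeft B φ) hp
    rw [map_zero] at h2
    rw [← h2]
    have : ((aeval z : MvPolynomial ι' k →ₐ[k] B).toRingHom.comp
        (map (eval fun i => φ (y i)))).comp ψ.toRingEquiv.toRingHom =
        (evalLeft B φ).toRingHom.comp (aeval (tensorGen (k := k) y z)).toRingHom := by
      apply MvPolynomial.ringHom_ext
      · intro r
        simp [ψ, sumAlgEquiv_C_inl, Algebra.algebraMap_eq_smul_one]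
      · rintro (i | i)
        · simp [ψ, sumAlgEquiv_X_inr, tensorGen, evalLeft_tmul, Algebra.smul_def]
        · simp [ψ, sumAlgEquiv_X_inl, tensorGen, evalLeft_tmul]
    exact congrArg (fun g => g p) this
  have h3 := congrArg (coeff m) (hz (h1.trans (map_zero _).symm))
  rw [coeff_map, coeff_zero] at h3
  rw [← h3]
  have : φ.comp (aeval y) = (aeval fun i => φ (y i) : MvPolynomial ι k →ₐ[k] k) := by
    ext i; simp
  exact congrArg (fun g => g (coeff m (ψ p))) this

end TensorProduct

/-! ### Degree of the closure of the image of a product. -/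

theorem Algebra.FiniteType.of_adjoin_range {k A σ : Type*} [CommRing k] [CommRing A] [Algebra k A]
    [Finite σ] {x : σ → A} (hx : Algebra.adjoin k (Set.range x) = ⊤) : Algebra.FiniteType k A :=
  ⟨⟨(Set.finite_range x).toFinset, by simpa using hx⟩⟩

theorem le_of_algHom_of_hilb_le {k A B σ ρ : Type*} [Field k] [Infinite k] [CommRing A]
    [Algebra k A] [IsDomain A] [Finite σ] [Fintype ρ] [CommRing B] [IsDomain B] [Algebra k B]
    {x : σ → B} (hx : Algebra.adjoin k (Set.range x) = ⊤) {c b s δ R : ℕ} (hR : tdim k B = R)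
    (hh : ∀ t, 0 < t → hilb k x t ≤ c * t ^ R) (f : A →ₐ[k] B) (hf : Function.Injective f)
    {z : ρ → A} (hz : HasGenericFinrank k z s δ)
    (hδ : 0 < δ) (hb : 0 < b) (hzx : ∀ r, f (z r) ∈ degOneSpan k x ^ b) :
    δ ≤ c * (b * R + 1) ^ R := by
  let := f.toRingHom.toAlgebra
  have : IsScalarTower k A B := IsScalarTower.of_algebraMap_eq fun r => (f.commutes r).symm
  have : FaithfulSMul A B := (faithfulSMul_iff_algebraMap_injective _ _).2 hf
  exact le_of_injective_of_hilb_le hx hR hh hz hδ hb hzx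

section ProductDegree

open scoped TensorProduct

variable {k σ τ ρ : Type*} [Field k]

theorem CoordRing.eq_zero_of_forall {Z : Set (ZariskiSpace σ k)} (a : CoordRing Z)
    (h : ∀ φ : CoordRing Z →ₐ[k] k, φ a = 0) : a = 0 := by
  obtain ⟨f, rfl⟩ := Ideal.Quotient.mk_surjective a
  rw [Ideal.Quotient.eq_zero_iff_mem, mem_vI]
  intro x hx
  exact h (Ideal.Quotient.liftₐ (vI Z) (zEval x) fun f hf => mem_vI.1 hf x hx)

/-- The image of a product of two sets under a map given by polynomials. -/
def polyImage (S : Set (ZariskiSpace σ k)) (T : Set (ZariskiSpace τ k))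
    (μ : ρ → MvPolynomial (σ ⊕ τ) k) : Set (ZariskiSpace ρ k) :=
  {x | ∃ s ∈ S, ∃ t ∈ T, x = fun r => aeval (Sum.elim s t : σ ⊕ τ → k) (μ r)}

/-- The pull back of functions under the map given by the polynomials `μ`. -/
noncomputable def polyPullback (S : Set (ZariskiSpace σ k)) (T : Set (ZariskiSpace τ k))
    (μ : ρ → MvPolynomial (σ ⊕ τ) k) : MvPolynomial ρ k →ₐ[k] CoordRing S ⊗[k] CoordRing T :=
  aeval fun r => aeval (tensorGen (coordFun S) (coordFun T)) (μ r)

/-- An element of the tensor product is zero if it vanishes at all pairs of points. Hence the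
coordinate ring of the closed image embeds in the tensor product, which is how its degree becomes
accessible. -/
theorem ker_polyPullback {S : Set (ZariskiSpace σ k)} {T : Set (ZariskiSpace τ k)}
    (hS : IsClosed S) (hT : IsClosed T) (μ : ρ → MvPolynomial (σ ⊕ τ) k) :
    RingHom.ker (polyPullback S T μ) = vI (closure (polyImage S T μ)) := by
  have key : ∀ (φ : CoordRing S →ₐ[k] k) (ψ : CoordRing T →ₐ[k] k) (f : MvPolynomial ρ k),
      ψ (evalLeft (CoordRing T) φ (polyPullback S T μ f)) =
      zEval (show ZariskiSpace ρ k from fun r => aeval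
        (Sum.elim (pointsEquiv hS φ).1 (pointsEquiv hT ψ).1 : σ ⊕ τ → k) (μ r)) f := by
    intro φ ψ f
    have h1 : (ψ.comp (evalLeft (CoordRing T) φ)).comp
        (aeval (tensorGen (coordFun S) (coordFun T))) = (aeval
        (Sum.elim (pointsEquiv hS φ).1 (pointsEquiv hT ψ).1 : σ ⊕ τ → k) :
          MvPolynomial (σ ⊕ τ) k →ₐ[k] k) := by
      ext i
      rcases i with i | j
      · simp [tensorGen, evalLeft_tmul]
        rfl
      · simp [tensorGen, evalLeft_tmul]
        rfl
    have h2 : (ψ.comp (evalLeft (CoordRing T) φ)).comp (polyPullback S T μ) =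
        zEval (show ZariskiSpace ρ k from fun r => aeval
        (Sum.elim (pointsEquiv hS φ).1 (pointsEquiv hT ψ).1 : σ ⊕ τ → k) (μ r)) := by
      ext r
      rw [zEval_X, AlgHom.comp_apply, polyPullback, aeval_X, ← AlgHom.comp_apply, h1]
    exact congrArg (fun g => g f) h2
  rw [vI_closure]
  ext f
  rw [RingHom.mem_ker, mem_vI]
  constructor
  · rintro hf _ ⟨s, hs, t, ht, rfl⟩
    have h1 := key ((pointsEquiv hS).symm ⟨s, hs⟩) ((pointsEquiv hT).symm ⟨t, ht⟩) f
    rw [hf, map_zero, map_zero, Equiv.apply_symm_apply, Equiv.apply_symm_apply] at h1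
    exact h1.symm
  · intro hf
    refine eq_zero_of_evalLeft_eq_zero CoordRing.eq_zero_of_forall fun φ => ?_
    refine CoordRing.eq_zero_of_forall _ fun ψ => ?_
    rw [key]
    exact hf _ ⟨_, (pointsEquiv hS φ).2, _, (pointsEquiv hT ψ).2, rfl⟩

variable [IsAlgClosed k] [Fintype σ] [Fintype τ] [Fintype ρ]

omit [IsAlgClosed k] [Fintype σ] [Fintype τ] [Fintype ρ] in
theorem isDomain_tensor_coordRing {S : Set (ZariskiSpace σ k)} {T : Set (ZariskiSpace τ k)}
    (hS : IsIrreducible S) (hSc : IsClosed S) (hT : IsIrreducible T) :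
    IsDomain (CoordRing S ⊗[k] CoordRing T) := by
  have := vI_isPrime hS
  have := vI_isPrime hT
  obtain ⟨s, hs⟩ := hS.1
  exact isDomain_tensorProduct CoordRing.eq_zero_of_forall ((pointsEquiv hSc).symm ⟨s, hs⟩)

omit [Fintype σ] [Fintype τ] in
theorem isIrreducible_closure_polyImage {S : Set (ZariskiSpace σ k)} {T : Set (ZariskiSpace τ k)}
    (hS : IsIrreducible S) (hSc : IsClosed S) (hT : IsIrreducible T) (hTc : IsClosed T)
    (μ : ρ → MvPolynomial (σ ⊕ τ) k) : IsIrreducible (closure (polyImage S T μ)) := by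
  have := isDomain_tensor_coordRing hS hSc hT
  have h1 : (vI (closure (polyImage S T μ))).IsPrime := by
    rw [← ker_polyPullback hSc hTc]
    exact RingHom.ker_isPrime _
  rw [← zSet_vI_of_isClosed (isClosed_closure (s := polyImage S T μ))]
  exact isIrreducible_zSet _

/-- A bound for `hilbConst` that does not depend on the dimension. -/
def hilbBound (N δ : ℕ) : ℕ := hilbConst N N δ

theorem hilbConst_le_hilbBound {N s δ : ℕ} (h : s ≤ N) : hilbConst N s δ ≤ hilbBound N δ :=
  Nat.mul_le_mul_right _ (Nat.pow_le_pow_right (Nat.succ_pos _) h)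

omit [Fintype ρ] [Fintype τ] [IsAlgClosed k] in
theorem tdim_le_card {A : Type*} [CommRing A] [IsDomain A] [Algebra k A] {x : σ → A}
    (hx : Algebra.adjoin k (Set.range x) = ⊤) : tdim k A ≤ Fintype.card σ := by
  have h1 : Function.Surjective (aeval x : MvPolynomial σ k →ₐ[k] A) := by
    rw [← AlgHom.range_eq_top, ← Algebra.adjoin_range_eq_range_aeval, hx]
  have := Algebra.FiniteType.of_adjoin_range hx
  rw [(IsTranscendenceBasis.mvPolynomial σ k).card_eq_tdim]
  exact tdim_le_of_surjective _ h1

/-- A bound for the degree of the image of a product. -/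
def prodBound (N M b d e : ℕ) : ℕ :=
  hilbBound N d * hilbBound M e * (b * (N + M) + 1) ^ (N + M)

/-- The Hilbert function of the tensor product is at most the product of those of the factors. The
coordinate ring of the image embeds with generators of degree at most `b`, so the lower bound for
Hilbert functions limits its degree. -/
theorem HasDegree.closure_polyImage_le {S : Set (ZariskiSpace σ k)} {T : Set (ZariskiSpace τ k)}
    (hS : IsIrreducible S) (hSc : IsClosed S) (hT : IsIrreducible T) (hTc : IsClosed T)
    {μ : ρ → MvPolynomial (σ ⊕ τ) k} {b d e δ : ℕ} (hb : 0 < b)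
    (hμ : ∀ r, μ r ∈ degOneSpan k (X : σ ⊕ τ → MvPolynomial (σ ⊕ τ) k) ^ b)
    (hd : HasDegree S d) (he : HasDegree T e) (hδ : HasDegree (closure (polyImage S T μ)) δ) :
    δ ≤ prodBound (Fintype.card σ) (Fintype.card τ) b d e := by
  have hI := isIrreducible_closure_polyImage hS hSc hT hTc μ
  have := isDomain_tensor_coordRing hS hSc hT
  have := vI_isPrime hS
  have := vI_isPrime hT
  have := vI_isPrime hI
  obtain ⟨hd0, hd'⟩ := hd.hasGenericFinrank hS hSc
  obtain ⟨he0, he'⟩ := he.hasGenericFinrank hT hTc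
  obtain ⟨hδ0, hδ'⟩ := hδ.hasGenericFinrank hI isClosed_closure
  let x := tensorGen (k := k) (coordFun S) (coordFun T)
  have hx : Algebra.adjoin k (Set.range x) = ⊤ :=
    adjoin_range_tensorGen (adjoin_range_coordFun S) (adjoin_range_coordFun T)
  have hft := Algebra.FiniteType.of_adjoin_range hx
  obtain ⟨y, hy⟩ := exists_isTranscendenceBasis_fin (k := k) (A := CoordRing S)
  obtain ⟨z, hz⟩ := exists_isTranscendenceBasis_fin (k := k) (A := CoordRing T)
  -- This inequality suffices, because the powers of a positive `t` grow with the exponent.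
  have hR : tdim k (CoordRing S) + tdim k (CoordRing T) ≤ tdim k (CoordRing S ⊗[k] CoordRing T) := by
    have := (algebraicIndependent_tensorGen CoordRing.eq_zero_of_forall hy.1 hz.1).card_le_tdim
    simpa using this
  have hRN : tdim k (CoordRing S ⊗[k] CoordRing T) ≤ Fintype.card σ + Fintype.card τ := by
    simpa using tdim_le_card hx
  let Φ : CoordRing (closure (polyImage S T μ)) →ₐ[k] CoordRing S ⊗[k] CoordRing T :=
    Ideal.Quotient.liftₐ _ (polyPullback S T μ) fun f hf => by
      rwa [← ker_polyPullback hSc hTc, RingHom.mem_ker] at hf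
  have hΦ : Function.Injective Φ := by
    rw [injective_iff_map_eq_zero]
    intro a ha
    obtain ⟨f, rfl⟩ := Ideal.Quotient.mk_surjective a
    rw [Ideal.Quotient.eq_zero_iff_mem, ← ker_polyPullback hSc hTc]
    exact ha
  have key := le_of_algHom_of_hilb_le hx
    (c := hilbBound (Fintype.card σ) d * hilbBound (Fintype.card τ) e) (b := b) rfl
    (fun t ht => ?_) Φ hΦ hδ' hδ0 hb fun r => ?_
  · refine key.trans (Nat.mul_le_mul_left _ ?_)
    exact (Nat.pow_le_pow_left (Nat.succ_le_succ (Nat.mul_le_mul_left b hRN)) _).trans (Nat.pow_le_pow_right (Nat.succ_pos _) hRN)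
  · refine (hilb_tensorGen_le _ _ t).trans ?_
    have h1 := hd'.hilb_le_mul_pow (adjoin_range_coordFun S) rfl hd0 ht
    have h2 := he'.hilb_le_mul_pow (adjoin_range_coordFun T) rfl he0 ht
    refine (Nat.mul_le_mul h1 h2).trans ?_
    rw [mul_mul_mul_comm, ← pow_add]
    refine Nat.mul_le_mul (Nat.mul_le_mul (hilbConst_le_hilbBound ?_) (hilbConst_le_hilbBound ?_))
      (Nat.pow_le_pow_right ht hR)
    · exact tdim_le_card (adjoin_range_coordFun S)
    · exact tdim_le_card (adjoin_range_coordFun T)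
  · have h1 : Φ (coordFun _ r) = aeval x (μ r) := by
      change polyPullback S T μ (X r) = _
      rw [polyPullback, aeval_X]
    have h2 : (degOneSpan k (X : σ ⊕ τ → MvPolynomial (σ ⊕ τ) k) ^ b).map (aeval x).toLinearMap ≤
        degOneSpan k x ^ b := by
      rw [Submodule.map_pow]
      refine pow_le_pow_left' ?_ b
      rw [Submodule.map_le_iff_le_comap, degOneSpan_le_iff]
      refine ⟨?_, fun i => ?_⟩
      · rw [Submodule.mem_comap, AlgHom.toLinearMap_apply, map_one]
        exact one_mem_degOneSpan x
      · rw [Submodule.mem_comap, AlgHom.toLinearMap_apply, aeval_X]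
        exact mem_degOneSpan x i
    rw [h1]
    exact h2 ⟨μ r, hμ r, rfl⟩

end ProductDegree

/-! ### Independent elements on the components of a hypersurface. -/

section Hypersurface

/-- A nonzero family of polynomials in `s + 1` variables is a power of the last variable times a
family with a member that does not vanish when the last variable is set to zero. -/
theorem exists_eq_X_pow_mul {k κ τ : Type*} [Field k] [Finite κ]
    (c : κ → MvPolynomial (Option τ) k) (hc : c ≠ 0) :
    ∃ (m : ℕ) (q : κ → MvPolynomial (Option τ) k), (∀ i, c i = X none ^ m * q i) ∧
      ∃ i, aeval (fun o : Option τ => o.elim (0 : MvPolynomial τ k) X) (q i) ≠ 0 := by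
  classical
  let ev : MvPolynomial (Option τ) k →ₐ[k] MvPolynomial τ k := aeval fun o => o.elim 0 X
  let sec : MvPolynomial τ k →ₐ[k] MvPolynomial (Option τ) k := aeval fun j => X (some j)
  have hdvd : ∀ f, ev f = 0 → X none ∣ f := by
    intro f hf
    have h1 : ∀ g : MvPolynomial (Option τ) k, X none ∣ g - sec (ev g) := by
      intro g
      induction g using MvPolynomial.induction_on with
      | C a => simp [ev, sec]
      | add p q hp hq =>
        rw [map_add, map_add, add_sub_add_comm]
        exact dvd_add hp hq
      | mul_X p i hp =>
        rw [map_mul, map_mul]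
        have : p * X i - sec (ev p) * sec (ev (X i)) =
          (p - sec (ev p)) * X i + sec (ev p) * (X i - sec (ev (X i))) := by ring
        rw [this]
        refine dvd_add (hp.mul_right _) (Dvd.dvd.mul_left ?_ _)
        rcases i with _ | j <;> simp [ev, sec]
    simpa [hf] using h1 f
  obtain ⟨i, hi⟩ := Function.ne_iff.1 hc
  have key : ∀ (D : ℕ) (c : κ → MvPolynomial (Option τ) k), c i ≠ 0 → (c i).totalDegree ≤ D →
      ∃ (m : ℕ) (q : κ → MvPolynomial (Option τ) k), (∀ i, c i = X none ^ m * q i) ∧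
      ∃ i, ev (q i) ≠ 0 := by
    intro D
    induction D with
    | zero =>
      intro c hi hD
      refine ⟨0, c, fun i => by simp, i, fun h0 => ?_⟩
      obtain ⟨q, hq⟩ := hdvd _ h0
      rw [hq] at hi hD
      have hq0 := right_ne_zero_of_mul hi
      rw [totalDegree_mul_of_isDomain (X_ne_zero _) hq0, totalDegree_X] at hD
      omega
    | succ D ih =>
      intro c hi hD
      by_cases h : ∃ j, ev (c j) ≠ 0
      · exact ⟨0, c, fun i => by simp, h⟩
      · push Not at h
        choose q hq using fun j => hdvd _ (h j)
        have hi' := hi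
        rw [hq] at hD hi'
        have hq0 := right_ne_zero_of_mul hi'
        rw [totalDegree_mul_of_isDomain (X_ne_zero _) hq0, totalDegree_X] at hD
        obtain ⟨m, q', h1, h2⟩ := ih q hq0 (by omega)
        exact ⟨m + 1, q', fun j => by rw [hq, h1, pow_succ', mul_assoc], h2⟩
  exact key _ c hi le_rfl

/-- For each component, `δ i` elements independent over its generic linear forms are lifted to `A`
and multiplied by a function that vanishes exactly on the other components among those considered.
All these elements together are independent over polynomial rings in `P` and the lifted forms, so
their number is limited by `hilb`. -/
theorem sum_le_of_hilb_le {k A ι σ : Type*} [Field k] [Infinite k] [CommRing A] [IsDomain A]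
    [Algebra k A] [Fintype ι] [Fintype σ] {x : σ → A}
    (hx : Algebra.adjoin k (Set.range x) = ⊤) {c b s : ℕ} (hb : 0 < b)
    (hh : ∀ t, 0 < t → hilb k x t ≤ c * t ^ (s + 1)) {P : A} (hP : P ≠ 0)
    (hPb : P ∈ degOneSpan k x ^ b) (B : ι → Type*) [∀ i, CommRing (B i)] [∀ i, IsDomain (B i)]
    [∀ i, Algebra k (B i)] (π : ∀ i, A →ₐ[k] B i) (hπ : ∀ i, Function.Surjective (π i))
    (hπP : ∀ i, π i P = 0) (hsep : ∀ i, ∃ f : A, π i f ≠ 0 ∧ ∀ j, j ≠ i → π j f = 0) {δ : ι → ℕ}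
    (hδ : ∀ i, 0 < δ i) (hdeg : ∀ i, HasGenericFinrank k (fun j => π i (x j)) s (δ i)) :
    ∑ i, δ i ≤ c * (b * (s + 1) + 1) ^ (s + 1) := by
  classical
  choose y e hyx hy he using fun i => (hdeg i).exists_independent (hδ i)
  choose a ha using hyx
  choose e' he' using fun i l => hπ i (e i l)
  choose f hf hf' using hsep
  let y' : ∀ i, Fin s → A := fun i l => ∑ j, a i (l, j) • x j
  have hy' : ∀ i l, π i (y' i l) = y i l := fun i l => by
    rw [ha, map_sum]
    exact Finset.sum_congr rfl fun j _ => map_smul _ _ _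
  let w : (Σ i, Fin (δ i)) → Option (Fin s) → A := fun p o => o.elim P (y' p.1)
  have key := card_le_of_hilb_le hx (c := c) (b := b) (τ := Option (Fin s)) (ι := Σ i, Fin (δ i))
    (by simpa using hh) w ?_ (fun p => f p.1 * e' p.1 p.2) ?_
  · simpa using key
  · rintro ⟨i, l⟩ (_ | j)
    · exact hPb
    · refine Submodule.sum_mem _ fun j _ => Submodule.smul_mem _ _ ?_
      refine degOneSpan_pow_mono x hb ?_
      rw [pow_one]
      exact mem_degOneSpan x j
  · intro q hq
    by_contra hne
    -- A power of `P` is cancelled from the relation until some coefficient survives at `P = 0`.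
    -- Restriction to the component `i` of that coefficient leaves only terms of this component and
    -- contradicts their independence.
    obtain ⟨m, q', hqq, ⟨i, l⟩, hil⟩ := exists_eq_X_pow_mul q hne
    have h1 : ∑ p, aeval (w p) (q' p) * (f p.1 * e' p.1 p.2) = 0 := by
      refine (mul_eq_zero.1 ?_).resolve_left (pow_ne_zero m hP)
      rw [← hq, Finset.mul_sum]
      refine Finset.sum_congr rfl fun p _ => ?_
      rw [hqq, map_mul, map_pow, aeval_X, mul_assoc]
      rfl
    have hred : ∀ p : MvPolynomial (Option (Fin s)) k, ∀ l, π i (aeval (w ⟨i, l⟩) p) =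
        aeval (y i) (aeval (fun o : Option (Fin s) => o.elim (0 : MvPolynomial (Fin s) k) X) p) := by
      intro p l
      have : (π i).comp (aeval (w ⟨i, l⟩)) = (aeval (y i)).comp
          (aeval (fun o : Option (Fin s) => o.elim (0 : MvPolynomial (Fin s) k) X)) := by
        ext (_ | j)
        · simp [w, hπP]
        · simp [w, hy']
      exact congrArg (fun g => g p) this
    have h2 : ∑ l, aeval (y i) (aeval (fun o : Option (Fin s) =>
        o.elim (0 : MvPolynomial (Fin s) k) X) (q' ⟨i, l⟩)) * e i l = 0 := by
      refine (mul_eq_zero.1 ?_).resolve_left (hf i)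
      have h3 := congrArg (π i) h1
      rw [map_zero, map_sum, Fintype.sum_sigma, Finset.sum_eq_single i] at h3
      · rw [← h3, Finset.mul_sum]
        refine Finset.sum_congr rfl fun l _ => ?_
        rw [map_mul, map_mul, hred, he']
        ring
      · intro j _ hj
        refine Finset.sum_eq_zero fun l _ => ?_
        rw [map_mul, map_mul, hf' j i hj.symm, zero_mul, mul_zero]
      · simp
    exact hil (congrFun (he i _ h2) l)

end Hypersurface

/-! ### Number and degrees of the components of a hypersurface section. -/

section Components

variable {k σ : Type*} [Field k]

theorem isClosed_of_mem_componentsOf {X : Type*} [TopologicalSpace X] {W Y : Set X}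
    (hW : IsClosed W) (hY : Y ∈ componentsOf W) : IsClosed Y := by
  have h : closure Y ⊆ Y :=
    hY.2 ⟨hY.1.1.closure, closure_minimal hY.1.2 hW⟩ subset_closure
  rw [← h.antisymm subset_closure]
  exact isClosed_closure

theorem exists_separating_polynomial {F : Finset (Set (ZariskiSpace σ k))}
    {Y : Set (ZariskiSpace σ k)} (hY : IsIrreducible Y) (hF : ∀ Y' ∈ F, IsClosed Y')
    (hne : ∀ Y' ∈ F, ¬ Y ⊆ Y') : ∃ f : MvPolynomial σ k, f ∉ vI Y ∧ ∀ Y' ∈ F, f ∈ vI Y' := by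
  have h1 : ¬ Y ⊆ ⋃₀ (F : Set (Set (ZariskiSpace σ k))) := by
    intro h
    obtain ⟨Y', hY', hsub⟩ := isIrreducible_iff_sUnion_isClosed.1 hY F hF h
    exact hne Y' hY' hsub
  obtain ⟨y, hy, hyF⟩ := Set.not_subset.1 h1
  have hcl : IsClosed (⋃₀ (F : Set (Set (ZariskiSpace σ k)))) :=
    Set.sUnion_eq_biUnion ▸ F.finite_toSet.isClosed_biUnion hF
  rw [← zSet_vI_of_isClosed hcl, mem_zSet] at hyF
  push Not at hyF
  obtain ⟨f, hf, hfy⟩ := hyF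
  exact ⟨f, fun h => hfy (mem_vI.1 h y hy), fun Y' hY' =>
    vI_anti (Set.subset_sUnion_of_mem hY') hf⟩

variable [IsAlgClosed k] [Fintype σ]

/-- By maximality of `Y`, its ideal is a minimal prime over `P` in the coordinate ring of `Z`, so
Krull's theorem applies. The dimension does drop, since `P` vanishes on `Y` and not on `Z`. -/
theorem tdim_coordRing_component {Z W Y : Set (ZariskiSpace σ k)} (hZ : IsIrreducible Z)
    (hZc : IsClosed Z) {P : MvPolynomial σ k} (hP : P ∉ vI Z)
    (hW : W = {x | x ∈ Z ∧ zEval x P = 0}) (hWc : IsClosed W) (hY : Y ∈ componentsOf W) :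
    tdim k (CoordRing Z) = tdim k (CoordRing Y) + 1 := by
  have hYc := isClosed_of_mem_componentsOf hWc hY
  have hYZ : Y ⊆ Z := fun x hx => by
    have := hY.1.2 hx
    rw [hW] at this
    exact this.1
  have hYP : P ∈ vI Y := mem_vI.2 fun x hx => by
    have := hY.1.2 hx
    rw [hW] at this
    exact this.2
  have := vI_isPrime hZ
  have := vI_isPrime hY.1.1
  have hft := Algebra.FiniteType.of_adjoin_range (adjoin_range_coordFun Z)
  refine le_antisymm ?_ (tdim_coordRing_lt hY.1.1 hYc hZ
    (hYZ.ssubset_of_ne fun h => hP (h ▸ hYP)))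
  let π : CoordRing Z →ₐ[k] CoordRing Y := Ideal.Quotient.factorₐ k (vI_anti hYZ)
  have hπ : Function.Surjective π := Ideal.Quotient.factor_surjective (vI_anti hYZ)
  have hmin : RingHom.ker π ∈ (Ideal.span {Ideal.Quotient.mk (vI Z) P}).minimalPrimes := by
    refine ⟨⟨RingHom.ker_isPrime _, ?_⟩, ?_⟩
    · rw [Ideal.span_singleton_le_iff_mem, RingHom.mem_ker]
      exact Ideal.Quotient.eq_zero_iff_mem.2 hYP
    · rintro q ⟨hq, hqP⟩ hle
      rw [Ideal.span_singleton_le_iff_mem] at hqP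
      have hq' : (q.comap (Ideal.Quotient.mk (vI Z))).IsPrime := Ideal.IsPrime.comap _
      have hle' : q.comap (Ideal.Quotient.mk (vI Z)) ≤ vI Y := by
        intro f hf
        have h1 := hle (Ideal.mem_comap.1 hf)
        exact Ideal.Quotient.eq_zero_iff_mem.1 h1
      have hsub : Y ⊆ zSet (q.comap (Ideal.Quotient.mk (vI Z))) := by
        rw [← zSet_vI_of_isClosed hYc]
        exact zSet_anti hle'
      have hirr := isIrreducible_zSet (q.comap (Ideal.Quotient.mk (vI Z)))
      have hsubW : zSet (q.comap (Ideal.Quotient.mk (vI Z))) ⊆ W := by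
        intro x hx
        rw [hW]
        refine ⟨?_, mem_zSet.1 hx P hqP⟩
        rw [← zSet_vI_of_isClosed hZc]
        refine zSet_anti (fun f hf => ?_) hx
        rw [Ideal.mem_comap, Ideal.Quotient.eq_zero_iff_mem.2 hf]
        exact q.zero_mem
      have heq := hsub.antisymm (hY.2 ⟨hirr, hsubW⟩ hsub)
      intro a ha
      obtain ⟨f, rfl⟩ := Ideal.Quotient.mk_surjective a
      have hf : f ∈ vI Y := Ideal.Quotient.eq_zero_iff_mem.1 ha
      rw [heq, vI_zSet_of_isPrime] at hf
      exact hf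
  have h1 := tdim_le_tdim_quotient_add_one (k := k)
    (fun h0 => hP (Ideal.Quotient.eq_zero_iff_mem.1 h0)) hmin
  rwa [tdim_quotient_eq_of_ker π hπ rfl] at h1

/-- A bound for the number of components and the degrees of the components of a hypersurface
section. -/
def sectionBound (N δ b : ℕ) : ℕ := hilbBound N δ * (b * N + 1) ^ N

/-- The bound is uniform over finite sets of components; that there are only finitely many
components is a consequence of it. -/
theorem exists_hasDegree_sum_le {Z W : Set (ZariskiSpace σ k)} (hZ : IsIrreducible Z)
    (hZc : IsClosed Z) {d b : ℕ} (hd : HasDegree Z d) (hb : 0 < b) {P : MvPolynomial σ k}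
    (hPb : P ∈ degOneSpan k (X : σ → MvPolynomial σ k) ^ b) (hP : P ∉ vI Z)
    (hW : W = {x | x ∈ Z ∧ zEval x P = 0}) (hWc : IsClosed W)
    (F : Finset (Set (ZariskiSpace σ k))) (hF : ∀ Y ∈ F, Y ∈ componentsOf W) :
    ∃ δ : F → ℕ, (∀ Y, 0 < δ Y ∧ HasDegree Y.1 (δ Y)) ∧
      ∑ Y, δ Y ≤ sectionBound (Fintype.card σ) d b := by
  classical
  have hFirr : ∀ Y : F, IsIrreducible Y.1 := fun Y => (hF Y.1 Y.2).1.1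
  have hFc : ∀ Y : F, IsClosed Y.1 := fun Y => isClosed_of_mem_componentsOf hWc (hF Y.1 Y.2)
  have := vI_isPrime hZ
  have hprime : ∀ Y : F, (vI Y.1).IsPrime := fun Y => vI_isPrime (hFirr Y)
  choose δ hδ hdeg hgen using fun Y : F => exists_hasDegree (hFirr Y) (hFc Y)
  refine ⟨δ, fun Y => ⟨hδ Y, hdeg Y⟩, ?_⟩
  rcases F.eq_empty_or_nonempty with rfl | ⟨Y₀, hY₀⟩
  · simp
  have hdim : ∀ Y : F, tdim k (CoordRing Z) = tdim k (CoordRing Y.1) + 1 := fun Y =>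
    tdim_coordRing_component hZ hZc hP hW hWc (hF Y.1 Y.2)
  have hYZ : ∀ Y : F, Y.1 ⊆ Z := fun Y x hx => by
    have := (hF Y.1 Y.2).1.2 hx
    rw [hW] at this
    exact this.1
  have hYP : ∀ Y : F, P ∈ vI Y.1 := fun Y => mem_vI.2 fun x hx => by
    have := (hF Y.1 Y.2).1.2 hx
    rw [hW] at this
    exact this.2
  let s := tdim k (CoordRing Y₀)
  have hs : tdim k (CoordRing Z) = s + 1 := hdim ⟨Y₀, hY₀⟩
  have hgen' : ∀ Y : F, HasGenericFinrank k (coordFun Y.1) s (δ Y) := fun Y => by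
    have h1 : tdim k (CoordRing Y.1) = s := by have := hdim Y; omega
    exact h1 ▸ hgen Y
  obtain ⟨hd0, hd'⟩ := hd.hasGenericFinrank hZ hZc
  have hsN : s + 1 ≤ Fintype.card σ := by
    have := Algebra.FiniteType.of_adjoin_range (adjoin_range_coordFun Z)
    rw [← hs]
    exact tdim_le_card (adjoin_range_coordFun Z)
  have key := sum_le_of_hilb_le (x := coordFun Z) (adjoin_range_coordFun Z)
    (c := hilbBound (Fintype.card σ) d) (b := b) (s := s) hb (fun t ht => ?_)
    (P := Ideal.Quotient.mk (vI Z) P) (fun h0 => hP (Ideal.Quotient.eq_zero_iff_mem.1 h0)) ?_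
    (fun Y : F => CoordRing Y.1) (fun Y => Ideal.Quotient.factorₐ k (vI_anti (hYZ Y)))
    (fun Y => Ideal.Quotient.factor_surjective (vI_anti (hYZ Y)))
    (fun Y => Ideal.Quotient.eq_zero_iff_mem.2 (hYP Y)) (fun Y => ?_) hδ hgen'
  · refine key.trans (Nat.mul_le_mul_left _ ?_)
    exact (Nat.pow_le_pow_left (Nat.succ_le_succ (Nat.mul_le_mul_left b hsN)) _).trans
      (Nat.pow_le_pow_right (Nat.succ_pos _) hsN)
  · refine (hd'.hilb_le_mul_pow (adjoin_range_coordFun Z) rfl hd0 ht).trans ?_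
    rw [hs]
    exact Nat.mul_le_mul_right _ (hilbConst_le_hilbBound hsN)
  · have h1 : (degOneSpan k (X : σ → MvPolynomial σ k) ^ b).map
        (Ideal.Quotient.mkₐ k (vI Z)).toLinearMap ≤ degOneSpan k (coordFun Z) ^ b := by
      rw [Submodule.map_pow]
      refine pow_le_pow_left' ?_ b
      rw [Submodule.map_le_iff_le_comap, degOneSpan_le_iff]
      refine ⟨?_, fun i => mem_degOneSpan (coordFun Z) i⟩
      rw [Submodule.mem_comap, AlgHom.toLinearMap_apply, map_one]
      exact one_mem_degOneSpan _
    exact h1 ⟨P, hPb, rfl⟩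
  · obtain ⟨f, hf, hf'⟩ := exists_separating_polynomial (F := F.erase Y.1) (hFirr Y)
      (fun Y' hY' => hFc ⟨Y', Finset.mem_of_mem_erase hY'⟩) (fun Y' hY' hsub => by
        have hm := Finset.mem_of_mem_erase hY'
        exact Finset.ne_of_mem_erase hY' ((hF Y' hm).1.2 |> fun h =>
          ((hF Y.1 Y.2).2 ⟨(hF Y' hm).1.1, h⟩ hsub).antisymm hsub))
    refine ⟨Ideal.Quotient.mk (vI Z) f, fun h0 => hf (Ideal.Quotient.eq_zero_iff_mem.1 h0),
      fun Y' hne => Ideal.Quotient.eq_zero_iff_mem.2 (hf' Y'.1 ?_)⟩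
    exact Finset.mem_erase.2 ⟨fun h => hne (Subtype.ext h), Y'.2⟩

theorem componentsOf_section_bound {Z W : Set (ZariskiSpace σ k)} (hZ : IsIrreducible Z)
    (hZc : IsClosed Z) {d b : ℕ} (hd : HasDegree Z d) (hb : 0 < b) {P : MvPolynomial σ k}
    (hPb : P ∈ degOneSpan k (X : σ → MvPolynomial σ k) ^ b) (hP : P ∉ vI Z)
    (hW : W = {x | x ∈ Z ∧ zEval x P = 0}) (hWc : IsClosed W) :
    (componentsOf W).encard ≤ sectionBound (Fintype.card σ) d b ∧
      ∀ Y ∈ componentsOf W, ∃ e ≤ sectionBound (Fintype.card σ) d b, HasDegree Y e := by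
  constructor
  · by_contra! h
    -- If there were more components than the bound, a set of one more than the bound would violate
    -- the estimate of the sum, as every degree is at least one.
    obtain ⟨S, hS, hcard⟩ := Set.exists_subset_encard_eq (Order.add_one_le_of_lt h)
    have hfin : S.Finite := Set.finite_of_encard_eq_coe (k := sectionBound (Fintype.card σ) d b + 1)
      (by rw [hcard]; rfl)
    lift S to Finset (Set (ZariskiSpace σ k)) using hfin
    obtain ⟨δ, h1, h2⟩ := exists_hasDegree_sum_le hZ hZc hd hb hPb hP hW hWc S fun Y hY => hS hY
    have h3 : ∑ _Y : S, 1 ≤ ∑ Y, δ Y := Finset.sum_le_sum fun Y _ => (h1 Y).1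
    rw [Set.encard_coe_eq_coe_finsetCard] at hcard
    have h4 : S.card = sectionBound (Fintype.card σ) d b + 1 := by exact_mod_cast hcard
    rw [Finset.sum_const, Finset.card_univ, Fintype.card_coe, smul_eq_mul, mul_one] at h3
    omega
  · intro Y hY
    obtain ⟨δ, h1, h2⟩ := exists_hasDegree_sum_le hZ hZc hd hb hPb hP hW hWc {Y}
      (fun Y' hY' => by rwa [Finset.mem_singleton.1 hY'])
    refine ⟨δ ⟨Y, Finset.mem_singleton_self Y⟩, le_trans ?_ h2, (h1 ⟨Y, Finset.mem_singleton_self Y⟩).2⟩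
    exact Finset.single_le_sum (fun _ _ => Nat.zero_le _) (Finset.mem_univ _)

end Components

/-! ### Galois descent for closed sets. -/

section GaloisDescent

theorem ZariskiSpace.continuous_of_polynomial {σ τ k : Type*} [Field k]
    (f : ZariskiSpace σ k → ZariskiSpace τ k) (q : τ → MvPolynomial σ k)
    (hf : ∀ x r, f x r = zEval x (q r)) : Continuous f := by
  rw [continuous_iff_isClosed]
  intro Z hZ
  rw [← zSet_vI_of_isClosed hZ]
  have : f ⁻¹' zSet (vI Z) = zSet ((vI Z).map (bind₁ q)) := by
    ext x
    have h1 : zEval (f x) = (zEval x).comp (bind₁ q) := by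
      ext r
      simp [hf]
    rw [Set.mem_preimage, mem_zSet, mem_zSet, h1]
    constructor
    · intro h p hp
      have : (vI Z).map (bind₁ q) ≤ RingHom.ker (zEval x) := by
        rw [Ideal.map_le_iff_le_comap]
        exact fun p hp => h p hp
      exact this hp
    · exact fun h p hp => h _ (Ideal.mem_map_of_mem _ hp)
  rw [this]
  exact isClosed_zSet _

variable {K k σ : Type*} [Field K] [Field k] [Algebra K k]

/-- The action of a field automorphism on points. -/
def galAct (τ : k ≃ₐ[K] k) (x : ZariskiSpace σ k) : ZariskiSpace σ k := fun i => τ (x i)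

theorem zEval_galAct (τ : k ≃ₐ[K] k) (x : ZariskiSpace σ k) (f : MvPolynomial σ k) :
    zEval (galAct τ x) (map (τ : k →+* k) f) = τ (zEval x f) := by
  have : (zEval (galAct τ x)).toRingHom.comp (map (τ : k →+* k)) =
      (τ : k →+* k).comp (zEval x).toRingHom := by
    apply MvPolynomial.ringHom_ext
    · intro r; simp
    · intro i; simp [galAct]
  exact congrArg (fun g => g f) this

theorem map_symm_map (τ : k ≃ₐ[K] k) (f : MvPolynomial σ k) :
    map (τ : k →+* k) (map (τ.symm : k →+* k) f) = f := by
  rw [map_map]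
  convert map_id f
  ext r
  simp

theorem continuous_galAct (τ : k ≃ₐ[K] k) :
    Continuous (galAct τ : ZariskiSpace σ k → ZariskiSpace σ k) := by
  rw [continuous_iff_isClosed]
  intro Z hZ
  rw [← zSet_vI_of_isClosed hZ]
  have : galAct τ ⁻¹' zSet (vI Z) = zSet ((vI Z).map (map (τ.symm : k →+* k))) := by
    ext x
    rw [Set.mem_preimage, mem_zSet, mem_zSet]
    have key : ∀ f, zEval (galAct τ x) f = 0 ↔ zEval x (map (τ.symm : k →+* k) f) = 0 := by
      intro f
      conv_lhs => rw [← map_symm_map τ f, zEval_galAct]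
      simp
    constructor
    · intro h p hp
      have : (vI Z).map (map (τ.symm : k →+* k)) ≤ RingHom.ker (zEval x) := by
        rw [Ideal.map_le_iff_le_comap]
        exact fun p hp => (key p).1 (h p hp)
      exact this hp
    · exact fun h p hp => (key p).2 (h _ (Ideal.mem_map_of_mem _ hp))
  rw [this]
  exact isClosed_zSet _

theorem IsDefinedOver.galAct_mem {Z : Set (ZariskiSpace σ k)} (hZ : IsDefinedOver K Z)
    (τ : k ≃ₐ[K] k) {x : ZariskiSpace σ k} (hx : x ∈ Z) : galAct τ x ∈ Z := by
  obtain ⟨S, rfl⟩ := hZ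
  intro p hp
  have h1 : (aeval (galAct τ x : σ → k) : MvPolynomial σ K →ₐ[K] k) =
      (τ : k →ₐ[K] k).comp (aeval (x : σ → k)) := by
    ext i
    exact (aeval_X _ i).trans (congrArg τ (aeval_X _ i).symm)
  rw [h1, AlgHom.comp_apply, hx p hp, map_zero]

theorem finite_range_map_algEquiv [Algebra.IsAlgebraic K k] (f : MvPolynomial σ k) :
    (Set.range fun τ : k ≃ₐ[K] k => map (τ : k →+* k) f).Finite := by
  classical
  have h1 : (Set.pi Set.univ fun m : f.support => (minpoly K (coeff m.1 f)).rootSet k).Finite :=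
    Set.Finite.pi fun m => Polynomial.rootSet_finite _ _
  refine Set.Finite.of_finite_image (f := fun q (m : f.support) => coeff m.1 q) (h1.subset ?_) ?_
  · rintro _ ⟨_, ⟨τ, rfl⟩, rfl⟩ m -
    change coeff m.1 (map (τ : k →+* k) f) ∈ _
    rw [coeff_map, Polynomial.mem_rootSet]
    refine ⟨minpoly.ne_zero (Algebra.IsIntegral.isIntegral _), ?_⟩
    change Polynomial.aeval ((τ : k →ₐ[K] k) (coeff m.1 f)) _ = 0
    rw [Polynomial.aeval_algHom_apply, minpoly.aeval, map_zero]
  · rintro _ ⟨τ, rfl⟩ _ ⟨τ', rfl⟩ h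
    ext1 m
    by_cases hm : m ∈ f.support
    · exact congrFun h ⟨m, hm⟩
    · rw [notMem_support_iff] at hm
      simp [coeff_map, hm]

theorem mem_range_map_of_forall_galois [IsGalois K k] (f : MvPolynomial σ k)
    (h : ∀ τ : k ≃ₐ[K] k, map (τ : k →+* k) f = f) :
    ∃ p : MvPolynomial σ K, map (algebraMap K k) p = f := by
  change f ∈ Set.range (map (algebraMap K k))
  rw [MvPolynomial.mem_range_map_iff_coeffs_subset]
  intro c hc
  obtain ⟨m, -, rfl⟩ := mem_coeffs_iff.1 hc
  refine (InfiniteGalois.mem_range_algebraMap_iff_fixed _).2 fun τ => ?_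
  have := congrArg (coeff m) (h τ)
  rwa [coeff_map] at this

/-- For `f` in the ideal of `Z`, the Galois orbit of `f` is finite and stays in the ideal. The monic
polynomial with this orbit as its roots has coefficients over `K`, and all but the leading one lie
in the ideal. At a common zero of the equations over `K`, this polynomial evaluated at `f` reduces
to a power of `f`, so `f` vanishes there. -/
theorem IsDefinedOver.of_galAct_mem [IsGalois K k] {Z : Set (ZariskiSpace σ k)} (hZ : IsClosed Z)
    (h : ∀ (τ : k ≃ₐ[K] k), ∀ x ∈ Z, galAct τ x ∈ Z) : IsDefinedOver K Z := by
  classical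
  refine ⟨{p | map (algebraMap K k) p ∈ vI Z}, ?_⟩
  have haeval : ∀ (x : ZariskiSpace σ k) (p : MvPolynomial σ K),
      aeval (x : σ → k) p = zEval x (map (algebraMap K k) p) := fun x p =>
    (aeval_map_algebraMap k (x : σ → k) p).symm
  ext x
  constructor
  · intro hx p hp
    rw [haeval]
    exact mem_vI.1 hp x hx
  · intro hx
    rw [← zSet_vI_of_isClosed hZ, mem_zSet]
    intro f hf
    have hfin := finite_range_map_algEquiv (K := K) f
    let O : Finset (MvPolynomial σ k) := hfin.toFinset
    have hO : ∀ q, q ∈ O ↔ ∃ τ : k ≃ₐ[K] k, map (τ : k →+* k) f = q := fun q => by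
      rw [Set.Finite.mem_toFinset]; rfl
    have hOI : ∀ q ∈ O, q ∈ vI Z := by
      intro q hq
      obtain ⟨τ, rfl⟩ := (hO q).1 hq
      rw [mem_vI]
      intro y hy
      have h1 := zEval_galAct τ (galAct τ.symm y) f
      have h2 : galAct τ (galAct τ.symm y) = y := by
        funext i
        exact τ.apply_symm_apply _
      rw [h2, mem_vI.1 hf _ (h τ.symm y hy), map_zero] at h1
      exact h1
    let p : Polynomial (MvPolynomial σ k) := ∏ q ∈ O, (Polynomial.X - Polynomial.C q)
    have hmon : p.Monic := Polynomial.monic_prod_X_sub_C _ _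
    have hdeg : p.natDegree = O.card :=
      (Polynomial.natDegree_prod_of_monic O (fun q => Polynomial.X - Polynomial.C q) fun q _ =>
        Polynomial.monic_X_sub_C q).trans (by simp)
    have hinv : ∀ τ : k ≃ₐ[K] k, p.map (map (τ : k →+* k)) = p := by
      intro τ
      simp only [p, Polynomial.map_prod, Polynomial.map_sub, Polynomial.map_X, Polynomial.map_C]
      refine Finset.prod_bij (fun q _ => map (τ : k →+* k) q) ?_ ?_ ?_ ?_
      · intro q hq
        obtain ⟨τ', rfl⟩ := (hO q).1 hq
        refine (hO _).2 ⟨τ * τ', ?_⟩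
        rw [map_map]
        rfl
      · intro q _ q' _ hqq
        exact map_injective (τ : k →+* k) τ.injective hqq
      · intro q hq
        obtain ⟨τ', rfl⟩ := (hO q).1 hq
        refine ⟨map (τ.symm : k →+* k) (map (τ' : k →+* k) f), (hO _).2 ⟨τ.symm * τ', ?_⟩,
          map_symm_map τ _⟩
        rw [map_map]
        rfl
      · intro q _
        rfl
    have hcoeffI : ∀ i, i < O.card → p.coeff i ∈ vI Z := by
      have h1 : p.map (Ideal.Quotient.mk (vI Z)) = Polynomial.X ^ O.card := by
        simp only [p, Polynomial.map_prod, Polynomial.map_sub, Polynomial.map_X, Polynomial.map_C]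
        rw [Finset.prod_congr rfl fun q hq => by
          rw [Ideal.Quotient.eq_zero_iff_mem.2 (hOI q hq), map_zero, sub_zero],
          Finset.prod_const]
      intro i hi
      rw [← Ideal.Quotient.eq_zero_iff_mem, ← Polynomial.coeff_map, h1, Polynomial.coeff_X_pow,
        if_neg hi.ne]
    have hcoeff0 : ∀ i, i < O.card → zEval x (p.coeff i) = 0 := by
      intro i hi
      obtain ⟨r, hr⟩ := mem_range_map_of_forall_galois (K := K) (p.coeff i) fun τ => by
        rw [← Polynomial.coeff_map, hinv]
      rw [← hr, ← haeval]
      refine hx r ?_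
      change map _ r ∈ vI Z
      rw [hr]
      exact hcoeffI i hi
    have hroot : Polynomial.eval f p = 0 := by
      rw [Polynomial.eval_prod]
      exact Finset.prod_eq_zero ((hO f).2 ⟨1, map_id f⟩) (by simp)
    have h1 := congrArg (zEval x) hroot
    rw [Polynomial.eval_eq_sum_range, hdeg, Finset.sum_range_succ, map_add, map_sum,
      Finset.sum_eq_zero fun i hi => by
        rw [map_mul, hcoeff0 i (Finset.mem_range.1 hi), zero_mul], zero_add, map_zero, ← hdeg,
      hmon.coeff_natDegree, one_mul, map_pow] at h1
    refine (pow_eq_zero_iff ?_).1 h1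
    rw [hdeg]
    exact (Finset.card_pos.2 ⟨f, (hO f).2 ⟨1, map_id f⟩⟩).ne'

end GaloisDescent

/-! ### The Zariski topology on the special linear group. -/

section ZariskiGroup

variable {n : ℕ} {k : Type*} [Field k]

/-- The matrix entries of an element of `SL_n` as a point of affine space. -/
def entries (g : SL(n, k)) : ZariskiSpace (Fin n × Fin n) k := fun ij => g ij.1 ij.2

theorem entries_injective : Function.Injective (entries : SL(n, k) → _) := by
  intro g h hgh
  ext i j
  exact congrFun hgh (i, j)

theorem points_eq (S : Set SL(n, k)) : points S = entries '' S := rfl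

/-- The Zariski topology on `SL_n`. -/
instance zariskiSL : TopologicalSpace SL(n, k) := TopologicalSpace.induced entries inferInstance

/-- The matrix of coordinate functions. -/
noncomputable def coordMatrix (n : ℕ) (k : Type*) [Field k] :
    Matrix (Fin n) (Fin n) (MvPolynomial (Fin n × Fin n) k) :=
  Matrix.of fun i j => X (i, j)

theorem map_zEval_coordMatrix (x : ZariskiSpace (Fin n × Fin n) k) :
    (zEval x).mapMatrix (coordMatrix n k) = Matrix.of fun i j => x (i, j) := by
  ext i j
  simp [coordMatrix]

theorem map_entries_coordMatrix (g : SL(n, k)) :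
    (zEval (entries g)).mapMatrix (coordMatrix n k) = g := by
  rw [map_zEval_coordMatrix]
  rfl

theorem isClosedEmbedding_entries :
    Topology.IsClosedEmbedding (entries : SL(n, k) → ZariskiSpace (Fin n × Fin n) k) := by
  refine ⟨⟨⟨rfl⟩, entries_injective⟩, ?_⟩
  have : Set.range (entries : SL(n, k) → _) = {x : ZariskiSpace (Fin n × Fin n) k |
      zEval x ((coordMatrix n k).det - 1) = 0} := by
    ext x
    have h1 : zEval x (coordMatrix n k).det = (Matrix.of fun i j => x (i, j)).det := by
      rw [AlgHom.map_det, map_zEval_coordMatrix]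
    rw [Set.mem_ofPred_eq, map_sub, map_one, h1, sub_eq_zero]
    constructor
    · rintro ⟨g, rfl⟩
      exact g.2
    · intro h
      exact ⟨⟨_, h⟩, rfl⟩
  rw [this]
  exact isClosed_eval_eq_zero _

theorem isClosed_points_iff {S : Set SL(n, k)} : IsClosed (points S) ↔ IsClosed S :=
  isClosedEmbedding_entries.isClosed_iff_image_isClosed.symm

theorem closure_points (S : Set SL(n, k)) : closure (points S) = points (closure S) :=
  isClosedEmbedding_entries.closure_image_eq S

theorem isIrreducible_points_iff {S : Set SL(n, k)} :
    IsIrreducible (points S) ↔ IsIrreducible S := by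
  constructor
  · rintro ⟨h1, h2⟩
    refine ⟨Set.image_nonempty.1 h1, ?_⟩
    rintro u v hu hv ⟨x, hx, hxu⟩ ⟨y, hy, hyv⟩
    obtain ⟨u', hu', rfl⟩ := isClosedEmbedding_entries.isInducing.isOpen_iff.1 hu
    obtain ⟨v', hv', rfl⟩ := isClosedEmbedding_entries.isInducing.isOpen_iff.1 hv
    obtain ⟨_, ⟨z, hz, rfl⟩, hzu⟩ := h2 u' v' hu' hv' ⟨_, ⟨x, hx, rfl⟩, hxu⟩ ⟨_, ⟨y, hy, rfl⟩, hyv⟩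
    exact ⟨z, hz, hzu⟩
  · exact fun h => h.image _ isClosedEmbedding_entries.continuous.continuousOn

theorem isConnected_points_iff {S : Set SL(n, k)} :
    IsConnected (points S) ↔ IsConnected S := by
  rw [IsConnected, IsConnected, points_eq, Set.image_nonempty,
    isClosedEmbedding_entries.isInducing.isPreconnected_image]

theorem continuous_of_polynomial (f : SL(n, k) → SL(n, k))
    (q : Fin n → Fin n → MvPolynomial (Fin n × Fin n) k)
    (hf : ∀ g i j, f g i j = zEval (entries g) (q i j)) : Continuous f := by
  rw [isClosedEmbedding_entries.isInducing.continuous_iff]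
  have h1 := ZariskiSpace.continuous_of_polynomial
    (fun x => show ZariskiSpace (Fin n × Fin n) k from fun ij => zEval x (q ij.1 ij.2))
    (fun ij => q ij.1 ij.2) fun x ij => rfl
  have h2 : (entries ∘ f : SL(n, k) → _) = (fun x => show ZariskiSpace (Fin n × Fin n) k from
      fun ij => zEval x (q ij.1 ij.2)) ∘ entries := by
    funext g ij
    exact hf g ij.1 ij.2
  rw [h2]
  exact h1.comp isClosedEmbedding_entries.continuous

/-- The Zariski topology of a product is finer than the product topology, so continuity is only used
in one variable at a time. -/
instance : SeparatelyContinuousMul SL(n, k) where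
  continuous_const_mul {h} := continuous_of_polynomial _
    (((h : Matrix (Fin n) (Fin n) k).map C) * coordMatrix n k) fun g i j => by
      change ∑ l, h.1 i l * g.1 l j = zEval (entries g) (∑ l, C (h.1 i l) * X (l, j))
      rw [map_sum]
      refine Finset.sum_congr rfl fun l _ => ?_
      rw [map_mul, zEval_C, zEval_X]
      rfl
  continuous_mul_const {h} := continuous_of_polynomial _
    (coordMatrix n k * ((h : Matrix (Fin n) (Fin n) k).map C)) fun g i j => by
      change ∑ l, g.1 i l * h.1 l j = zEval (entries g) (∑ l, X (i, l) * C (h.1 l j))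
      rw [map_sum]
      refine Finset.sum_congr rfl fun l _ => ?_
      rw [map_mul, zEval_C, zEval_X]
      rfl

instance : ContinuousInv SL(n, k) where
  continuous_inv := continuous_of_polynomial _ (coordMatrix n k).adjugate fun g i j => by
    have h1 := AlgHom.map_adjugate (zEval (entries g)) (coordMatrix n k)
    rw [map_entries_coordMatrix] at h1
    rw [Matrix.SpecialLinearGroup.coe_inv, ← h1]
    rfl

end ZariskiGroup

/-! ### Closures and connectedness of subgroups. -/

section SubgroupClosure

variable {Γ : Type*} [Group Γ] [TopologicalSpace Γ] [SeparatelyContinuousMul Γ] [ContinuousInv Γ]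

/-- The closure of a subgroup, if multiplication is separately continuous. -/
def Subgroup.separateClosure (N : Subgroup Γ) : Subgroup Γ where
  carrier := _root_.closure (N : Set Γ)
  one_mem' := _root_.subset_closure N.one_mem
  inv_mem' {a} ha := map_mem_closure continuous_inv ha fun _ => N.inv_mem
  mul_mem' {a b} ha hb := by
    -- The closure is first taken in the right factor and then in the left one, so separate
    -- continuity is enough.
    have h1 : ∀ a ∈ N, a * b ∈ _root_.closure (N : Set Γ) := fun a ha =>
      map_mem_closure (continuous_const_mul a) hb fun _ => N.mul_mem ha
    have h2 := map_mem_closure (t := _root_.closure (N : Set Γ)) (continuous_mul_const b) ha h1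
    rwa [closure_closure] at h2

omit [ContinuousInv Γ] in
-- Connected sets joining `1` to `a` and `1` to `b` give one joining `1` to `a * b`, after
-- translating the second by `a`. Inverses are treated by translating with `a⁻¹`.
theorem isPreconnected_closure_subgroup {S : Set Γ}
    (hS : ∀ a ∈ S, ∃ T ⊆ (Subgroup.closure S : Set Γ), 1 ∈ T ∧ a ∈ T ∧ IsPreconnected T) :
    IsPreconnected (Subgroup.closure S : Set Γ) := by
  have key : ∀ a ∈ Subgroup.closure S, ∃ T ⊆ (Subgroup.closure S : Set Γ),
      1 ∈ T ∧ a ∈ T ∧ IsPreconnected T := by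
    intro a ha
    induction ha using Subgroup.closure_induction with
    | mem a ha => exact hS a ha
    | one => exact ⟨{1}, by simp, rfl, rfl, isPreconnected_singleton⟩
    | mul a b ha hb iha ihb =>
      obtain ⟨T, hT, h1, h2, h3⟩ := iha
      obtain ⟨T', hT', h1', h2', h3'⟩ := ihb
      refine ⟨T ∪ (a * ·) '' T', ?_, Or.inl h1, Or.inr ⟨b, h2', rfl⟩, ?_⟩
      · rintro _ (h | ⟨c, hc, rfl⟩)
        · exact hT h
        · exact mul_mem ha (hT' hc)
      · exact h3.union a h2 ⟨1, h1', mul_one a⟩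
          (h3'.image _ (continuous_const_mul a).continuousOn)
    | inv a ha iha =>
      obtain ⟨T, hT, h1, h2, h3⟩ := iha
      refine ⟨(a⁻¹ * ·) '' T, ?_, ⟨a, h2, inv_mul_cancel a⟩, ⟨1, h1, mul_one _⟩,
        h3.image _ (continuous_const_mul _).continuousOn⟩
      rintro _ ⟨c, hc, rfl⟩
      exact mul_mem (inv_mem ha) (hT hc)
  refine isPreconnected_of_forall 1 fun a ha => ?_
  obtain ⟨T, hT, h1, h2, h3⟩ := key a ha
  exact ⟨T, hT, h1, h2, h3⟩

end SubgroupClosure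

/-! ### Generation of a simple group by conjugates of quotients. -/

section Generation

variable {K k : Type*} [Field K] [Field k] [Algebra K k] {n : ℕ}

theorem IsDefinedOver.isClosed {K k σ : Type*} [Field K] [Field k] [Algebra K k]
    {Z : Set (ZariskiSpace σ k)} (hZ : IsDefinedOver K Z) :
    IsClosed Z := by
  obtain ⟨S, rfl⟩ := hZ
  rw [ZariskiSpace.isClosed_iff]
  refine ⟨map (algebraMap K k) '' S, ?_⟩
  ext x
  constructor
  · rintro h _ ⟨p, hp, rfl⟩
    exact (aeval_map_algebraMap k (x : σ → k) p).trans (h p hp)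
  · intro h p hp
    exact (aeval_map_algebraMap k (x : σ → k) p).symm.trans (h _ ⟨p, hp, rfl⟩)

/-- The action of a field automorphism on `SL_n`. -/
def galSL (τ : k ≃ₐ[K] k) : SL(n, k) →* SL(n, k) :=
  Matrix.SpecialLinearGroup.map (τ : k →+* k)

theorem entries_galSL (τ : k ≃ₐ[K] k) (g : SL(n, k)) : entries (galSL τ g) = galAct τ (entries g) :=
  rfl

theorem continuous_galSL (τ : k ≃ₐ[K] k) : Continuous (galSL τ : SL(n, k) → SL(n, k)) := by
  rw [isClosedEmbedding_entries.isInducing.continuous_iff]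
  exact (continuous_galAct τ).comp isClosedEmbedding_entries.continuous

theorem galSL_mem {S : Set SL(n, k)} (hS : IsDefinedOver K (points S)) (τ : k ≃ₐ[K] k)
    {g : SL(n, k)} (hg : g ∈ S) : galSL τ g ∈ S := by
  obtain ⟨h, hh, heq⟩ := hS.galAct_mem τ (x := entries g) ⟨g, hg, rfl⟩
  have : h = galSL τ g := entries_injective heq
  exact this ▸ hh

/-- The conjugates of quotients of elements of `V'`. -/
def conjQuotients (G V' : Set SL(n, k)) : Set SL(n, k) :=
  {h | ∃ g ∈ G, ∃ v ∈ V', ∃ w ∈ V', h = g * v * w⁻¹ * g⁻¹}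

/-- Field automorphisms over `K` map the set of generators into itself and are continuous, so they
preserve the closure of the generated subgroup. -/
theorem isDefinedOver_closure_conjQuotients [IsGalois K k] {G V' : Set SL(n, k)}
    (hG : IsDefinedOver K (points G)) (hV' : IsDefinedOver K (points V')) :
    IsDefinedOver K (points (closure (Subgroup.closure (conjQuotients G V') : Set SL(n, k)))) := by
  refine IsDefinedOver.of_galAct_mem (isClosed_points_iff.2 isClosed_closure) ?_
  rintro τ _ ⟨g, hg, rfl⟩
  refine ⟨galSL τ g, ?_, entries_galSL τ g⟩
  refine map_mem_closure (continuous_galSL τ) hg fun h hh => ?_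
  have hle : Subgroup.closure (conjQuotients G V') ≤
      (Subgroup.closure (conjQuotients G V')).comap (galSL τ) := by
    rw [Subgroup.closure_le]
    rintro _ ⟨g, hg, v, hv, w, hw, rfl⟩
    refine Subgroup.subset_closure ⟨galSL τ g, galSL_mem hG τ hg, galSL τ v, galSL_mem hV' τ hv,
      galSL τ w, galSL_mem hV' τ hw, ?_⟩
    simp only [map_mul, map_inv]
  exact hle hh

/-- The closure `H` of the subgroup generated by the elements `g v w⁻¹ g⁻¹` is connected, normal in
`G` and defined over `K`. It is not trivial, as `V'` has two points, so `H = G` by simplicity. The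
closed set `X` is stable under `H`, hence contains a coset of `G`. -/
theorem IsSimpleAlgGroup.eq_of_mul_subset [IsGalois K k] {G : Subgroup SL(n, k)}
    {V' : Set SL(n, k)} (hG : IsSimpleAlgGroup K G) (hV'G : V' ⊆ G)
    (hV'K : IsDefinedOver K (points V')) (hV' : IsIrreducible (points V'))
    (hnt : V'.Nontrivial) {X : Set SL(n, k)} (hXG : X ⊆ G) (hX : X.Nonempty)
    (hXc : IsClosed (points X)) (h : ∀ g ∈ G, ∀ v ∈ V', ∀ w ∈ V', ∀ x ∈ X,
      x * (g * v * w⁻¹ * g⁻¹) ∈ X) : X = G := by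
  let N := Subgroup.closure (conjQuotients (G : Set SL(n, k)) V')
  have hGc := isClosed_points_iff.1 hG.isDefinedOver.isClosed
  rw [isClosed_points_iff] at hXc
  rw [isIrreducible_points_iff] at hV'
  have hNG : N ≤ G := by
    rw [Subgroup.closure_le]
    rintro _ ⟨g, hg, v, hv, w, hw, rfl⟩
    exact mul_mem (mul_mem (mul_mem hg (hV'G hv)) (inv_mem (hV'G hw))) (inv_mem hg)
  let H := N.separateClosure
  have hHG : H ≤ G := closure_minimal hNG hGc
  have hconn : IsConnected (closure (N : Set SL(n, k))) := by
    refine ⟨⟨1, subset_closure N.one_mem⟩, (isPreconnected_closure_subgroup ?_).closure⟩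
    rintro _ ⟨g, hg, v, hv, w, hw, rfl⟩
    -- This image of `V'` is connected and joins `1`, at `u = w`, to the generator, at `u = v`.
    refine ⟨(fun u => g * u * w⁻¹ * g⁻¹) '' V', ?_, ⟨w, hw, by group⟩, ⟨v, hv, rfl⟩, ?_⟩
    · rintro _ ⟨u, hu, rfl⟩
      exact Subgroup.subset_closure ⟨g, hg, u, hu, w, hw, rfl⟩
    · refine hV'.isPreirreducible.isPreconnected.image _ (Continuous.continuousOn ?_)
      exact (continuous_mul_const _).comp ((continuous_mul_const _).comp (continuous_const_mul _))
  have hnormal : (H.subgroupOf G).Normal := by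
    refine ⟨fun a ha g => ?_⟩
    rw [Subgroup.mem_subgroupOf] at ha ⊢
    have hle : N ≤ N.comap (MulAut.conj (g : SL(n, k))).toMonoidHom := by
      rw [Subgroup.closure_le]
      rintro _ ⟨g', hg', v, hv, w, hw, rfl⟩
      refine Subgroup.subset_closure ⟨g * g', mul_mem g.2 hg', v, hv, w, hw, ?_⟩
      simp [mul_assoc]
    have hc : Continuous fun a : SL(n, k) => (g : SL(n, k)) * a * (g : SL(n, k))⁻¹ :=
      (continuous_mul_const _).comp (continuous_const_mul _)
    exact map_mem_closure (s := (N : Set SL(n, k))) (t := (N : Set SL(n, k))) hc ha fun b hb => hle hb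
  have hH : IsConnectedNormalAlgSubgroup G H :=
    ⟨isClosed_points_iff.2 isClosed_closure, isConnected_points_iff.2 hconn, hHG, hnormal⟩
  have hmemH : ∀ g ∈ G, ∀ v ∈ V', ∀ w ∈ V', g * v * w⁻¹ * g⁻¹ ∈ H := fun g hg v hv w hw =>
    subset_closure (Subgroup.subset_closure ⟨g, hg, v, hv, w, hw, rfl⟩)
  rcases hG.simple H hH (isDefinedOver_closure_conjQuotients hG.isDefinedOver hV'K) with h0 | h1
  · exfalso
    obtain ⟨v, hv, w, hw, hne⟩ := hnt
    have h2 := hmemH 1 G.one_mem v hv w hw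
    rw [h0, Subgroup.mem_bot, one_mul, inv_one, mul_one, mul_inv_eq_one] at h2
    exact hne h2
  · have hXN : ∀ a ∈ N, ∀ x ∈ X, x * a ∈ X := by
      intro a ha
      induction ha using Subgroup.closure_induction'' with
      | mem a ha =>
        obtain ⟨g, hg, v, hv, w, hw, rfl⟩ := ha
        exact h g hg v hv w hw
      | inv_mem a ha =>
        obtain ⟨g, hg, v, hv, w, hw, rfl⟩ := ha
        intro x hx
        -- The inverse of a generator is the generator with `v` and `w` exchanged.
        have := h g hg w hw v hv x hx
        convert this using 2
        group
      | one => simp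
      | mul a b _ _ iha ihb =>
        intro x hx
        rw [← mul_assoc]
        exact ihb _ (iha x hx)
    have hXH : ∀ a ∈ H, ∀ x ∈ X, x * a ∈ X := by
      intro a ha x hx
      have := map_mem_closure (continuous_const_mul x) ha fun b hb => hXN b hb x hx
      rwa [hXc.closure_eq] at this
    refine hXG.antisymm fun g hg => ?_
    obtain ⟨x, hx⟩ := hX
    have hm : x⁻¹ * g ∈ H := by
      rw [h1]
      exact mul_mem (inv_mem (hXG hx)) hg
    simpa using hXH _ hm x hx

end Generation

/-! ### Separating polynomials of bounded degree. -/

theorem map_degOneSpan_pow {k A B σ : Type*} [Field k] [CommRing A] [Algebra k A] [CommRing B]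
    [Algebra k B] (f : A →ₐ[k] B) (x : σ → A) (t : ℕ) :
    (degOneSpan k x ^ t).map f.toLinearMap = degOneSpan k (fun j => f (x j)) ^ t := by
  rw [Submodule.map_pow]
  congr 1
  rw [degOneSpan, Submodule.map_span, Set.image_insert_eq, ← Set.range_comp, degOneSpan]
  congr 2
  exact map_one f

section Interpolation

variable {k σ : Type*} [Field k]

/-- By rank and nullity, the polynomials of degree at most `t` vanishing on `V` form a space of
larger dimension than those vanishing on `Y`. -/
theorem exists_mem_vI_notMem_vI {V Y : Set (ZariskiSpace σ k)} [Finite σ] {t : ℕ}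
    (h : hilb k (coordFun V) t < hilb k (coordFun Y) t) :
    ∃ p ∈ degOneSpan k (X : σ → MvPolynomial σ k) ^ t, p ∈ vI V ∧ p ∉ vI Y := by
  by_contra! hcon
  let U := degOneSpan k (X : σ → MvPolynomial σ k) ^ t
  have hrank : ∀ Z : Set (ZariskiSpace σ k), hilb k (coordFun Z) t =
      Module.finrank k (LinearMap.range ((Ideal.Quotient.mkₐ k (vI Z)).toLinearMap ∘ₗ U.subtype)) := by
    intro Z
    rw [LinearMap.range_comp, Submodule.range_subtype, map_degOneSpan_pow]
    rfl
  have hU : Module.Finite k U := inferInstance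
  have h1 := LinearMap.finrank_range_add_finrank_ker
    ((Ideal.Quotient.mkₐ k (vI V)).toLinearMap ∘ₗ U.subtype)
  have h2 := LinearMap.finrank_range_add_finrank_ker
    ((Ideal.Quotient.mkₐ k (vI Y)).toLinearMap ∘ₗ U.subtype)
  have h3 : LinearMap.ker ((Ideal.Quotient.mkₐ k (vI V)).toLinearMap ∘ₗ U.subtype) ≤
      LinearMap.ker ((Ideal.Quotient.mkₐ k (vI Y)).toLinearMap ∘ₗ U.subtype) := by
    rintro ⟨p, hp⟩ hpV
    exact Ideal.Quotient.eq_zero_iff_mem.2 (hcon p hp (Ideal.Quotient.eq_zero_iff_mem.1 hpV))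
  have h4 := Submodule.finrank_mono h3
  rw [hrank, hrank] at h
  omega

theorem pow_le_hilb {A : Type*} [CommRing A] [Algebra k A] {ι : Type*} [Fintype ι] [Finite σ]
    {x : σ → A} {y : ι → A} (hy : AlgebraicIndependent k y) (hyx : ∀ i, y i ∈ Set.range x) (m : ℕ) :
    (m + 1) ^ Fintype.card ι ≤ hilb k x (Fintype.card ι * m) := by
  classical
  let E : (ι → Fin (m + 1)) → (ι →₀ ℕ) := fun α => Finsupp.equivFunOnFinite.symm fun j => (α j : ℕ)
  have hE : Function.Injective E := by
    intro α β h
    funext j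
    exact Fin.ext (DFunLike.congr_fun h j)
  have hv : LinearIndependent k fun α : ι → Fin (m + 1) => ∏ i, y i ^ (α i : ℕ) := by
    have h1 : LinearIndependent k fun α => (monomial (E α) (1 : k) : MvPolynomial ι k) :=
      (basisMonomials ι k).linearIndependent.comp E hE
    have h2 := h1.map' (aeval y).toLinearMap (LinearMap.ker_eq_bot.2 hy)
    have h3 : (fun α : ι → Fin (m + 1) => ∏ i, y i ^ (α i : ℕ)) =
        (aeval y).toLinearMap ∘ fun α => monomial (E α) (1 : k) := by
      funext α
      simp only [Function.comp_apply, AlgHom.toLinearMap_apply, aeval_monomial, map_one, one_mul]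
      rw [Finsupp.prod_fintype _ _ fun i => pow_zero _]
      rfl
    rw [h3]
    exact h2
  have h1 : Fintype.card (ι → Fin (m + 1)) = (m + 1) ^ Fintype.card ι := by simp
  rw [← h1, ← finrank_span_eq_card hv]
  refine Submodule.finrank_mono (Submodule.span_le.2 ?_)
  rintro _ ⟨α, rfl⟩
  have := prod_pow_mem_degOneSpan_pow (k := k) (x := x) (b := 1) (w := y) (T := m)
    (α := fun i => (α i : ℕ)) (fun i => by
      obtain ⟨j, hj⟩ := hyx i
      rw [← hj, pow_one]
      exact mem_degOneSpan x j) fun i => Nat.lt_succ_iff.1 (α i).2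
  rwa [one_mul] at this

/-- The degree of a polynomial that separates a variety of degree `d` in an affine space of
dimension `N` from a larger variety. -/
def separationDegree (N d : ℕ) : ℕ := (N + 1) * (hilbBound N d * (N + 1) ^ N + 1)

/-- With `s` the dimension of `V`, the Hilbert function of `V` grows at most like `t ^ s`. That of
`Y` is at least `(m + 1) ^ (s + 1)` at `(s + 1) * m`, because `s + 1` of the coordinates are
independent on `Y`. The degree of `Y` does not enter. -/
theorem exists_separating_of_ssubset [IsAlgClosed k] [Fintype σ] {V Y : Set (ZariskiSpace σ k)}
    (hV : IsIrreducible V) (hVc : IsClosed V) (hY : IsIrreducible Y) (hlt : V ⊂ Y) {d : ℕ}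
    (hd : HasDegree V d) : ∃ p ∈ degOneSpan k (X : σ → MvPolynomial σ k) ^
      separationDegree (Fintype.card σ) d, p ∈ vI V ∧ p ∉ vI Y := by
  have := vI_isPrime hV
  have := vI_isPrime hY
  obtain ⟨hd0, hd'⟩ := hd.hasGenericFinrank hV hVc
  have hdim := tdim_coordRing_lt hV hVc hY hlt
  have := Algebra.FiniteType.of_adjoin_range (adjoin_range_coordFun V)
  have hsN := tdim_le_card (k := k) (adjoin_range_coordFun V)
  set N := Fintype.card σ
  set s := tdim k (CoordRing V)
  obtain ⟨y, hy, hyx⟩ := exists_isTranscendenceBasis_fin_of_subset (k := k) (A := CoordRing Y)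
    (s := Set.range (coordFun Y)) (by
      rw [adjoin_range_coordFun]
      exact ⟨fun t => isAlgebraic_algebraMap (⟨t, trivial⟩ : (⊤ : Subalgebra k (CoordRing Y)))⟩)
  have hy' : AlgebraicIndependent k fun i : Fin (s + 1) => y (Fin.castLE hdim i) :=
    hy.1.comp _ (Fin.castLE_injective hdim)
  -- This exceeds the constant `hilbConst N s d * (s + 1) ^ s` of the upper bound at `t = (s + 1) *
  -- m`, uniformly in `s ≤ N`.
  let m := hilbBound N d * (N + 1) ^ N + 1
  have h1 := pow_le_hilb hy' (fun i => hyx _) m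
  have h2 := hd'.hilb_le_mul_pow (adjoin_range_coordFun V) rfl hd0 (t := (s + 1) * m)
    (by positivity)
  rw [Fintype.card_fin] at h1
  have h3 : hilb k (coordFun V) ((s + 1) * m) < hilb k (coordFun Y) ((s + 1) * m) := by
    refine lt_of_le_of_lt h2 (lt_of_lt_of_le ?_ h1)
    have h4 : hilbConst N s d * (s + 1) ^ s ≤ hilbBound N d * (N + 1) ^ N := by
      refine Nat.mul_le_mul (hilbConst_le_hilbBound hsN) ?_
      exact (Nat.pow_le_pow_left (Nat.succ_le_succ hsN) _).trans
        (Nat.pow_le_pow_right (Nat.succ_pos _) hsN)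
    calc hilbConst N s d * ((s + 1) * m) ^ s = hilbConst N s d * (s + 1) ^ s * m ^ s := by
          rw [mul_pow, mul_assoc]
      _ ≤ (hilbBound N d * (N + 1) ^ N) * m ^ s := Nat.mul_le_mul_right _ h4
      _ < (m + 1) * m ^ s := by
          refine Nat.mul_lt_mul_of_pos_right ?_ (by positivity)
          omega
      _ ≤ (m + 1) * (m + 1) ^ s := Nat.mul_le_mul_left _ (Nat.pow_le_pow_left (Nat.le_succ m) _)
      _ = (m + 1) ^ (s + 1) := by rw [pow_succ']
  obtain ⟨p, hp, hpV, hpY⟩ := exists_mem_vI_notMem_vI h3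
  exact ⟨p, degOneSpan_pow_mono _ (Nat.mul_le_mul_right _ (Nat.succ_le_succ hsN)) hp, hpV, hpY⟩

end Interpolation

/-! ### Products in the special linear group as polynomial maps of degree two. -/

theorem Matrix.mul_apply_mem {k A ι : Type*} [Field k] [CommRing A] [Algebra k A] [Fintype ι]
    {P Q : Submodule k A} {M N : Matrix ι ι A} (hM : ∀ i j, M i j ∈ P) (hN : ∀ i j, N i j ∈ Q)
    (i j : ι) : (M * N) i j ∈ P * Q := by
  rw [Matrix.mul_apply]
  exact Submodule.sum_mem _ fun l _ => Submodule.mul_mem_mul (hM i l) (hN l j)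

theorem Matrix.map_C_mem_one {k σ ι : Type*} [Field k] (M : Matrix ι ι k) (i j : ι) :
    M.map (C : k →+* MvPolynomial σ k) i j ∈ (1 : Submodule k (MvPolynomial σ k)) :=
  Submodule.mem_one.2 ⟨M i j, rfl⟩

section GroupProduct

variable {n : ℕ} {k : Type*} [Field k]

/-- The polynomials that define the map `(s, t) ↦ s g t h`. -/
noncomputable def productPoly (g h : SL(n, k)) (ij : Fin n × Fin n) :
    MvPolynomial ((Fin n × Fin n) ⊕ (Fin n × Fin n)) k :=
  ((coordMatrix n k).map (rename Sum.inl) * (g : Matrix (Fin n) (Fin n) k).map C *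
    (coordMatrix n k).map (rename Sum.inr) * (h : Matrix (Fin n) (Fin n) k).map C :
      Matrix (Fin n) (Fin n) (MvPolynomial ((Fin n × Fin n) ⊕ (Fin n × Fin n)) k)) ij.1 ij.2

theorem productPoly_mem (g h : SL(n, k)) (ij : Fin n × Fin n) : productPoly g h ij ∈
    degOneSpan k (X : _ → MvPolynomial ((Fin n × Fin n) ⊕ (Fin n × Fin n)) k) ^ 2 := by
  let U := degOneSpan k (X : _ → MvPolynomial ((Fin n × Fin n) ⊕ (Fin n × Fin n)) k)
  have h1 : ∀ i j, (coordMatrix n k).map (rename Sum.inl) i j ∈ U := fun i j => by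
    rw [Matrix.map_apply, coordMatrix, Matrix.of_apply, rename_X]
    exact mem_degOneSpan _ _
  have h2 : ∀ i j, (coordMatrix n k).map (rename Sum.inr) i j ∈ U := fun i j => by
    rw [Matrix.map_apply, coordMatrix, Matrix.of_apply, rename_X]
    exact mem_degOneSpan _ _
  have := Matrix.mul_apply_mem (Matrix.mul_apply_mem (Matrix.mul_apply_mem h1
    (Matrix.map_C_mem_one g.1)) h2) (Matrix.map_C_mem_one h.1) ij.1 ij.2
  rwa [mul_one, mul_one, ← pow_two] at this

theorem aeval_productPoly (g h s t : SL(n, k)) (ij : Fin n × Fin n) :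
    aeval (Sum.elim (entries s) (entries t) : _ → k) (productPoly g h ij) =
      entries (s * g * t * h) ij := by
  let φ : MvPolynomial ((Fin n × Fin n) ⊕ (Fin n × Fin n)) k →ₐ[k] k :=
    aeval (Sum.elim (entries s) (entries t))
  have h1 : φ.mapMatrix ((coordMatrix n k).map (rename Sum.inl)) = s := by
    ext i j
    simp [φ, coordMatrix]
    rfl
  have h2 : φ.mapMatrix ((coordMatrix n k).map (rename Sum.inr)) = t := by
    ext i j
    simp [φ, coordMatrix]
    rfl
  have h3 : ∀ a : SL(n, k), φ.mapMatrix ((a : Matrix (Fin n) (Fin n) k).map C) = a := by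
    intro a
    ext i j
    simp [φ]
  change φ.mapMatrix ((coordMatrix n k).map (rename Sum.inl) *
    (g : Matrix (Fin n) (Fin n) k).map C * (coordMatrix n k).map (rename Sum.inr) *
    (h : Matrix (Fin n) (Fin n) k).map C) ij.1 ij.2 = _
  rw [map_mul, map_mul, map_mul, h1, h2, h3, h3]
  rfl

theorem polyImage_productPoly (S T : Set SL(n, k)) (g h : SL(n, k)) :
    polyImage (points S) (points T) (productPoly g h) = points (S * {g} * T * {h}) := by
  ext x
  constructor
  · rintro ⟨_, ⟨s, hs, rfl⟩, _, ⟨t, ht, rfl⟩, rfl⟩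
    refine ⟨s * g * t * h, Set.mul_mem_mul (Set.mul_mem_mul (Set.mul_mem_mul hs rfl) ht) rfl, ?_⟩
    funext ij
    exact (aeval_productPoly g h s t ij).symm
  · rintro ⟨_, ⟨_, ⟨_, ⟨s, hs, g, rfl, rfl⟩, t, ht, rfl⟩, h, rfl, rfl⟩, rfl⟩
    refine ⟨entries s, ⟨s, hs, rfl⟩, entries t, ⟨t, ht, rfl⟩, ?_⟩
    funext ij
    exact (aeval_productPoly g h s t ij).symm

variable [IsAlgClosed k]

/-- The closure of `S g T h` is irreducible if `S` and `T` are. -/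
theorem isIrreducible_closure_product {S T : Set SL(n, k)} (hS : IsIrreducible S)
    (hSc : IsClosed S) (hT : IsIrreducible T) (hTc : IsClosed T) (g h : SL(n, k)) :
    IsIrreducible (closure (S * {g} * T * {h})) := by
  rw [← isIrreducible_points_iff, ← closure_points, ← polyImage_productPoly]
  exact isIrreducible_closure_polyImage (isIrreducible_points_iff.2 hS) (isClosed_points_iff.2 hSc)
    (isIrreducible_points_iff.2 hT) (isClosed_points_iff.2 hTc) _

theorem exists_hasDegree_closure_product_le {S T : Set SL(n, k)} (hS : IsIrreducible S)
    (hSc : IsClosed S) (hT : IsIrreducible T) (hTc : IsClosed T) (g h : SL(n, k)) {d e : ℕ}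
    (hd : HasDegree (points S) d) (he : HasDegree (points T) e) :
    ∃ δ ≤ prodBound (n * n) (n * n) 2 d e,
      HasDegree (points (closure (S * {g} * T * {h}))) δ := by
  have hI := isIrreducible_points_iff.2 (isIrreducible_closure_product hS hSc hT hTc g h)
  have := vI_isPrime hI
  obtain ⟨δ, -, hδ, -⟩ := exists_hasDegree hI (isClosed_points_iff.2 isClosed_closure)
  refine ⟨δ, ?_, hδ⟩
  rw [← closure_points, ← polyImage_productPoly] at hδ
  have := HasDegree.closure_polyImage_le (isIrreducible_points_iff.2 hS)
    (isClosed_points_iff.2 hSc) (isIrreducible_points_iff.2 hT) (isClosed_points_iff.2 hTc)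
    two_pos (productPoly_mem g h) hd he hδ
  simpa only [Fintype.card_prod, Fintype.card_fin] using this

end GroupProduct

/-! ### Bounding the degree of the group. -/

theorem hilbBound_mono (N : ℕ) {δ δ' : ℕ} (h : δ ≤ δ') : hilbBound N δ ≤ hilbBound N δ' := by
  unfold hilbBound hilbConst
  gcongr

theorem prodBound_mono (N M b e : ℕ) {d d' : ℕ} (h : d ≤ d') :
    prodBound N M b d e ≤ prodBound N M b d' e :=
  Nat.mul_le_mul_right _ (Nat.mul_le_mul_right _ (hilbBound_mono N h))

theorem sectionBound_mono (N b : ℕ) {δ δ' : ℕ} (h : δ ≤ δ') :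
    sectionBound N δ b ≤ sectionBound N δ' b :=
  Nat.mul_le_mul_right _ (hilbBound_mono N h)

/-- A bound for the degree of a product of `j + 1` translates of varieties of degree `d` in
`SL_n`. -/
def iteratedBound (n d : ℕ) : ℕ → ℕ
  | 0 => d
  -- The first summand makes the sequence monotone, which covers the case that `G` has already been
  -- reached.
  | j + 1 => iteratedBound n d j + prodBound (n * n) (n * n) 2 (iteratedBound n d j) d

section DegreeBound

variable {K k : Type*} [Field K] [Field k] [Algebra K k] {n : ℕ}

theorem closure_product_subset {G : Subgroup SL(n, k)} (hG : IsClosed (G : Set SL(n, k)))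
    {S V' : Set SL(n, k)} (hS : S ⊆ G) (hV' : V' ⊆ G) {g w : SL(n, k)} (hg : g ∈ G) (hw : w ∈ V') :
    closure (S * {g} * V' * {w⁻¹ * g⁻¹}) ⊆ G := by
  refine closure_minimal ?_ hG
  rintro _ ⟨_, ⟨_, ⟨s, hs, _, rfl, rfl⟩, t, ht, rfl⟩, _, rfl, rfl⟩
  exact mul_mem (mul_mem (mul_mem (hS hs) hg) (hV' ht)) (mul_mem (inv_mem (hV' hw)) (inv_mem hg))

theorem subset_closure_product {S V' : Set SL(n, k)} {g w : SL(n, k)} (hw : w ∈ V') :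
    S ⊆ closure (S * {g} * V' * {w⁻¹ * g⁻¹}) := fun s hs => subset_closure
  ⟨s * g * w, Set.mul_mem_mul (Set.mul_mem_mul hs rfl) hw, w⁻¹ * g⁻¹, rfl, by group⟩

variable [IsGalois K k]

/-- A closed irreducible subset of `G` other than `G` grows under multiplication by a suitable
translate of `V'`. -/
theorem IsSimpleAlgGroup.exists_ssubset_closure_product {G : Subgroup SL(n, k)}
    {V' : Set SL(n, k)} (hG : IsSimpleAlgGroup K G) (hV'G : V' ⊆ G)
    (hV'K : IsDefinedOver K (points V')) (hV' : IsIrreducible V')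
    (hnt : V'.Nontrivial) {S : Set SL(n, k)} (hSG : S ⊆ G) (hS : S.Nonempty)
    (hSc : IsClosed S) (hne : S ≠ G) :
    ∃ g ∈ G, ∃ w ∈ V', S ⊂ closure (S * {g} * V' * {w⁻¹ * g⁻¹}) := by
  by_contra! hcon
  refine hne (hG.eq_of_mul_subset hV'G hV'K (isIrreducible_points_iff.2 hV') hnt hSG hS
    (isClosed_points_iff.2 hSc) fun g hg v hv w hw s hs => ?_)
  by_contra hnot
  refine hcon g hg w hw ⟨subset_closure_product hw, fun h => hnot (h (subset_closure ?_))⟩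
  exact ⟨s * g * v, Set.mul_mem_mul (Set.mul_mem_mul hs rfl) hv, w⁻¹ * g⁻¹, rfl, by group⟩

variable [IsAlgClosed k]

/-- Starting from `V'`, a set different from `G` is multiplied by a translate of `V'` that enlarges
it. The closure is again irreducible, so its dimension increases, and its degree is controlled by
the bound for products. -/
theorem IsSimpleAlgGroup.exists_closed_subset {G : Subgroup SL(n, k)} {V' : Set SL(n, k)}
    (hG : IsSimpleAlgGroup K G) (hV'G : V' ⊆ G) (hV'K : IsDefinedOver K (points V'))
    (hV' : IsIrreducible V') (hnt : V'.Nontrivial) {d' : ℕ} (hd' : HasDegree (points V') d')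
    (j : ℕ) : ∃ S ⊆ (G : Set SL(n, k)), IsClosed S ∧ IsIrreducible S ∧
      (S = G ∨ j ≤ tdim k (CoordRing (points S))) ∧
      ∃ δ ≤ iteratedBound n d' j, HasDegree (points S) δ := by
  have hGc := isClosed_points_iff.1 hG.isDefinedOver.isClosed
  have hV'c := isClosed_points_iff.1 hV'K.isClosed
  induction j with
  | zero => exact ⟨V', hV'G, hV'c, hV', Or.inr (Nat.zero_le _), d', le_rfl, hd'⟩
  | succ j ih =>
    obtain ⟨S, hSG, hSc, hSi, hS, δ, hδ, hdeg⟩ := ih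
    by_cases hSG' : S = G
    · exact ⟨S, hSG, hSc, hSi, Or.inl hSG', δ, hδ.trans (Nat.le_add_right _ _), hdeg⟩
    · obtain ⟨g, hg, w, hw, hlt⟩ :=
        hG.exists_ssubset_closure_product hV'G hV'K hV' hnt hSG hSi.1 hSc hSG'
      have hI := isIrreducible_closure_product hSi hSc hV' hV'c g (w⁻¹ * g⁻¹)
      obtain ⟨e, he, hdeg'⟩ :=
        exists_hasDegree_closure_product_le hSi hSc hV' hV'c g (w⁻¹ * g⁻¹) hdeg hd'
      refine ⟨_, closure_product_subset hGc hSG hV'G hg hw, isClosed_closure, hI, Or.inr ?_, e,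
        (he.trans (prodBound_mono _ _ _ _ hδ)).trans (Nat.le_add_left _ _), hdeg'⟩
      exact ((hS.resolve_left hSG').trans_lt (tdim_coordRing_lt (isIrreducible_points_iff.2 hSi)
        (isClosed_points_iff.2 hSc) (isIrreducible_points_iff.2 hI)
        (entries_injective.image_strictMono hlt)))

/-- The degree of `G` is bounded in terms of `n` and the degree of `V'`. -/
theorem IsSimpleAlgGroup.exists_hasDegree_le {G : Subgroup SL(n, k)} {V' : Set SL(n, k)}
    (hG : IsSimpleAlgGroup K G) (hV'G : V' ⊆ G) (hV'K : IsDefinedOver K (points V'))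
    (hV' : IsIrreducible V') (hnt : V'.Nontrivial) {d' : ℕ} (hd' : HasDegree (points V') d') :
    IsIrreducible (G : Set SL(n, k)) ∧
      ∃ δ ≤ iteratedBound n d' (n * n + 1), HasDegree (points (G : Set SL(n, k))) δ := by
  obtain ⟨S, -, -, hSi, hS, h⟩ :=
    hG.exists_closed_subset hV'G hV'K hV' hnt hd' (n * n + 1)
  have := vI_isPrime (isIrreducible_points_iff.2 hSi)
  have h1 := tdim_le_card (k := k) (adjoin_range_coordFun (points S))
  rw [Fintype.card_prod, Fintype.card_fin] at h1
  -- A dimension of `n * n + 1` is impossible in the space of matrices, so `G` has been reached, and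
  -- it inherits irreducibility from the construction.
  have h2 : S = G := hS.resolve_right (by omega)
  rw [h2] at h hSi
  exact ⟨hSi, h⟩

end DegreeBound

/-! ### Degrees of determinants, adjugates and substituted polynomials. -/

theorem det_mem_pow {k A ι : Type*} [Field k] [CommRing A] [Algebra k A] [Fintype ι]
    [DecidableEq ι] {P : Submodule k A} {M : Matrix ι ι A} (hM : ∀ i j, M i j ∈ P) :
    M.det ∈ P ^ Fintype.card ι := by
  rw [Matrix.det_apply]
  refine Submodule.sum_mem _ fun τ _ => ?_
  have h : ∏ i, M (τ i) i ∈ P ^ Fintype.card ι := by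
    rw [← Finset.card_univ]
    induction (Finset.univ : Finset ι) using Finset.induction_on with
    | empty => exact Submodule.one_le.1 le_rfl
    | insert a s ha ih =>
      rw [Finset.prod_insert ha, Finset.card_insert_of_notMem ha, pow_succ']
      exact Submodule.mul_mem_mul (hM _ _) ih
  rcases Int.units_eq_one_or (Equiv.Perm.sign τ) with h1 | h1
  · rwa [h1, one_smul]
  · rw [h1, Units.neg_smul, one_smul]
    exact Submodule.neg_mem _ h

theorem adjugate_apply_mem {k A ι : Type*} [Field k] [CommRing A] [Algebra k A] [Fintype ι]
    [DecidableEq ι] {P : Submodule k A} (hP : 1 ∈ P) {M : Matrix ι ι A} (hM : ∀ i j, M i j ∈ P)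
    (i j : ι) : M.adjugate i j ∈ P ^ Fintype.card ι := by
  rw [Matrix.adjugate_apply]
  refine det_mem_pow fun a b => ?_
  rw [Matrix.updateRow_apply]
  split_ifs with h
  · rw [Pi.single_apply]
    split_ifs
    · exact hP
    · exact P.zero_mem
  · exact hM a b

theorem aeval_mem_pow_mul {k A ρ : Type*} [Field k] [CommRing A] [Algebra k A]
    {U : Submodule k A} (hU : 1 ∈ U) {m t : ℕ} {q : ρ → A} (hq : ∀ r, q r ∈ U ^ m)
    {p : MvPolynomial ρ k} (hp : p ∈ degOneSpan k (X : ρ → MvPolynomial ρ k) ^ t) :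
    aeval q p ∈ U ^ (t * m) := by
  have h1 := Submodule.mem_map_of_mem (f := (aeval q).toLinearMap) hp
  rw [map_degOneSpan_pow] at h1
  rw [mul_comm, pow_mul]
  refine (pow_le_pow_left' ?_ t : _ ≤ (U ^ m) ^ t) h1
  rw [degOneSpan_le_iff]
  refine ⟨?_, fun r => ?_⟩
  · rw [← one_pow m]
    exact Submodule.pow_mem_pow _ hU m
  · rw [aeval_X]
    exact hq r

theorem zariskiDim_le_zero_of_subsingleton {σ k : Type*} [Field k] {Z : Set (ZariskiSpace σ k)}
    (hZ : Z.Subsingleton) : zariskiDim Z ≤ 0 := by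
  have := hZ.coe_sort
  have : Subsingleton (TopologicalSpace.IrreducibleCloseds Z) := by
    refine ⟨fun a b => ?_⟩
    ext x
    obtain ⟨y, hy⟩ := a.2.1
    obtain ⟨z, hz⟩ := b.2.1
    rw [Subsingleton.elim x y]
    exact ⟨fun _ => Subsingleton.elim z y ▸ hz, fun _ => hy⟩
  exact Order.krullDim_nonpos_of_subsingleton

/-! ### The exceptional set. -/

section Main

variable {n : ℕ} {k : Type*} [Field k]

theorem zariskiDim_points_image (e : SL(n, k) ≃ₜ SL(n, k)) (S : Set SL(n, k)) :
    zariskiDim (points (e '' S)) = zariskiDim (points S) := by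
  have h : ∀ S : Set SL(n, k), zariskiDim (points S) = topologicalKrullDim S := fun S =>
    (isClosedEmbedding_entries.isEmbedding.homeomorphImage S).isHomeomorph.topologicalKrullDim_eq.symm
  rw [h, h]
  exact (e.image S).isHomeomorph.topologicalKrullDim_eq.symm

theorem eq_of_subset_of_zariskiDim_le [IsAlgClosed k] {S T : Set SL(n, k)} (hS : IsIrreducible S)
    (hSc : IsClosed S) (hT : IsIrreducible T) (hTc : IsClosed T) (hST : S ⊆ T)
    (h : zariskiDim (points T) ≤ zariskiDim (points S)) : S = T := by
  by_contra hne
  rw [zariskiDim_eq (isIrreducible_points_iff.2 hS) (isClosed_points_iff.2 hSc),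
    zariskiDim_eq (isIrreducible_points_iff.2 hT) (isClosed_points_iff.2 hTc)] at h
  have h1 := tdim_coordRing_lt (isIrreducible_points_iff.2 hS) (isClosed_points_iff.2 hSc)
    (isIrreducible_points_iff.2 hT)
    (entries_injective.image_strictMono (hST.ssubset_of_ne hne))
  exact absurd (by exact_mod_cast h) (not_le.2 h1)

/-- Each `V g v` is an irreducible closed subset of `T` of at least the dimension of `T`, hence
equal to `T`. So `V g v = V g w` for all `v, w ∈ V'`. -/
theorem mul_mem_of_zariskiDim_closure_le [IsAlgClosed k] {V V' : Set SL(n, k)} (hV : IsIrreducible V)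
    (hVc : IsClosed V) (hV' : IsIrreducible V') (hV'c : IsClosed V') {g : SL(n, k)}
    (h : ¬ zariskiDim (points V) < zariskiDim (closure (points (V * {g} * V')))) :
    ∀ u ∈ V, ∀ v ∈ V', ∀ w ∈ V', u * g * v * w⁻¹ * g⁻¹ ∈ V := by
  let T := closure (V * {g} * V')
  have hT : IsIrreducible T := by
    have := isIrreducible_closure_product hV hVc hV' hV'c g 1
    rwa [Set.singleton_one, mul_one] at this
  rw [closure_points, not_lt] at h
  have key : ∀ v ∈ V', (Homeomorph.mulRight (g * v)) '' V = T := by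
    intro v hv
    refine eq_of_subset_of_zariskiDim_le (hV.image _ (Homeomorph.continuous _).continuousOn)
      ((Homeomorph.isClosed_image _).2 hVc) hT isClosed_closure ?_ ?_
    · rintro _ ⟨u, hu, rfl⟩
      refine subset_closure ⟨u * g, Set.mul_mem_mul hu rfl, v, hv, mul_assoc _ _ _⟩
    · rwa [zariskiDim_points_image]
  intro u hu v hv w hw
  have h1 : u * (g * v) ∈ Homeomorph.mulRight (g * w) '' V := by
    rw [key w hw, ← key v hv]
    exact ⟨u, hu, rfl⟩
  obtain ⟨u', hu', heq⟩ := h1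
  have h2 : u * g * v * w⁻¹ * g⁻¹ = u' := by
    change u' * (g * w) = u * (g * v) at heq
    rw [mul_inv_eq_iff_eq_mul, mul_inv_eq_iff_eq_mul, mul_assoc u, ← heq, mul_assoc u']
  rwa [h2]

/-- The polynomials that define the map `g ↦ u g c g⁻¹`. -/
noncomputable def conjPoly (u c : SL(n, k)) (ij : Fin n × Fin n) : MvPolynomial (Fin n × Fin n) k :=
  ((u : Matrix (Fin n) (Fin n) k).map C * coordMatrix n k *
    (c : Matrix (Fin n) (Fin n) k).map C * (coordMatrix n k).adjugate :
      Matrix (Fin n) (Fin n) (MvPolynomial (Fin n × Fin n) k)) ij.1 ij.2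

theorem conjPoly_mem (u c : SL(n, k)) (ij : Fin n × Fin n) : conjPoly u c ij ∈
    degOneSpan k (X : _ → MvPolynomial (Fin n × Fin n) k) ^ (n + 1) := by
  let U := degOneSpan k (X : _ → MvPolynomial (Fin n × Fin n) k)
  have h1 : ∀ i j, coordMatrix n k i j ∈ U := fun i j => mem_degOneSpan _ _
  have := Matrix.mul_apply_mem (Matrix.mul_apply_mem (Matrix.mul_apply_mem
    (Matrix.map_C_mem_one u.1) h1) (Matrix.map_C_mem_one c.1))
    (adjugate_apply_mem (one_mem_degOneSpan X) h1) ij.1 ij.2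
  rwa [one_mul, mul_one, Fintype.card_fin, ← pow_succ'] at this

theorem zEval_conjPoly (u c g : SL(n, k)) (ij : Fin n × Fin n) :
    zEval (entries g) (conjPoly u c ij) = entries (u * g * c * g⁻¹) ij := by
  have h3 : ∀ a : SL(n, k), (zEval (entries g)).mapMatrix
      ((a : Matrix (Fin n) (Fin n) k).map C) = a := by
    intro a
    ext i j
    simp
  have h4 := AlgHom.map_adjugate (zEval (entries g)) (coordMatrix n k)
  rw [map_entries_coordMatrix] at h4
  change (zEval (entries g)).mapMatrix ((u : Matrix (Fin n) (Fin n) k).map C * coordMatrix n k *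
    (c : Matrix (Fin n) (Fin n) k).map C * (coordMatrix n k).adjugate) ij.1 ij.2 = _
  rw [map_mul, map_mul, map_mul, h3, h3, map_entries_coordMatrix, h4,
    ← Matrix.SpecialLinearGroup.coe_inv]
  rfl

theorem zEval_aeval_conjPoly (u c g : SL(n, k)) (p : MvPolynomial (Fin n × Fin n) k) :
    zEval (entries g) (aeval (conjPoly u c) p) = zEval (entries (u * g * c * g⁻¹)) p := by
  have : (zEval (entries g)).comp (aeval (conjPoly u c)) = zEval (entries (u * g * c * g⁻¹)) := by
    ext ij
    rw [AlgHom.comp_apply, aeval_X, zEval_conjPoly, zEval_X]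
  exact congrArg (fun f => f p) this

/-- A bound for the number and the degrees of the components of the exceptional set. -/
def exceptionalBound (n d d' : ℕ) : ℕ :=
  sectionBound (n * n) (iteratedBound n d' (n * n + 1)) (separationDegree (n * n) d * (n + 1))

end Main

theorem mainTheorem6 (n d d' : ℕ) :
    ∃ C : ℕ, ∀ (K : Type*) (k : Type*) [Field K] [PerfectField K] [Field k] [Algebra K k]
      [IsAlgClosure K k] (G : Subgroup SL(n, k)) (V V' : Set SL(n, k)),
      IsSimpleAlgGroup K G →
      V ⊆ G → IsClosed (points V) → IsIrreducible (points V) →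
      V' ⊆ G → IsDefinedOver K (points V') → IsIrreducible (points V') →
      zariskiDim (points V) < zariskiDim (points (G : Set SL(n, k))) →
      0 < zariskiDim (points V') →
      HasDegree (points V) d → HasDegree (points V') d' →
      ∃ W : Set SL(n, k), W ⊂ G ∧ IsClosed (points W) ∧
        (∀ g ∈ G, g ∉ W →
          zariskiDim (points V) < zariskiDim (closure (points (V * {g} * V')))) ∧
        (componentsOf (points W)).encard ≤ C ∧
        ∀ Z ∈ componentsOf (points W), ∃ e ≤ C, HasDegree Z e := by
  refine ⟨exceptionalBound n d d', ?_⟩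
  intro K k _ _ _ _ _ G V V' hG hVG hVc hV hV'G hV'K hV' hdim hdim' hd hd'
  have : IsAlgClosed k := IsAlgClosure.isAlgClosed K
  have hGc := hG.isDefinedOver.isClosed
  have hV'c := hV'K.isClosed
  rw [isClosed_points_iff] at hVc hV'c
  rw [isIrreducible_points_iff] at hV hV'
  have hnt : V'.Nontrivial := by
    by_contra h
    rw [Set.not_nontrivial_iff] at h
    exact absurd hdim' (not_lt.2 (zariskiDim_le_zero_of_subsingleton (h.image _)))
  have hne : V ≠ G := by
    rintro rfl
    exact lt_irrefl _ hdim
  obtain ⟨hGi, δ, hδ, hGδ⟩ := hG.exists_hasDegree_le hV'G hV'K hV' hnt hd'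
  obtain ⟨g₀, hg₀, w, hw, hlt⟩ :=
    hG.exists_ssubset_closure_product hV'G hV'K hV' hnt hVG hV.1 hVc hne
  -- Separating `V` from the larger irreducible closure, rather than from a single point outside
  -- `V`, keeps the degree of `p` bounded in terms of `n` and `d`.
  obtain ⟨p, hp, hpV, hpY⟩ := exists_separating_of_ssubset (isIrreducible_points_iff.2 hV)
    (isClosed_points_iff.2 hVc) (isIrreducible_points_iff.2
      (isIrreducible_closure_product hV hVc hV' hV'c g₀ (w⁻¹ * g₀⁻¹)))
    (entries_injective.image_strictMono hlt) hd
  -- A polynomial not vanishing on the closure does not vanish on the product itself, which supplies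
  -- `u ∈ V` and `v ∈ V'` with `p` nonzero at `u g₀ v w⁻¹ g₀⁻¹`.
  rw [← closure_points, vI_closure, mem_vI] at hpY
  push Not at hpY
  obtain ⟨_, ⟨_, ⟨_, ⟨_, ⟨u, hu, g₀, rfl, rfl⟩, v, hv, rfl⟩, _, rfl, rfl⟩, rfl⟩, hne0⟩ := hpY
  -- As a function of `g` this is `p (u g v w⁻¹ g⁻¹)` with `u, v, w` fixed. It is nonzero at `g₀`
  -- and vanishes at every exceptional `g`, so its zeros in `G` are taken as `W`.
  let P := aeval (conjPoly u (v * w⁻¹)) p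
  have hP : ∀ g, zEval (entries g) P = zEval (entries (u * g * (v * w⁻¹) * g⁻¹)) p :=
    fun g => zEval_aeval_conjPoly u (v * w⁻¹) g p
  have hPg₀ : zEval (entries g₀) P ≠ 0 := by
    rw [hP]
    have h : u * g₀ * (v * w⁻¹) * g₀⁻¹ = u * g₀ * v * (w⁻¹ * g₀⁻¹) := by group
    rw [h]
    exact hne0
  have hPU : P ∈ degOneSpan k (X : _ → MvPolynomial (Fin n × Fin n) k) ^
      (separationDegree (n * n) d * (n + 1)) := by
    rw [Fintype.card_prod, Fintype.card_fin] at hp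
    exact aeval_mem_pow_mul (one_mem_degOneSpan X) (conjPoly_mem u _) hp
  have hWeq : points {g : SL(n, k) | g ∈ G ∧ zEval (entries g) P = 0} =
      {x | x ∈ points (G : Set SL(n, k)) ∧ zEval x P = 0} := by
    ext x
    constructor
    · rintro ⟨g, ⟨hg, hg0⟩, rfl⟩
      exact ⟨⟨g, hg, rfl⟩, hg0⟩
    · rintro ⟨⟨g, hg, rfl⟩, hg0⟩
      exact ⟨g, ⟨hg, hg0⟩, rfl⟩
  have hWc : IsClosed (points {g : SL(n, k) | g ∈ G ∧ zEval (entries g) P = 0}) := by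
    rw [hWeq]
    exact hGc.inter (isClosed_eval_eq_zero P)
  obtain ⟨h1, h2⟩ := componentsOf_section_bound (isIrreducible_points_iff.2 hGi) hGc hGδ
    (by unfold separationDegree; positivity) hPU
    (fun h => hPg₀ (mem_vI.1 h _ ⟨g₀, hg₀, rfl⟩)) hWeq hWc
  have hle : sectionBound (Fintype.card (Fin n × Fin n)) δ
      (separationDegree (n * n) d * (n + 1)) ≤ exceptionalBound n d d' := by
    rw [Fintype.card_prod, Fintype.card_fin]
    exact sectionBound_mono _ _ hδ
  refine ⟨_, ⟨fun g hg => hg.1, fun h => hPg₀ (h hg₀).2⟩, hWc, fun g hg hgW => ?_,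
    h1.trans (by exact_mod_cast hle), fun Z hZ => ?_⟩
  · by_contra hcon
    refine hgW ⟨hg, ?_⟩
    rw [hP, ← mul_assoc]
    exact mem_vI.1 hpV _ ⟨_, mul_mem_of_zariskiDim_closure_le hV hVc hV' hV'c hcon u hu v hv w hw, rfl⟩
  · obtain ⟨e, he, hZe⟩ := h2 Z hZ
    exact ⟨e, he.trans hle, hZe⟩
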